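/- **Setting.** For a Schwartz function $\varphi$ put $\hat\varphi(\omega)=\int_{\mathbb R}\varphi(t)e^{-it\omega}\,dt$, and write $\mathcal F[g]$ for the Fourier transform of a tempered distribution $g$, $\langle \mathcal F[g],\varphi\rangle=\langle g,\hat\varphi\rangle$; write $\tilde f(x)=f(-x)$ and $K^+(t)=K(t)1_{\{t\ge 0\}}$. Let $\nu$ be a non-negative Borel measure on $\mathbb R$, absolutely continuous with respect to Lebesgue measure, with $\int(1+x^2)^{-k}\,\nu(dx)<\infty$ for some integer $k$. Let $\xi$ be a mean-zero Gaussian random measure with respect to $\nu$ on a probability space, i.e. $\mathbb E[\xi(E_1)\overline{\xi(E_2)}]=\nu(E_1\cap E_2)$ for Borel sets $E_1,E_2$ of finite $\nu$-measure. Let $\mathrm{Dom}(V)$ be the set of tempered distributions $g$ whose Fourier transform $\mathcal F[g]$ is a (locally integrable) function lying in $L^2(\nu)$, and for $g\in\mathrm{Dom}(V)$ put $\langle V,g\rangle=\int_{\mathbb R}\overline{\mathcal F[g](\omega)}\,\xi(d\omega)$. For $\beta>0$ and $K:\mathbb R\to\mathbb R$, $V$ is a *weak solution* of the generalized Langevin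 equation with $m=\lambda=0$ if $K^+*\varphi\in\mathrm{Dom}(V)$ for all real Schwartz $\varphi$ and, for all real Schwartz $\varphi,\psi$, $$\mathbb E\Big[\big\langle V,\beta\,\widetilde{K^+*\tilde\varphi}\big\rangle\,\overline{\big\langle V,\beta\,\widetilde{K^+*\tilde\psi}\big\rangle}\Big]=\mathbb E\Big[\langle\sqrt\beta F,\varphi\rangle\overline{\langle\sqrt\beta F,\psi\rangle}\Big],$$ where $F$ is a random distribution with $\mathbb E[\langle F,\varphi\rangle\overline{\langle F,\psi\rangle}]=\int_{\mathbb R} K(t)\,(\varphi*\tilde\psi)(t)\,dt$. **Assumptions on $K$** (the value $K(0)$, possibly infinite, is understood as $\lim_{t\to0^+}K(t)$). 1. $K$ is symmetric, positive off $0$, locally integrable, tends to $0$ at $\infty$ and is eventually decreasing; the improper integral $\int_0^\infty K(t)\cos(\omega t)\,dt$ converges to a positive number for every $\omega\ne0$; and either $K\in L^1(\mathbb R)$, or $K\notin L^1(\mathbb R)$ and $\lim_{t\to\infty}t^{\alpha}K(t)\in(0,\infty)$ for some $\alpha\in(0,1)$. 2. $K\in C^2(0,\infty)$ is convex on $(0,\infty)$,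 $K''$ is monotone near the origin, and for some $\sigma\in(0,1)$ one of the following holds: (i) $K(0)$ is finite and $\lim_{t\to0^+}t^{\sigma}K'(t)=0$; or (ii) $K(0)$ is infinite and $\lim_{t\to0^+}t^{1-\sigma}K(t)\in(0,\infty)$. **Theorem.** Let $\beta>0$, let $K$ satisfy Assumptions 1 and 2 with exponent $\sigma$, and let $V$ be a weak solution of the generalized Langevin equation with $m=\lambda=0$. Then: * the velocity process is not well defined: $\delta_t\notin\mathrm{Dom}(V)$ for every $t\in\mathbb R$; * the position process $X(t)=\langle V,1_{[0,t]}\rangle$ is well defined: $1_{[0,t]}\in\mathrm{Dom}(V)$ for every $t\ge0$; * for every $T>0$ there is a constant $C=C(T)>0$ such that $\mathbb E|X(t)-X(s)|^2\le C|t-s|^{(1-\sigma)/2}$ for all $s,t\in[0,T]$; * $X$ is a.s. continuous, that is, $\{X(t)\}_{t\ge0}$ has a version with continuous paths. -/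

import Mathlib

open MeasureTheory ProbabilityTheory Filter Topology
open scoped SchwartzMap FourierTransform ENNReal ComplexConjugate

noncomputable section

namespace GLE

/-! ## The memory kernel

Only the values of `K` off the origin matter; the (possibly infinite) value "`K(0)`" is the limit of
`K(t)` as `t → 0⁺`. -/

/-- General assumptions on the memory kernel. -/
structure KernelAssumption (K : ℝ → ℝ) : Prop where
  symm : ∀ t, K (-t) = K t
  pos : ∀ t, t ≠ 0 → 0 < K t
  tendsto_zero : Tendsto K atTop (𝓝 0)
  eventually_decreasing : ∃ A, AntitoneOn K (Set.Ici A)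
  locallyIntegrable : LocallyIntegrable K volume
  /-- the improper cosine integral converges to a positive number for `ω ≠ 0` -/
  cos_pos : ∀ ω : ℝ, ω ≠ 0 → ∃ c : ℝ, 0 < c ∧
    Tendsto (fun T : ℝ => ∫ t in (0 : ℝ)..T, K t * Real.cos (ω * t)) atTop (𝓝 c)
  /-- `K` is integrable, or it is not but `K(t) ~ t ^ (-α)` (up to a positive constant) -/
  tail : Integrable K volume ∨
    (¬ Integrable K volume ∧ ∃ α : ℝ, 0 < α ∧ α < 1 ∧ ∃ c : ℝ, 0 < c ∧
      Tendsto (fun t : ℝ => K t / t ^ (-α)) atTop (𝓝 c))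

/-- `K ∈ C²(0,∞)` is convex and `K''` is monotone near the origin. -/
structure ConvexKernel (K : ℝ → ℝ) : Prop where
  contDiffOn : ContDiffOn ℝ 2 K (Set.Ioi 0)
  convexOn : ConvexOn ℝ (Set.Ioi 0) K
  monotone_near_zero : ∃ ε : ℝ, 0 < ε ∧
    (MonotoneOn (deriv (deriv K)) (Set.Ioo 0 ε) ∨ AntitoneOn (deriv (deriv K)) (Set.Ioo 0 ε))

/-- `K(0)` is finite and `t ^ σ₁ * K'(t) → 0` as `t → 0⁺`, with `σ₁ ∈ (0,1)`. -/
structure FiniteAtZero (K : ℝ → ℝ) (σ₁ : ℝ) : Prop where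
  pos : 0 < σ₁
  lt_one : σ₁ < 1
  finite : ∃ L : ℝ, Tendsto K (𝓝[>] 0) (𝓝 L)
  deriv_lim : Tendsto (fun t : ℝ => t ^ σ₁ * deriv K t) (𝓝[>] 0) (𝓝 0)

/-- `K(0)` is infinite and `t ^ σ₂ * K(t)` has a limit in `(0,∞)` as `t → 0⁺`, with
`σ₂ ∈ (0,1)`. -/
structure InfiniteAtZero (K : ℝ → ℝ) (σ₂ : ℝ) : Prop where
  pos : 0 < σ₂
  lt_one : σ₂ < 1
  infinite : Tendsto K (𝓝[>] 0) atTop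
  power_lim : ∃ c : ℝ, 0 < c ∧ Tendsto (fun t : ℝ => t ^ σ₂ * K t) (𝓝[>] 0) (𝓝 c)

/-! ## Fourier transform of tempered distributions -/

/-- The dilation `ω ↦ ω / (2π)` of the line. -/
def dilation : ℝ ≃L[ℝ] ℝ :=
  ContinuousLinearEquiv.unitsEquivAut ℝ
    (Units.mk0 (2 * Real.pi)⁻¹ (inv_ne_zero Real.two_pi_pos.ne'))

/-- The Fourier transform `φ̂(ω) = ∫ φ(t) e^{-itω} dt` of a Schwartz function
(see `schwartzFourier_apply`). -/
def schwartzFourier (φ : 𝓢(ℝ, ℂ)) : 𝓢(ℝ, ℂ) :=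
  SchwartzMap.compCLMOfContinuousLinearEquiv ℂ dilation (𝓕 φ)

theorem schwartzFourier_apply (φ : 𝓢(ℝ, ℂ)) (ω : ℝ) :
    schwartzFourier φ ω = ∫ t : ℝ, φ t * Complex.exp (-(Complex.I * t * ω)) := by
  have h : schwartzFourier φ ω = 𝓕 (φ : ℝ → ℂ) (ω * (2 * Real.pi)⁻¹) := by
    simp [schwartzFourier, dilation, SchwartzMap.fourier_coe]
  rw [h, Real.fourier_real_eq_integral_exp_smul]
  refine integral_congr_ae (Eventually.of_forall fun t => ?_)
  have hpi : (Real.pi : ℂ) ≠ 0 := by exact_mod_cast Real.pi_ne_zero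
  simp only [smul_eq_mul]
  rw [mul_comm]
  congr 2
  push_cast
  field_simp

/-- The Fourier transform (in the sense of tempered distributions) of `g` is the locally integrable
function `h`, i.e. `⟨g, φ̂⟩ = ∫ h φ` for all smooth compactly supported `φ`. -/
def IsFourierFunction (g : 𝓢'(ℝ, ℂ)) (h : ℝ → ℂ) : Prop :=
  LocallyIntegrable h volume ∧
    ∀ φ : 𝓢(ℝ, ℂ), HasCompactSupport φ → g (schwartzFourier φ) = ∫ ω : ℝ, h ω * φ ω

theorem IsFourierFunction.ae_eq {g : 𝓢'(ℝ, ℂ)} {h₁ h₂ : ℝ → ℂ}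
    (H₁ : IsFourierFunction g h₁) (H₂ : IsFourierFunction g h₂) : h₁ =ᵐ[volume] h₂ := by
  refine ae_eq_of_integral_contDiff_smul_eq H₁.1 H₂.1 fun f hf hc => ?_
  have hc' : HasCompactSupport (fun x => (f x : ℂ)) :=
    hc.comp_left (g := fun x : ℝ => (x : ℂ)) (by simp)
  have hf' : ContDiff ℝ (⊤ : ℕ∞) (fun x => (f x : ℂ)) :=
    Complex.ofRealCLM.contDiff.comp hf
  have e := (H₁.2 (hc'.toSchwartzMap hf') hc').symm.trans (H₂.2 (hc'.toSchwartzMap hf') hc')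
  simpa [mul_comm] using e

/-- `f` defines a tempered distribution by integration. -/
def IsTempered (f : ℝ → ℂ) : Prop :=
  ∃ g : 𝓢'(ℝ, ℂ), ∀ φ : 𝓢(ℝ, ℂ),
    Integrable (fun t => f t * φ t) volume ∧ g φ = ∫ t, f t * φ t

open Classical in
/-- The tempered distribution `φ ↦ ∫ f φ` (zero if `f` does not define one). -/
def ofFun (f : ℝ → ℂ) : 𝓢'(ℝ, ℂ) :=
  if hf : IsTempered f then hf.choose else 0

theorem ofFun_apply {f : ℝ → ℂ} (hf : IsTempered f) (φ : 𝓢(ℝ, ℂ)) :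
    ofFun f φ = ∫ t, f t * φ t := by
  rw [ofFun, dif_pos hf]
  exact (hf.choose_spec φ).2

/-! ## Random measures and stochastic integrals -/

section RandomMeasure

variable {Ω : Type*} [MeasurableSpace Ω]

/-- The Borel sets of finite `ν`-measure. -/
def FiniteSet (ν : Measure ℝ) : Type := {E : Set ℝ // MeasurableSet E ∧ ν E < ∞}

/-- A random measure with respect to `ν`: a map `ξ` from the Borel sets of finite `ν`-measure to
`L²(Ω)` with `E[ξ(E₁) conj ξ(E₂)] = ν(E₁ ∩ E₂)`. -/
structure RandomMeasure (ν : Measure ℝ) (P : Measure Ω) where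
  toFun : FiniteSet ν → Lp ℂ 2 P
  cov : ∀ E₁ E₂ : FiniteSet ν,
    ∫ x, toFun E₁ x * conj (toFun E₂ x) ∂P = (ν.real (E₁.1 ∩ E₂.1) : ℂ)

/-- The random measure is mean zero and (jointly) Gaussian. -/
structure RandomMeasure.IsGaussian {ν : Measure ℝ} {P : Measure Ω} (ξ : RandomMeasure ν P) :
    Prop where
  mean : ∀ E, ∫ x, ξ.toFun E x ∂P = 0
  gaussian : IsGaussianProcess (fun E x => ξ.toFun E x) P

/-- The indicator of a set of finite measure, as an element of `L²(ν)`. -/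
def indic {ν : Measure ℝ} (E : FiniteSet ν) : Lp ℂ 2 ν :=
  indicatorConstLp 2 E.2.1 E.2.2.ne (1 : ℂ)

/-- Finite linear combinations of indicators `∑ cᵢ 1_{Eᵢ}`, in `L²(ν)`. -/
def simpleFun (ν : Measure ℝ) : (FiniteSet ν →₀ ℂ) →ₗ[ℂ] Lp ℂ 2 ν :=
  Finsupp.linearCombination ℂ indic

/-- The stochastic integral `∑ cᵢ ξ(Eᵢ)` of a finite linear combination of indicators. -/
def RandomMeasure.simpleInt {ν : Measure ℝ} {P : Measure Ω} (ξ : RandomMeasure ν P) :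
    (FiniteSet ν →₀ ℂ) →ₗ[ℂ] Lp ℂ 2 P :=
  Finsupp.linearCombination ℂ ξ.toFun

/-- The stochastic integral `g ↦ ∫ g dξ`: the continuous extension of `simpleInt` to `L²(ν)`. -/
def RandomMeasure.stochInt {ν : Measure ℝ} {P : Measure Ω} (ξ : RandomMeasure ν P) :
    Lp ℂ 2 ν →L[ℂ] Lp ℂ 2 P :=
  ξ.simpleInt.extendOfNorm (simpleFun ν)

theorem inner_indic {ν : Measure ℝ} (E₁ E₂ : FiniteSet ν) :
    inner ℂ (indic E₁) (indic E₂) = (ν.real (E₁.1 ∩ E₂.1) : ℂ) := by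
  rw [indic, L2.inner_indicatorConstLp_one]
  rw [indic, integral_congr_ae (ae_restrict_of_ae indicatorConstLp_coeFn)]
  rw [setIntegral_indicator E₂.2.1]
  simp

theorem RandomMeasure.inner_toFun {ν : Measure ℝ} {P : Measure Ω} (ξ : RandomMeasure ν P)
    (E₁ E₂ : FiniteSet ν) :
    inner ℂ (ξ.toFun E₁) (ξ.toFun E₂) = (ν.real (E₁.1 ∩ E₂.1) : ℂ) := by
  rw [L2.inner_def, Set.inter_comm, ← ξ.cov E₂ E₁]
  refine integral_congr_ae (Eventually.of_forall fun x => ?_)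
  simp [RCLike.inner_apply]

theorem RandomMeasure.norm_simpleInt {ν : Measure ℝ} {P : Measure Ω} (ξ : RandomMeasure ν P)
    (c : FiniteSet ν →₀ ℂ) : ‖ξ.simpleInt c‖ = ‖simpleFun ν c‖ := by
  have h : (inner ℂ (ξ.simpleInt c) (ξ.simpleInt c) : ℂ)
      = inner ℂ (simpleFun ν c) (simpleFun ν c) := by
    simp only [RandomMeasure.simpleInt, simpleFun, Finsupp.linearCombination_apply,
      Finsupp.sum, sum_inner, inner_sum, inner_smul_left, inner_smul_right, ξ.inner_toFun,
      inner_indic]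
  rw [inner_self_eq_norm_sq_to_K, inner_self_eq_norm_sq_to_K] at h
  have h' : ‖ξ.simpleInt c‖ ^ 2 = ‖simpleFun ν c‖ ^ 2 := by exact_mod_cast h
  exact (pow_left_inj₀ (norm_nonneg _) (norm_nonneg _) two_ne_zero).1 h'

theorem denseRange_simpleFun (ν : Measure ℝ) : DenseRange (simpleFun ν) := by
  intro f
  refine Lp.induction (p := 2) (by norm_num)
    (motive := fun f : Lp ℂ 2 ν => f ∈ closure (Set.range (simpleFun ν))) ?_ ?_ ?_ f
  · intro c s hs hμs
    refine subset_closure ⟨Finsupp.single ⟨s, hs, hμs⟩ c, ?_⟩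
    rw [Lp.simpleFunc.coe_indicatorConst]
    have h1 : simpleFun ν (Finsupp.single ⟨s, hs, hμs⟩ c) =
        c • indicatorConstLp 2 hs hμs.ne (1 : ℂ) := Finsupp.linearCombination_single ℂ c _
    rw [h1]
    refine Lp.ext ?_
    filter_upwards [Lp.coeFn_smul c (indicatorConstLp 2 hs hμs.ne (1 : ℂ)),
      indicatorConstLp_coeFn (p := 2) (hs := hs) (hμs := hμs.ne) (c := (1 : ℂ)),
      indicatorConstLp_coeFn (p := 2) (hs := hs) (hμs := hμs.ne) (c := c)] with x h2 h3 h4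
    rw [h2, h4, Pi.smul_apply, h3]
    by_cases hx : x ∈ s <;> simp [hx]
  · intro f g hf hg _ h₁ h₂
    have : closure (Set.range (simpleFun ν))
        = ((LinearMap.range (simpleFun ν)).topologicalClosure : Set (Lp ℂ 2 ν)) := rfl
    rw [this] at h₁ h₂ ⊢
    exact Submodule.add_mem _ h₁ h₂
  · exact isClosed_closure

/-- `∫ 1_E dξ = ξ(E)`. -/
theorem RandomMeasure.stochInt_indic {ν : Measure ℝ} {P : Measure Ω} (ξ : RandomMeasure ν P)
    (E : FiniteSet ν) : ξ.stochInt (indic E) = ξ.toFun E := by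
  have h := LinearMap.extendOfNorm_eq (f := ξ.simpleInt) (e := simpleFun ν)
    (denseRange_simpleFun ν) ⟨1, fun c => by rw [one_mul, ξ.norm_simpleInt]⟩ (Finsupp.single E 1)
  simpa [simpleFun, RandomMeasure.simpleInt, RandomMeasure.stochInt] using h

/-- The stochastic integral is an isometry. -/
theorem RandomMeasure.norm_stochInt {ν : Measure ℝ} {P : Measure Ω} (ξ : RandomMeasure ν P)
    (g : Lp ℂ 2 ν) : ‖ξ.stochInt g‖ = ‖g‖ := by
  refine (denseRange_simpleFun ν).induction_on
    (p := fun g : Lp ℂ 2 ν => ‖ξ.stochInt g‖ = ‖g‖) g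
    (isClosed_eq (by fun_prop) (by fun_prop)) fun c => ?_
  have h := LinearMap.extendOfNorm_eq (f := ξ.simpleInt) (e := simpleFun ν)
    (denseRange_simpleFun ν) ⟨1, fun c => by rw [one_mul, ξ.norm_simpleInt]⟩ c
  rw [RandomMeasure.stochInt, h, ξ.norm_simpleInt]

/-! ## The extended stationary random distribution -/

/-- The domain of the operator `Φ` with spectral measure `ν`: the tempered distributions whose
Fourier transform is a function in `L²(ν)`. -/
def Dom (ν : Measure ℝ) : Set 𝓢'(ℝ, ℂ) :=
  {g | ∃ h : ℝ → ℂ, IsFourierFunction g h ∧ MemLp h 2 ν}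

/-- The function `f` is (i.e. defines) a tempered distribution in the domain of `Φ`. -/
def FunInDom (ν : Measure ℝ) (f : ℝ → ℂ) : Prop := IsTempered f ∧ ofFun f ∈ Dom ν

open Classical in
/-- `⟨Φ, g⟩ = ∫ conj (𝓕[g](ω)) ξ(dω)` for `g` in the domain (and `0` otherwise). For absolutely
continuous `ν` it does not depend on the choice of the function `𝓕[g]`, see `RandomMeasure.op_eq`. -/
def RandomMeasure.op {ν : Measure ℝ} {P : Measure Ω} (ξ : RandomMeasure ν P) (g : 𝓢'(ℝ, ℂ)) :
    Lp ℂ 2 P :=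
  if hg : g ∈ Dom ν then ξ.stochInt (MemLp.toLp _ hg.choose_spec.2.star) else 0

theorem RandomMeasure.op_eq {ν : Measure ℝ} {P : Measure Ω} (ξ : RandomMeasure ν P)
    (hν : ν ≪ volume) {g : 𝓢'(ℝ, ℂ)} {h : ℝ → ℂ} (hg : IsFourierFunction g h)
    (hh : MemLp h 2 ν) : ξ.op g = ξ.stochInt (MemLp.toLp (star h) hh.star) := by
  have hg' : g ∈ Dom ν := ⟨h, hg, hh⟩
  rw [RandomMeasure.op, dif_pos hg']
  congr 1
  rw [MemLp.toLp_eq_toLp_iff]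
  filter_upwards [hν.ae_le (hg'.choose_spec.1.ae_eq hg)] with x hx
  simp [hx]

/-- `X(t) = ⟨Φ, 1_{[0,t]}⟩`, for `t ≥ 0`. -/
def RandomMeasure.position {ν : Measure ℝ} {P : Measure Ω} (ξ : RandomMeasure ν P) (t : ℝ) :
    Lp ℂ 2 P :=
  ξ.op (ofFun ((Set.Icc 0 t).indicator fun _ => 1))

end RandomMeasure

/-! ## Weak solutions of the generalized Langevin equation -/

/-- `f̃(x) = f(-x)`. -/
def refl (f : ℝ → ℝ) : ℝ → ℝ := fun x => f (-x)

/-- `(f * g)(x) = ∫ f(u) g(x - u) du`. -/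
def conv (f g : ℝ → ℝ) : ℝ → ℝ := fun x => ∫ u, f u * g (x - u)

/-- `K⁺(t) = K(t) 1_{t ≥ 0}`. -/
def causal (K : ℝ → ℝ) : ℝ → ℝ := (Set.Ici 0).indicator K

/-- The function `-m φ' + λ φ + β (K⁺ * φ̃)~` against which `V` is tested. -/
def testFun (m lam β : ℝ) (K φ : ℝ → ℝ) : ℝ → ℝ := fun t =>
  -m * deriv φ t + lam * φ t + β * refl (conv (causal K) (refl φ)) t

section Weak

variable {Ω Ω' : Type*} [MeasurableSpace Ω] [MeasurableSpace Ω']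

/-- White noise: a random distribution on the (real) Schwartz functions with covariance
`E[⟨W, φ⟩ conj ⟨W, ψ⟩] = ∫ φ ψ`. -/
def IsWhiteNoise {Q : Measure Ω'} (W : 𝓢(ℝ, ℝ) →ₗ[ℝ] Lp ℂ 2 Q) : Prop :=
  ∀ φ ψ : 𝓢(ℝ, ℝ), ∫ x, W φ x * conj (W ψ x) ∂Q = ((∫ t, φ t * ψ t : ℝ) : ℂ)

/-- A random distribution on the (real) Schwartz functions with covariance distribution `K`. -/
def HasCovariance {Q : Measure Ω'} (F : 𝓢(ℝ, ℝ) →ₗ[ℝ] Lp ℂ 2 Q) (K : ℝ → ℝ) : Prop :=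
  ∀ φ ψ : 𝓢(ℝ, ℝ), ∫ x, F φ x * conj (F ψ x) ∂Q = ((∫ t, K t * conv φ (refl ψ) t : ℝ) : ℂ)

/-- `V = ξ.op`, the extended stationary random distribution with spectral measure `ν` and random
measure `ξ`, is a weak solution of the generalized Langevin equation
`m V' = -λ V - β K⁺ * V + √β F + √(2λ) W`.
Absolute continuity of `ν` is what makes the operator `ξ.op` well defined. -/
structure IsWeakSolution {ν : Measure ℝ} {P : Measure Ω} {Q : Measure Ω'} (m lam β : ℝ) (K : ℝ → ℝ)
    (W F : 𝓢(ℝ, ℝ) →ₗ[ℝ] Lp ℂ 2 Q) (ξ : RandomMeasure ν P) : Prop where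
  tempered : ∃ k : ℕ, ∫⁻ x, ENNReal.ofReal (1 / (1 + x ^ 2) ^ k) ∂ν < ∞
  absolutelyContinuous : ν ≪ volume
  dom : ∀ φ : 𝓢(ℝ, ℝ), FunInDom ν (fun t => (conv (causal K) φ t : ℂ))
  eqn : ∀ φ ψ : 𝓢(ℝ, ℝ),
    ∫ x, ξ.op (ofFun fun t => (testFun m lam β K φ t : ℂ)) x *
        conj (ξ.op (ofFun fun t => (testFun m lam β K ψ t : ℂ)) x) ∂P =
      ∫ x, (√(2 * lam) • W φ + √β • F φ) x * conj ((√(2 * lam) • W ψ + √β • F ψ) x) ∂Q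

end Weak

end GLE

end

/-! Write `Z(ω) = ∫₀^∞ K(t) e^{iωt} dt` (`halfTransform`) and let `p` be the density of `ν`. Testing
the equation on Fourier transforms of even real functions `θ` supported away from `0` turns it into
`πβ ∫ θ₁θ₂ |Z|² dν = ∫ θ₁θ₂ Z dω` (`IsWeakSolution.integral_evenTest`). As `Z(-ω)` is the conjugate
of `Z(ω)`, this says `(p(ω) + p(-ω)) πβ |Z(ω)|² = 2 Re Z(ω)` for a.e. `ω > 0`
(`DecayingKernel.density_eq`). Every assertion then depends on the size of `Re Z / |Z|²` at high
frequency.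

That size comes from convexity. With `g = -K'` and `h = K''`, both nonnegative, integration by parts
gives formally `ω Im Z = ∫ g (1 - cos ωt)` and `ω² Re Z = ∫ h (1 - cos ωt)`, so the integral over
any window is a lower bound. Upper bounds come from cutting at `t = 1/ω` and using oscillation
beyond. Together with the behaviour of `K` at `0⁺` they yield `c ≤ Re Z / |Z|² ≤ M ω^σ` for large
`ω` (`spectral_bounds`).

The lower bound makes `ν` infinite. The transform of `δ_t` has modulus one, so it is not in `L²(ν)`.
The upper bound makes `max(1,|ω|)^{-r}` `ν`-integrable for every `r > 1 + σ`. The transform of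
`1_{[s,t]}` is at most `min(|t-s|, 2/|ω|)`, and interpolating between the two bounds gives
`E|X(t)-X(s)|² ≤ C |t-s|^ρ` for `ρ = (1-σ)/2`. Gaussian equivalence of moments raises this to
`E|X(t)-X(s)|^{4/ρ} ≤ C' |t-s|²`, and a dyadic Kolmogorov argument produces the continuous version.
-/

namespace GLE

/-! ### Convex decreasing kernels. -/

/-- `K` is positive, integrable near the origin, and convex on `(0,∞)` with derivatives `K' = -g`,
`K'' = h`, and decreases to `0` at infinity. -/
structure DecayingKernel (K g h : ℝ → ℝ) : Prop where
  hasDerivAt : ∀ t, 0 < t → HasDerivAt K (-g t) t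
  hasDerivAt' : ∀ t, 0 < t → HasDerivAt g (-h t) t
  continuousOn : ContinuousOn h (Set.Ioi 0)
  nonneg' : ∀ t, 0 < t → 0 ≤ g t
  nonneg'' : ∀ t, 0 < t → 0 ≤ h t
  pos : ∀ t, 0 < t → 0 < K t
  tendsto_zero : Tendsto K atTop (𝓝 0)
  intervalIntegrable : ∀ a b, IntervalIntegrable K volume a b

/-- Convexity makes `K'` monotone, and `K' ≤ 0` far out because `K` eventually decreases. Comparing
`t` with a later point gives `K' ≤ 0` on all of `(0,∞)`. -/
theorem KernelAssumption.decayingKernel {K : ℝ → ℝ} (hK : KernelAssumption K)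
    (hc : ConvexKernel K) :
    DecayingKernel K (fun t => -deriv K t) (deriv (deriv K)) := by
  have h2 : ContDiffOn ℝ (1 + 1) K (Set.Ioi 0) := hc.contDiffOn
  obtain ⟨d1, -, h1⟩ := (contDiffOn_succ_iff_deriv_of_isOpen isOpen_Ioi).1 h2
  have h1' : ContDiffOn ℝ (0 + 1) (deriv K) (Set.Ioi 0) := by simpa using h1
  obtain ⟨d2, -, h0⟩ := (contDiffOn_succ_iff_deriv_of_isOpen isOpen_Ioi).1 h1'
  have hd1 : ∀ t, 0 < t → DifferentiableAt ℝ K t := fun t ht =>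
    (d1 t ht).differentiableAt (Ioi_mem_nhds ht)
  have hd2 : ∀ t, 0 < t → DifferentiableAt ℝ (deriv K) t := fun t ht =>
    (d2 t ht).differentiableAt (Ioi_mem_nhds ht)
  have hmono : MonotoneOn (deriv K) (Set.Ioi 0) := hc.convexOn.monotoneOn_deriv hd1
  have hneg : ∀ t, 0 < t → deriv K t ≤ 0 := by
    intro t ht
    obtain ⟨A, hA⟩ := hK.eventually_decreasing
    set y := max t (A + 1)
    have hy : 0 < y := lt_of_lt_of_le ht (le_max_left _ _)
    have hyA : A < y := lt_of_lt_of_le (by linarith) (le_max_right _ _)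
    refine (hmono ht hy (le_max_left _ _)).trans ?_
    have := hA.derivWithin_nonpos (x := y)
    rwa [derivWithin_of_mem_nhds (Ici_mem_nhds hyA)] at this
  refine ⟨fun t ht => by simpa using (hd1 t ht).hasDerivAt,
    fun t ht => (hd2 t ht).hasDerivAt.neg, h0.continuousOn, fun t ht => by linarith [hneg t ht],
    fun t ht => ?_, fun t ht => hK.pos t ht.ne', hK.tendsto_zero, fun a b =>
      (hK.locallyIntegrable.integrableOn_isCompact isCompact_uIcc).intervalIntegrable⟩
  have := hmono.derivWithin_nonneg (x := t)
  rwa [derivWithin_of_mem_nhds (Ioi_mem_nhds ht)] at this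

/-- An oscillatory integral against a decreasing function. -/
theorem norm_integral_mul_cexp_le {g g' : ℝ → ℝ} {a b : ℝ} (hab : a ≤ b)
    (hg : ∀ t ∈ Set.Icc a b, HasDerivAt g (g' t) t) (hg' : ContinuousOn g' (Set.Icc a b))
    (hneg : ∀ t ∈ Set.Icc a b, g' t ≤ 0) (hpos : 0 ≤ g b) {ω : ℝ} (hω : ω ≠ 0) :
    ‖∫ t in a..b, (g t : ℂ) * Complex.exp (Complex.I * t * ω)‖ ≤ 2 * g a / |ω| := by
  have hωC : (ω : ℂ) ≠ 0 := by exact_mod_cast hω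
  have hI : Complex.I * (ω : ℂ) ≠ 0 := mul_ne_zero Complex.I_ne_zero hωC
  have hv : ∀ t : ℝ, HasDerivAt
      (fun t : ℝ => Complex.exp (Complex.I * t * ω) / (Complex.I * ω))
      (Complex.exp (Complex.I * t * ω)) t := by
    intro t
    have h1 : HasDerivAt (fun t : ℝ => Complex.I * (t : ℂ) * ω) (Complex.I * 1 * ω) t :=
      ((Complex.ofRealCLM.hasDerivAt (x := t)).const_mul Complex.I).mul_const (ω : ℂ)
    refine ((h1.cexp).div_const (Complex.I * ω)).congr_deriv ?_
    rw [mul_one, mul_div_assoc, div_self hI, mul_one]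
  have hnorm : ∀ t : ℝ, ‖Complex.exp (Complex.I * t * ω)‖ = 1 := by
    intro t
    rw [Complex.norm_exp]
    simp
  have hnorm' : ∀ t : ℝ, ‖Complex.exp (Complex.I * t * ω) / (Complex.I * ω)‖ = 1 / |ω| := by
    intro t
    rw [norm_div, hnorm]
    simp
  have hgi : IntervalIntegrable g' volume a b := by
    apply ContinuousOn.intervalIntegrable
    rwa [Set.uIcc_of_le hab]
  -- Integration by parts with antiderivative `e^{iωt}/(iω)`, of modulus `1/|ω|`. The boundary terms
  -- contribute `g a + g b` and the total variation `g a - g b`, which add up to `2 g a`.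
  have key := intervalIntegral.integral_mul_deriv_eq_deriv_mul (a := a) (b := b)
    (u := fun t => (g t : ℂ)) (u' := fun t => (g' t : ℂ))
    (v := fun t : ℝ => Complex.exp (Complex.I * t * ω) / (Complex.I * ω))
    (v' := fun t : ℝ => Complex.exp (Complex.I * t * ω))
    (fun t ht => (hg t (by rwa [Set.uIcc_of_le hab] at ht)).ofReal_comp)
    (fun t _ => hv t) ⟨hgi.1.ofReal, hgi.2.ofReal⟩ (Continuous.intervalIntegrable (by fun_prop) _ _)
  rw [key]
  have hint : ‖∫ t in a..b, (g' t : ℂ) * (Complex.exp (Complex.I * t * ω) / (Complex.I * ω))‖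
      ≤ (g a - g b) / |ω| := by
    have h1 : ∫ t in a..b, -g' t / |ω| = (g a - g b) / |ω| := by
      rw [intervalIntegral.integral_div, intervalIntegral.integral_neg,
        intervalIntegral.integral_eq_sub_of_hasDerivAt
          (fun t ht => hg t (by rwa [Set.uIcc_of_le hab] at ht)) hgi]
      ring
    rw [← h1]
    refine intervalIntegral.norm_integral_le_of_norm_le hab ?_ (hgi.neg.div_const _)
    refine (ae_of_all _ fun t ht => ?_)
    rw [norm_mul, hnorm', Complex.norm_real, Real.norm_eq_abs,
      abs_of_nonpos (hneg t ⟨ht.1.le, ht.2⟩)]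
    exact le_of_eq (by ring)
  have hga : 0 ≤ g a := by
    have : 0 ≤ ∫ t in a..b, -g' t := intervalIntegral.integral_nonneg hab
      fun t ht => by linarith [hneg t ht]
    rw [intervalIntegral.integral_neg, intervalIntegral.integral_eq_sub_of_hasDerivAt
          (fun t ht => hg t (by rwa [Set.uIcc_of_le hab] at ht)) hgi] at this
    linarith
  calc _ ≤ ‖(g b : ℂ) * (Complex.exp (Complex.I * b * ω) / (Complex.I * ω))‖
        + ‖(g a : ℂ) * (Complex.exp (Complex.I * a * ω) / (Complex.I * ω))‖
        + (g a - g b) / |ω| :=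
        (norm_sub_le _ _).trans (add_le_add (norm_sub_le _ _) hint)
    _ = 2 * g a / |ω| := by
        rw [norm_mul, norm_mul, hnorm', hnorm', Complex.norm_real, Complex.norm_real,
          Real.norm_of_nonneg hpos, Real.norm_of_nonneg hga]
        ring

/-- `∫₀ᵀ K(t) e^{iωt} dt`. -/
noncomputable def truncTransform (K : ℝ → ℝ) (T ω : ℝ) : ℂ :=
  ∫ t in (0 : ℝ)..T, (K t : ℂ) * Complex.exp (Complex.I * t * ω)

/-- `∫₀^∞ K(t) e^{iωt} dt`, as an improper integral. -/
noncomputable def halfTransform (K : ℝ → ℝ) (ω : ℝ) : ℂ :=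
  limUnder atTop fun T => truncTransform K T ω

/-! ### Existence and size of the half-line transform. -/

namespace DecayingKernel

variable {K g h : ℝ → ℝ}

theorem continuousOn_deriv (H : DecayingKernel K g h) : ContinuousOn g (Set.Ioi 0) :=
  fun t ht => (H.hasDerivAt' t ht).continuousAt.continuousWithinAt

theorem antitoneOn (H : DecayingKernel K g h) : AntitoneOn K (Set.Ioi 0) := by
  refine antitoneOn_of_deriv_nonpos (convex_Ioi 0)
    (fun t ht => (H.hasDerivAt t ht).continuousAt.continuousWithinAt)
    (fun t ht => ?_) (fun t ht => ?_) <;> rw [interior_Ioi] at ht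
  · exact (H.hasDerivAt t ht).differentiableAt.differentiableWithinAt
  · rw [(H.hasDerivAt t ht).deriv]
    linarith [H.nonneg' t ht]

theorem antitoneOn' (H : DecayingKernel K g h) : AntitoneOn g (Set.Ioi 0) := by
  refine antitoneOn_of_deriv_nonpos (convex_Ioi 0) H.continuousOn_deriv
    (fun t ht => ?_) (fun t ht => ?_) <;> rw [interior_Ioi] at ht
  · exact (H.hasDerivAt' t ht).differentiableAt.differentiableWithinAt
  · rw [(H.hasDerivAt' t ht).deriv]
    linarith [H.nonneg'' t ht]

theorem intervalIntegrable' (H : DecayingKernel K g h) {a b : ℝ} (ha : 0 < a) (hab : a ≤ b) :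
    IntervalIntegrable g volume a b := by
  apply ContinuousOn.intervalIntegrable
  rw [Set.uIcc_of_le hab]
  exact H.continuousOn_deriv.mono fun t ht => lt_of_lt_of_le ha ht.1

theorem intervalIntegrable'' (H : DecayingKernel K g h) {a b : ℝ} (ha : 0 < a) (hab : a ≤ b) :
    IntervalIntegrable h volume a b := by
  apply ContinuousOn.intervalIntegrable
  rw [Set.uIcc_of_le hab]
  exact H.continuousOn.mono fun t ht => lt_of_lt_of_le ha ht.1

theorem integral_deriv (H : DecayingKernel K g h) {a b : ℝ} (ha : 0 < a) (hab : a ≤ b) :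
    ∫ t in a..b, g t = K a - K b := by
  have := intervalIntegral.integral_eq_sub_of_hasDerivAt (a := a) (b := b) (f := K)
    (f' := fun t => -g t) (fun t ht => H.hasDerivAt t (by
      rw [Set.uIcc_of_le hab] at ht; exact lt_of_lt_of_le ha ht.1)) (H.intervalIntegrable' ha hab).neg
  rw [intervalIntegral.integral_neg] at this
  linarith

theorem integral_deriv' (H : DecayingKernel K g h) {a b : ℝ} (ha : 0 < a) (hab : a ≤ b) :
    ∫ t in a..b, h t = g a - g b := by
  have := intervalIntegral.integral_eq_sub_of_hasDerivAt (a := a) (b := b) (f := g)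
    (f' := fun t => -h t) (fun t ht => H.hasDerivAt' t (by
      rw [Set.uIcc_of_le hab] at ht; exact lt_of_lt_of_le ha ht.1)) (H.intervalIntegrable'' ha hab).neg
  rw [intervalIntegral.integral_neg] at this
  linarith

theorem norm_integral_le (H : DecayingKernel K g h) {a b ω : ℝ} (ha : 0 < a) (hab : a ≤ b)
    (hω : ω ≠ 0) :
    ‖∫ t in a..b, (K t : ℂ) * Complex.exp (Complex.I * t * ω)‖ ≤ 2 * K a / |ω| := by
  have hp : ∀ t ∈ Set.Icc a b, 0 < t := fun t ht => lt_of_lt_of_le ha ht.1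
  exact norm_integral_mul_cexp_le hab (fun t ht => H.hasDerivAt t (hp t ht))
    (H.continuousOn_deriv.neg.mono hp) (fun t ht => by linarith [H.nonneg' t (hp t ht)])
    (H.pos b (ha.trans_le hab)).le hω

theorem norm_integral_le' (H : DecayingKernel K g h) {a b ω : ℝ} (ha : 0 < a) (hab : a ≤ b)
    (hω : ω ≠ 0) :
    ‖∫ t in a..b, (g t : ℂ) * Complex.exp (Complex.I * t * ω)‖ ≤ 2 * g a / |ω| := by
  have hp : ∀ t ∈ Set.Icc a b, 0 < t := fun t ht => lt_of_lt_of_le ha ht.1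
  exact norm_integral_mul_cexp_le hab (fun t ht => H.hasDerivAt' t (hp t ht))
    (H.continuousOn.neg.mono hp) (fun t ht => by linarith [H.nonneg'' t (hp t ht)])
    (H.nonneg' b (ha.trans_le hab)) hω

theorem intervalIntegrable_mul_cexp (H : DecayingKernel K g h) (a b ω : ℝ) :
    IntervalIntegrable (fun t : ℝ => (K t : ℂ) * Complex.exp (Complex.I * t * ω)) volume a b :=
  IntervalIntegrable.mul_continuousOn
    ⟨(H.intervalIntegrable a b).1.ofReal, (H.intervalIntegrable a b).2.ofReal⟩
    (Continuous.continuousOn (by fun_prop))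

theorem truncTransform_sub (H : DecayingKernel K g h) (a b ω : ℝ) :
    truncTransform K b ω - truncTransform K a ω =
      ∫ t in a..b, (K t : ℂ) * Complex.exp (Complex.I * t * ω) :=
  intervalIntegral.integral_interval_sub_left (H.intervalIntegrable_mul_cexp _ _ _)
    (H.intervalIntegrable_mul_cexp _ _ _)

/-- Dirichlet's test: the integral beyond `N` is at most `2 K(N)/|ω|`, which tends to `0`.
Integrability of `K` at infinity plays no role. -/
theorem tendsto_truncTransform (H : DecayingKernel K g h) {ω : ℝ} (hω : ω ≠ 0) :
    Tendsto (fun T => truncTransform K T ω) atTop (𝓝 (halfTransform K ω)) := by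
  refine CauchySeq.tendsto_limUnder (Metric.cauchySeq_iff'.2 fun ε hε => ?_)
  have hlim : Tendsto (fun T => 2 * K T / |ω|) atTop (𝓝 0) := by
    simpa using (H.tendsto_zero.const_mul 2).div_const |ω|
  obtain ⟨N, hN, hN0⟩ := ((hlim.eventually (gt_mem_nhds hε)).and (eventually_gt_atTop 0)).exists
  refine ⟨N, fun T hT => ?_⟩
  rw [dist_eq_norm, H.truncTransform_sub]
  exact (H.norm_integral_le hN0 hT hω).trans_lt hN

theorem norm_halfTransform_sub_le (H : DecayingKernel K g h) {ω T : ℝ} (hω : ω ≠ 0)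
    (hT : 0 < T) : ‖halfTransform K ω - truncTransform K T ω‖ ≤ 2 * K T / |ω| := by
  refine le_of_tendsto ((H.tendsto_truncTransform hω).sub_const _).norm ?_
  filter_upwards [eventually_ge_atTop T] with S hS
  rw [H.truncTransform_sub]
  exact H.norm_integral_le hT hS hω

theorem norm_truncTransform_le (H : DecayingKernel K g h) {T : ℝ} (hT : 0 < T) (ω : ℝ) :
    ‖truncTransform K T ω‖ ≤ ∫ t in (0 : ℝ)..T, K t := by
  refine intervalIntegral.norm_integral_le_of_norm_le hT.le (ae_of_all _ fun t ht => ?_)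
    (H.intervalIntegrable _ _)
  rw [norm_mul, Complex.norm_exp, Complex.norm_real, Real.norm_of_nonneg (H.pos t ht.1).le]
  simp

theorem mul_le_integral (H : DecayingKernel K g h) {x : ℝ} (hx : 0 < x) :
    x * K x ≤ ∫ t in (0 : ℝ)..x, K t := by
  have h1 : ∫ t in (0 : ℝ)..x, K x = x * K x := by simp
  rw [← h1]
  refine intervalIntegral.integral_mono_on_of_le_Ioo hx.le (by simp)
    (H.intervalIntegrable _ _) fun t ht => H.antitoneOn ht.1 hx ht.2.le

/-- Cut at `1/ω`. The tail costs `2 ω⁻¹ K(ω⁻¹)`, and monotonicity bounds `ω⁻¹ K(ω⁻¹)` by the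
integral over `(0, ω⁻¹)`, so the constant is `1 + 2`. -/
theorem norm_halfTransform_le (H : DecayingKernel K g h) {ω : ℝ} (hω : 0 < ω) :
    ‖halfTransform K ω‖ ≤ 3 * ∫ t in (0 : ℝ)..ω⁻¹, K t := by
  have h1 := H.norm_halfTransform_sub_le hω.ne' (inv_pos.2 hω)
  have h2 := H.norm_truncTransform_le (inv_pos.2 hω) ω
  have h3 := H.mul_le_integral (inv_pos.2 hω)
  rw [abs_of_pos hω] at h1
  have h4 := norm_le_norm_sub_add (halfTransform K ω) (truncTransform K ω⁻¹ ω)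
  have h5 : 2 * K ω⁻¹ / ω = 2 * (ω⁻¹ * K ω⁻¹) := by ring
  linarith

/-- Removes the boundary terms at the origin in the integrations by parts, even when `K` blows up
there. -/
theorem tendsto_mul_zero (H : DecayingKernel K g h) :
    Tendsto (fun x => x * K x) (𝓝[>] 0) (𝓝 0) := by
  have hc : Continuous fun x => ∫ t in (0 : ℝ)..x, K t :=
    intervalIntegral.continuous_primitive H.intervalIntegrable 0
  have h0 : Tendsto (fun x => ∫ t in (0 : ℝ)..x, K t) (𝓝[>] 0) (𝓝 0) := by
    simpa using (hc.tendsto 0).mono_left nhdsWithin_le_nhds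
  refine tendsto_of_tendsto_of_tendsto_of_le_of_le' tendsto_const_nhds h0 ?_ ?_
  · filter_upwards [self_mem_nhdsWithin] with x hx
    exact mul_nonneg (le_of_lt hx) (H.pos x hx).le
  · filter_upwards [self_mem_nhdsWithin] with x hx using H.mul_le_integral hx

theorem im_integral (H : DecayingKernel K g h) (a b ω : ℝ) :
    (∫ t in a..b, (K t : ℂ) * Complex.exp (Complex.I * t * ω)).im =
      ∫ t in a..b, K t * Real.sin (ω * t) := by
  have := (Complex.imCLM.intervalIntegral_comp_comm (H.intervalIntegrable_mul_cexp a b ω)).symm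
  rw [Complex.imCLM_apply] at this
  rw [this]
  refine intervalIntegral.integral_congr fun t _ => ?_
  have : Complex.I * t * ω = ((ω * t : ℝ) : ℂ) * Complex.I := by push_cast; ring
  simp only [Complex.imCLM_apply, Complex.im_ofReal_mul, this, Complex.exp_ofReal_mul_I_im]

theorem re_integral (H : DecayingKernel K g h) (a b ω : ℝ) :
    (∫ t in a..b, (K t : ℂ) * Complex.exp (Complex.I * t * ω)).re =
      ∫ t in a..b, K t * Real.cos (ω * t) := by
  have := (Complex.reCLM.intervalIntegral_comp_comm (H.intervalIntegrable_mul_cexp a b ω)).symm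
  rw [Complex.reCLM_apply] at this
  rw [this]
  refine intervalIntegral.integral_congr fun t _ => ?_
  have : Complex.I * t * ω = ((ω * t : ℝ) : ℂ) * Complex.I := by push_cast; ring
  simp only [Complex.reCLM_apply, Complex.re_ofReal_mul, this, Complex.exp_ofReal_mul_I_re]

/-- The half transform is the limit of the integrals over `(ε,T)`. -/
theorem tendsto_integral_halfTransform (H : DecayingKernel K g h) {ω : ℝ} (hω : ω ≠ 0)
    {p : ℂ → ℝ} (hp : Continuous p) {r : ℝ → ℝ} (hr : Tendsto r (𝓝[>] 0) (𝓝 0))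
    {s : ℝ → ℝ} (hs : Tendsto s atTop (𝓝 0)) {m T₀ ε₀ : ℝ} (hε₀ : 0 < ε₀)
    (hm : ∀ ε T, 0 < ε → ε ≤ ε₀ → T₀ ≤ T →
      m ≤ p (∫ t in ε..T, (K t : ℂ) * Complex.exp (Complex.I * t * ω)) + r ε + s T) :
    m ≤ p (halfTransform K ω) := by
  -- The limits are taken one after the other: `ε → 0` with `T` fixed removes the error `r`, then `T
  -- → ∞` removes `s`.
  have h1 : ∀ T, T₀ ≤ T → m ≤ p (truncTransform K T ω) + s T := by
    intro T hT
    have hc : Tendsto (fun ε => truncTransform K ε ω) (𝓝[>] 0) (𝓝 0) := by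
      have := (intervalIntegral.continuous_primitive
        (fun a b => H.intervalIntegrable_mul_cexp a b ω) 0).tendsto 0
      simpa [truncTransform] using this.mono_left (nhdsWithin_le_nhds (s := Set.Ioi 0))
    have h2 : Tendsto (fun ε => p (truncTransform K T ω - truncTransform K ε ω) + r ε + s T)
        (𝓝[>] 0) (𝓝 (p (truncTransform K T ω) + s T)) := by
      have := ((hp.tendsto _).comp (hc.const_sub (truncTransform K T ω))).add hr
      simpa using this.add_const (s T)
    refine ge_of_tendsto h2 ?_
    filter_upwards [Ioc_mem_nhdsGT hε₀] with ε hε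
    rw [H.truncTransform_sub]
    exact hm ε T hε.1 hε.2 hT
  have h3 := ((hp.tendsto _).comp (H.tendsto_truncTransform hω)).add hs
  rw [add_zero] at h3
  refine ge_of_tendsto h3 ?_
  filter_upwards [eventually_ge_atTop T₀] with T hT using h1 T hT

end DecayingKernel

/-! ### Integration by parts and one-sided bounds for the real and imaginary parts. -/

theorem integral_mul_deriv_of_hasDerivAt_neg {u w v v' : ℝ → ℝ} {a b : ℝ} (hab : a ≤ b)
    (hu : ∀ t ∈ Set.Icc a b, HasDerivAt u (-w t) t) (hw : ContinuousOn w (Set.Icc a b))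
    (hv : ∀ t, HasDerivAt v (v' t) t) (hv' : Continuous v') :
    ∫ t in a..b, u t * v' t = u b * v b - u a * v a + ∫ t in a..b, w t * v t := by
  rw [intervalIntegral.integral_mul_deriv_eq_deriv_mul (u' := fun t => -w t)
    (fun t ht => hu t (by rwa [Set.uIcc_of_le hab] at ht)) (fun t _ => hv t)
    (ContinuousOn.intervalIntegrable (by rw [Set.uIcc_of_le hab]; exact hw.neg))
    (hv'.intervalIntegrable _ _)]
  simp only [neg_mul, intervalIntegral.integral_neg, sub_neg_eq_add]

namespace DecayingKernel

variable {K g h : ℝ → ℝ}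

/-- The antiderivative `1 - cos` is chosen because it is nonnegative and vanishes to second order at
`0`. It serves both for the pair `K, g` and for the pair `g, h`. -/
theorem mul_integral_sin {u w : ℝ → ℝ} (hu : ∀ t, 0 < t → HasDerivAt u (-w t) t)
    (hw : ContinuousOn w (Set.Ioi 0)) {a b : ℝ} (ha : 0 < a) (hab : a ≤ b) (ω : ℝ) :
    ω * ∫ t in a..b, u t * Real.sin (ω * t) =
      u b * (1 - Real.cos (ω * b)) - u a * (1 - Real.cos (ω * a)) +
        ∫ t in a..b, w t * (1 - Real.cos (ω * t)) := by
  have hp : ∀ t ∈ Set.Icc a b, 0 < t := fun t ht => lt_of_lt_of_le ha ht.1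
  rw [← integral_mul_deriv_of_hasDerivAt_neg hab (fun t ht => hu t (hp t ht)) (hw.mono hp)
    (v := fun t => 1 - Real.cos (ω * t)) (v' := fun t => ω * Real.sin (ω * t)) ?_ (by fun_prop),
    ← intervalIntegral.integral_const_mul]
  · exact intervalIntegral.integral_congr fun t _ => by ring
  · intro t
    have := (((hasDerivAt_id t).const_mul ω).cos).const_sub 1
    simpa [mul_comm] using this

theorem mul_integral_cos {u w : ℝ → ℝ} (hu : ∀ t, 0 < t → HasDerivAt u (-w t) t)
    (hw : ContinuousOn w (Set.Ioi 0)) {a b : ℝ} (ha : 0 < a) (hab : a ≤ b) (ω : ℝ) :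
    ω * ∫ t in a..b, u t * Real.cos (ω * t) =
      u b * Real.sin (ω * b) - u a * Real.sin (ω * a) + ∫ t in a..b, w t * Real.sin (ω * t) := by
  have hp : ∀ t ∈ Set.Icc a b, 0 < t := fun t ht => lt_of_lt_of_le ha ht.1
  rw [← integral_mul_deriv_of_hasDerivAt_neg hab (fun t ht => hu t (hp t ht)) (hw.mono hp)
    (v := fun t => Real.sin (ω * t)) (v' := fun t => ω * Real.cos (ω * t)) ?_ (by fun_prop),
    ← intervalIntegral.integral_const_mul]
  · exact intervalIntegral.integral_congr fun t _ => by ring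
  · intro t
    have := ((hasDerivAt_id t).const_mul ω).sin
    simpa [mul_comm] using this

theorem integral_mono_set {w : ℝ → ℝ} (hw : ContinuousOn w (Set.Ioi 0))
    (h0 : ∀ t, 0 < t → 0 ≤ w t) {a b a' b' : ℝ} (ha' : 0 < a') (haa : a' ≤ a) (hab : a ≤ b)
    (hbb : b ≤ b') : ∫ t in a..b, w t ≤ ∫ t in a'..b', w t := by
  refine intervalIntegral.integral_mono_interval haa hab hbb ?_ ?_
  · refine (ae_restrict_mem measurableSet_Ioc).mono fun t ht => h0 t (ha'.trans ht.1)
  · refine ContinuousOn.intervalIntegrable ?_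
    rw [Set.uIcc_of_le (haa.trans (hab.trans hbb))]
    exact hw.mono fun t ht => lt_of_lt_of_le ha' ht.1

/-- In the limit `ω Im Z` is the integral of `g(t)(1 - cos ωt)` over `(0,∞)`. The integrand is
nonnegative, so a window gives a lower bound. -/
theorem le_mul_im (H : DecayingKernel K g h) {a b ω : ℝ} (ha : 0 < a) (hab : a ≤ b)
    (hω : 0 < ω) :
    ∫ t in a..b, g t * (1 - Real.cos (ω * t)) ≤ ω * (halfTransform K ω).im := by
  refine H.tendsto_integral_halfTransform hω.ne' (p := fun z => ω * z.im) (by fun_prop)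
    (r := fun ε => ω * (ε * K ε)) (by simpa using H.tendsto_mul_zero.const_mul ω)
    (s := fun _ => 0) tendsto_const_nhds (T₀ := b) ha fun ε T hε hεa hT => ?_
  rw [H.im_integral, mul_integral_sin H.hasDerivAt H.continuousOn_deriv hε
    (hεa.trans (hab.trans hT))]
  have h1 := integral_mono_set (w := fun t => g t * (1 - Real.cos (ω * t)))
    (H.continuousOn_deriv.mul (Continuous.continuousOn (by fun_prop)))
    (fun t ht => mul_nonneg (H.nonneg' t ht) (by linarith [Real.cos_le_one (ω * t)]))
    hε hεa hab hT
  have h2 : 0 ≤ K T * (1 - Real.cos (ω * T)) :=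
    mul_nonneg (H.pos T (ha.trans_le (hab.trans hT))).le (by linarith [Real.cos_le_one (ω * T)])
  -- This is `1 - cos y ≤ y` for `y > 0`: use `y²/2` when `y ≤ 2`, and the trivial bound `2`
  -- otherwise.
  have h3 : K ε * (1 - Real.cos (ω * ε)) ≤ ω * (ε * K ε) := by
    rw [← mul_assoc, mul_comm _ (K ε)]
    refine mul_le_mul_of_nonneg_left ?_ (H.pos ε hε).le
    have h4 := Real.one_sub_sq_div_two_le_cos (x := ω * ε)
    have h5 := Real.neg_one_le_cos (ω * ε)
    have h6 : 0 < ω * ε := mul_pos hω hε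
    rcases le_total (ω * ε) 2 with h7 | h7
    · nlinarith
    · linarith
  linarith

/-- Since `g` is antitone, the secant slope of `K` lies between its endpoint slopes. This and
`le_mul_deriv` convert asymptotics of `K` into bounds on `g`. -/
theorem mul_deriv_le (H : DecayingKernel K g h) {x y : ℝ} (hx : 0 < x) (hxy : x ≤ y) :
    (y - x) * g y ≤ K x - K y := by
  have h1 : ∫ _ in x..y, g y = (y - x) * g y := by simp
  rw [← h1, ← H.integral_deriv hx hxy]
  exact intervalIntegral.integral_mono_on hxy (by simp) (H.intervalIntegrable' hx hxy)
    fun t ht => H.antitoneOn' (hx.trans_le ht.1) (hx.trans_le hxy) ht.2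

theorem le_mul_deriv (H : DecayingKernel K g h) {x y : ℝ} (hx : 0 < x) (hxy : x ≤ y) :
    K x - K y ≤ (y - x) * g x := by
  have h1 : ∫ _ in x..y, g x = (y - x) * g x := by simp
  rw [← h1, ← H.integral_deriv hx hxy]
  exact intervalIntegral.integral_mono_on hxy (H.intervalIntegrable' hx hxy) (by simp)
    fun t ht => H.antitoneOn' hx (hx.trans_le ht.1) ht.1

/-- Two integrations by parts express `ω² Re Z` through `h(t)(1 - cos ωt)`, again nonnegative. The
functions `r` and `s` collect the boundary terms at `ε` and at `T`. -/
theorem le_sq_mul_re (H : DecayingKernel K g h) {a b ω : ℝ} (ha : 0 < a) (hab : a ≤ b)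
    (hω : 0 < ω) :
    ∫ t in a..b, h t * (1 - Real.cos (ω * t)) ≤ ω ^ 2 * (halfTransform K ω).re := by
  have hr : Tendsto (fun ε => ω ^ 2 * (ε * K ε) + 2 * ω ^ 2 * (ε / 2 * K (ε / 2)))
      (𝓝[>] 0) (𝓝 0) := by
    have h2 : Tendsto (fun ε : ℝ => ε / 2) (𝓝[>] 0) (𝓝[>] 0) := by
      refine tendsto_nhdsWithin_iff.2 ⟨?_, ?_⟩
      · simpa using ((continuous_id.div_const (2 : ℝ)).tendsto 0).mono_left
          (nhdsWithin_le_nhds (s := Set.Ioi 0))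
      · filter_upwards [self_mem_nhdsWithin] with x hx using half_pos (Set.mem_Ioi.1 hx)
    simpa using (H.tendsto_mul_zero.const_mul (ω ^ 2)).add
      ((H.tendsto_mul_zero.comp h2).const_mul (2 * ω ^ 2))
  refine H.tendsto_integral_halfTransform hω.ne' (p := fun z => ω ^ 2 * z.re) (by fun_prop)
    (r := fun ε => ω ^ 2 * (ε * K ε) + 2 * ω ^ 2 * (ε / 2 * K (ε / 2))) hr
    (s := fun T => ω * K T) (by simpa using H.tendsto_zero.const_mul ω)
    (T₀ := b) ha fun ε T hε hεa hT => ?_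
  have hT0 : 0 < T := ha.trans_le (hab.trans hT)
  rw [H.re_integral, pow_two, mul_assoc, mul_integral_cos H.hasDerivAt H.continuousOn_deriv hε
    (hεa.trans (hab.trans hT)), mul_add, mul_integral_sin H.hasDerivAt' H.continuousOn hε
    (hεa.trans (hab.trans hT))]
  have h1 := integral_mono_set (w := fun t => h t * (1 - Real.cos (ω * t)))
    (H.continuousOn.mul (Continuous.continuousOn (by fun_prop)))
    (fun t ht => mul_nonneg (H.nonneg'' t ht) (by linarith [Real.cos_le_one (ω * t)]))
    hε hεa hab hT
  have h2 : 0 ≤ g T * (1 - Real.cos (ω * T)) :=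
    mul_nonneg (H.nonneg' T hT0) (by linarith [Real.cos_le_one (ω * T)])
  -- `1 - cos` supplies `(ωε)²/2`, and convexity between `ε/2` and `ε` bounds `ε g(ε)` by `2
  -- K(ε/2)`. What remains is of the form `y K(y)`, which tends to `0`.
  have h3 : g ε * (1 - Real.cos (ω * ε)) ≤ 2 * ω ^ 2 * (ε / 2 * K (ε / 2)) := by
    have h4 := Real.one_sub_sq_div_two_le_cos (x := ω * ε)
    have h5 := H.mul_deriv_le (half_pos hε) (half_le_self hε.le)
    have h6 := (H.pos ε hε).le
    have h7 : ε * g ε ≤ 2 * K (ε / 2) := by linarith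
    calc g ε * (1 - Real.cos (ω * ε)) ≤ g ε * ((ω * ε) ^ 2 / 2) :=
          mul_le_mul_of_nonneg_left (by linarith) (H.nonneg' ε hε)
      _ = ω ^ 2 * ε / 2 * (ε * g ε) := by ring
      _ ≤ ω ^ 2 * ε / 2 * (2 * K (ε / 2)) := mul_le_mul_of_nonneg_left h7 (by positivity)
      _ = _ := by ring
  have h8 : -(K T) ≤ K T * Real.sin (ω * T) := by
    have := mul_le_mul_of_nonneg_left (Real.neg_one_le_sin (ω * T)) (H.pos T hT0).le
    linarith
  have h9 : K ε * Real.sin (ω * ε) ≤ K ε * (ω * ε) :=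
    mul_le_mul_of_nonneg_left (Real.sin_le (by positivity)) (H.pos ε hε).le
  have h10 := mul_le_mul_of_nonneg_left h8 hω.le
  have h11 := mul_le_mul_of_nonneg_left h9 hω.le
  nlinarith

/-- One integration by parts leaves `∫ g(t) sin ωt`. Up to `1/ω` the sine is replaced by `1`, giving
an increment of `K`; beyond it the oscillatory bound for the decreasing `g` applies. -/
theorem mul_re_le (H : DecayingKernel K g h) {L ω : ℝ} (hL : Tendsto K (𝓝[>] 0) (𝓝 L))
    (hω : 0 < ω) :
    ω * (halfTransform K ω).re ≤ L - K ω⁻¹ + 2 * ω⁻¹ * g ω⁻¹ := by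
  suffices hs : -(L - K ω⁻¹ + 2 * ω⁻¹ * g ω⁻¹) ≤ -(ω * (halfTransform K ω).re) by linarith
  refine H.tendsto_integral_halfTransform hω.ne' (p := fun z => -(ω * z.re)) (by fun_prop)
    (r := fun ε => ω * (ε * K ε)) (by simpa using H.tendsto_mul_zero.const_mul ω)
    (s := K) H.tendsto_zero (T₀ := ω⁻¹) (inv_pos.2 hω) fun ε T hε hεa hT => ?_
  have hx := inv_pos.2 hω
  have hT0 : 0 < T := hx.trans_le hT
  have hgc : ∀ a b : ℝ, 0 < a → a ≤ b →
      IntervalIntegrable (fun t => g t * Real.sin (ω * t)) volume a b := fun a b ha hab =>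
    (H.intervalIntegrable' ha hab).mul_continuousOn (Continuous.continuousOn (by fun_prop))
  rw [H.re_integral, mul_integral_cos H.hasDerivAt H.continuousOn_deriv hε (hεa.trans hT),
    ← intervalIntegral.integral_add_adjacent_intervals (hgc ε ω⁻¹ hε hεa) (hgc ω⁻¹ T hx hT)]
  have h1 : ∫ t in ε..ω⁻¹, g t * Real.sin (ω * t) ≤ K ε - K ω⁻¹ := by
    rw [← H.integral_deriv hε hεa]
    refine intervalIntegral.integral_mono_on hεa (hgc ε ω⁻¹ hε hεa) (H.intervalIntegrable' hε hεa)
      fun t ht => ?_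
    exact mul_le_of_le_one_right (H.nonneg' t (hε.trans_le ht.1)) (Real.sin_le_one _)
  have h2 : ∫ t in ω⁻¹..T, g t * Real.sin (ω * t) ≤ 2 * ω⁻¹ * g ω⁻¹ := by
    have hi : IntervalIntegrable (fun t : ℝ => (g t : ℂ) * Complex.exp (Complex.I * t * ω))
        volume ω⁻¹ T :=
      IntervalIntegrable.mul_continuousOn ⟨(H.intervalIntegrable' hx hT).1.ofReal,
        (H.intervalIntegrable' hx hT).2.ofReal⟩ (Continuous.continuousOn (by fun_prop))
    have h3 := Complex.imCLM.intervalIntegral_comp_comm hi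
    have h4 : ∫ t in ω⁻¹..T, g t * Real.sin (ω * t) =
        (∫ t in ω⁻¹..T, (g t : ℂ) * Complex.exp (Complex.I * t * ω)).im := by
      rw [Complex.imCLM_apply] at h3
      rw [← h3]
      refine intervalIntegral.integral_congr fun t _ => ?_
      have : Complex.I * t * ω = ((ω * t : ℝ) : ℂ) * Complex.I := by push_cast; ring
      simp only [Complex.imCLM_apply, Complex.im_ofReal_mul, this, Complex.exp_ofReal_mul_I_im]
    rw [h4]
    refine (Complex.im_le_norm _).trans ((H.norm_integral_le' hx hT hω.ne').trans (le_of_eq ?_))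
    rw [abs_of_pos hω]
    ring
  have h5 : K ε ≤ L := by
    refine ge_of_tendsto hL ?_
    filter_upwards [Ioc_mem_nhdsGT hε] with t ht using H.antitoneOn ht.1 hε ht.2
  have h8 : K T * Real.sin (ω * T) ≤ K T :=
    mul_le_of_le_one_right (H.pos T hT0).le (Real.sin_le_one _)
  have h9 : -(K ε * (ω * ε)) ≤ K ε * Real.sin (ω * ε) := by
    rw [← mul_neg]
    refine mul_le_mul_of_nonneg_left ?_ (H.pos ε hε).le
    have h6 : 0 < ω * ε := mul_pos hω hε
    have h7 := neg_le_of_abs_le (Real.abs_sin_le_abs (x := ω * ε))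
    rwa [abs_of_pos h6] at h7
  nlinarith

end DecayingKernel
-- High-frequency bounds on `Re Z / |Z|²`, with `x = 1/ω`.
namespace DecayingKernel

variable {K g h : ℝ → ℝ}

/-- A window that scales with `x`: there the phase `t/x` stays in `[a,b] ⊆ (0,π]`, where the cosine
is at most `cos a`. -/
theorem const_mul_integral_le {w : ℝ → ℝ} (hw : ContinuousOn w (Set.Ioi 0))
    (h0 : ∀ t, 0 < t → 0 ≤ w t) {a b x : ℝ} (ha : 0 < a) (hab : a ≤ b) (hb : b ≤ Real.pi)
    (hx : 0 < x) :
    (1 - Real.cos a) * ∫ t in a * x..b * x, w t ≤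
      ∫ t in a * x..b * x, w t * (1 - Real.cos (x⁻¹ * t)) := by
  have hax : 0 < a * x := mul_pos ha hx
  have habx : a * x ≤ b * x := mul_le_mul_of_nonneg_right hab hx.le
  have hc : ContinuousOn w (Set.uIcc (a * x) (b * x)) := by
    rw [Set.uIcc_of_le habx]
    exact hw.mono fun t ht => lt_of_lt_of_le hax ht.1
  rw [← intervalIntegral.integral_const_mul]
  refine intervalIntegral.integral_mono_on habx (hc.intervalIntegrable.const_mul _)
    (hc.mul (Continuous.continuousOn (by fun_prop))).intervalIntegrable fun t ht => ?_
  rw [mul_comm]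
  have h1 : a ≤ x⁻¹ * t := by rw [inv_mul_eq_div, le_div_iff₀ hx]; exact ht.1
  have h2 : x⁻¹ * t ≤ b := by rw [inv_mul_eq_div, div_le_iff₀ hx]; exact ht.2
  have h3 := Real.cos_le_cos_of_nonneg_of_le_pi ha.le (h2.trans hb) h1
  exact mul_le_mul_of_nonneg_left (by linarith) (h0 t (hax.trans_le ht.1))

/-- A fixed window: near `t₀` the weight exceeds half its value, and the cosine integrates to
`O(x)`, leaving a positive amount as `x → 0`. -/
theorem eventually_le_integral {w : ℝ → ℝ} (hw : ContinuousOn w (Set.Ioi 0)) {t₀ : ℝ} (ht₀ : 0 < t₀) (hwt : 0 < w t₀) :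
    ∃ a b c : ℝ, 0 < a ∧ a ≤ b ∧ 0 < c ∧ ∀ᶠ x in 𝓝[>] (0 : ℝ),
      c ≤ ∫ t in a..b, w t * (1 - Real.cos (x⁻¹ * t)) := by
  have hc := (hw.continuousAt (Ioi_mem_nhds ht₀)).eventually (lt_mem_nhds (half_lt_self hwt))
  obtain ⟨ε, hε, hball⟩ := Metric.eventually_nhds_iff.1 (hc.and (lt_mem_nhds ht₀))
  set b := t₀ + ε / 2
  have htb : t₀ ≤ b := by simp only [b]; linarith
  have hb : ∀ t ∈ Set.Icc t₀ b, w t₀ / 2 ≤ w t := fun t ht => by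
    refine (hball ?_).1.le
    rw [Real.dist_eq, abs_of_nonneg (by linarith [ht.1])]
    have := ht.2
    simp only [b] at this
    linarith
  refine ⟨t₀, b, w t₀ * ε / 8, ht₀, htb, by positivity, ?_⟩
  -- The window has length `ε/2`. For `x ≤ ε/8` the sine terms take away at most `ε/4`, so `ε/4` of
  -- the length survives, multiplied by `w t₀ / 2`.
  filter_upwards [Ioc_mem_nhdsGT (show (0 : ℝ) < ε / 8 by positivity)] with x hx
  have h1 : ∫ t in t₀..b, w t₀ / 2 * (1 - Real.cos (x⁻¹ * t)) =
      w t₀ / 2 * ((b - t₀) - x * (Real.sin (x⁻¹ * b) - Real.sin (x⁻¹ * t₀))) := by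
    rw [intervalIntegral.integral_const_mul, intervalIntegral.integral_sub
      (by simp) (Continuous.intervalIntegrable (by fun_prop) _ _),
      intervalIntegral.integral_comp_mul_left (fun t => Real.cos t) (inv_ne_zero hx.1.ne')]
    simp
  have h2 : ∫ t in t₀..b, w t₀ / 2 * (1 - Real.cos (x⁻¹ * t)) ≤
      ∫ t in t₀..b, w t * (1 - Real.cos (x⁻¹ * t)) := by
    refine intervalIntegral.integral_mono_on htb (Continuous.intervalIntegrable (by fun_prop) _ _)
      (ContinuousOn.intervalIntegrable ?_) fun t ht => ?_
    · rw [Set.uIcc_of_le htb]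
      exact (hw.mono fun t ht => lt_of_lt_of_le ht₀ ht.1).mul
        (Continuous.continuousOn (by fun_prop))
    · exact mul_le_mul_of_nonneg_right (hb t ht) (by linarith [Real.cos_le_one (x⁻¹ * t)])
  refine le_trans ?_ (h1.symm.le.trans h2)
  have h3 : x * (Real.sin (x⁻¹ * b) - Real.sin (x⁻¹ * t₀)) ≤ ε / 8 * 2 := by
    have := Real.sin_le_one (x⁻¹ * b)
    have := Real.neg_one_le_sin (x⁻¹ * t₀)
    calc x * (Real.sin (x⁻¹ * b) - Real.sin (x⁻¹ * t₀)) ≤ x * 2 :=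
          mul_le_mul_of_nonneg_left (by linarith) hx.1.le
      _ ≤ _ := mul_le_mul_of_nonneg_right hx.2 (by norm_num)
  have h4 : ε / 4 ≤ (b - t₀) - x * (Real.sin (x⁻¹ * b) - Real.sin (x⁻¹ * t₀)) := by
    simp only [b] at h3 ⊢
    linarith
  calc w t₀ * ε / 8 = w t₀ / 2 * (ε / 4) := by ring
    _ ≤ _ := mul_le_mul_of_nonneg_left h4 (by positivity)

/-- Otherwise `K` would stay at least `K 1 > 0` on `[1,∞)`, against `K → 0`. -/
theorem exists_deriv_pos (H : DecayingKernel K g h) : ∃ t, 0 < t ∧ 0 < g t := by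
  by_contra! hcon
  have h1 : ∀ y, 1 ≤ y → K 1 ≤ K y := fun y hy => by
    have := H.le_mul_deriv one_pos hy
    nlinarith [hcon 1 one_pos]
  have := ge_of_tendsto H.tendsto_zero ((eventually_ge_atTop 1).mono h1)
  linarith [H.pos 1 one_pos]

/-- Otherwise `g` would be constant from a point with `g t₀ > 0` on, and `K`, affine with negative
slope, would reach zero. -/
theorem exists_deriv_deriv_pos (H : DecayingKernel K g h) : ∃ t, 0 < t ∧ 0 < h t := by
  by_contra! hcon
  obtain ⟨t₀, ht₀, hg⟩ := H.exists_deriv_pos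
  have h0 : ∀ t, 0 < t → h t = 0 := fun t ht => le_antisymm (hcon t ht) (H.nonneg'' t ht)
  have h1 : ∀ y, t₀ ≤ y → g y = g t₀ := fun y hy => by
    have h2 := H.integral_deriv' ht₀ hy
    have h3 : ∫ t in t₀..y, h t = 0 := by
      rw [intervalIntegral.integral_congr (g := fun _ => (0 : ℝ)), intervalIntegral.integral_zero]
      intro t ht
      rw [Set.uIcc_of_le hy] at ht
      exact h0 t (ht₀.trans_le ht.1)
    linarith
  have h2 := H.mul_deriv_le ht₀ (y := t₀ + K t₀ / g t₀)
    (by have := div_pos (H.pos t₀ ht₀) hg; linarith)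
  have hpos : 0 < t₀ + K t₀ / g t₀ := add_pos ht₀ (div_pos (H.pos t₀ ht₀) hg)
  rw [h1 (t₀ + K t₀ / g t₀) (by have := div_pos (H.pos t₀ ht₀) hg; linarith), add_sub_cancel_left,
    div_mul_cancel₀ _ hg.ne'] at h2
  linarith [H.pos _ hpos]

/-- Here `Im Z ≥ c₁ x`, `|Z| ≤ 3 L x`, `Re Z ≥ c₂ x²` and `Re Z ≤ C x^{2-σ}`. The lower bounds use
fixed windows, and the last bound uses `g(t) ≤ t^{-σ}` near `0`. -/
theorem spectral_bounds_of_finite (H : DecayingKernel K g h) {σ L : ℝ} (hσ : σ < 1)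
    (hL : Tendsto K (𝓝[>] 0) (𝓝 L)) (hg : Tendsto (fun t => t ^ σ * g t) (𝓝[>] 0) (𝓝 0)) :
    ∃ c M : ℝ, 0 < c ∧ ∀ᶠ x in 𝓝[>] (0 : ℝ),
      c ≤ (halfTransform K x⁻¹).re / ‖halfTransform K x⁻¹‖ ^ 2 ∧
      (halfTransform K x⁻¹).re / ‖halfTransform K x⁻¹‖ ^ 2 ≤ M * x ^ (-σ) := by
  obtain ⟨t₁, ht₁, hg₁⟩ := H.exists_deriv_pos
  obtain ⟨t₂, ht₂, hg₂⟩ := H.exists_deriv_deriv_pos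
  obtain ⟨a₁, b₁, c₁, ha₁, hab₁, hc₁, hS⟩ :=
    eventually_le_integral H.continuousOn_deriv ht₁ hg₁
  obtain ⟨a₂, b₂, c₂, ha₂, hab₂, hc₂, hC⟩ :=
    eventually_le_integral H.continuousOn ht₂ hg₂
  have hKL : ∀ t, 0 < t → K t ≤ L := fun t ht => by
    refine ge_of_tendsto hL ?_
    filter_upwards [Ioc_mem_nhdsGT ht] with s hs using H.antitoneOn hs.1 ht hs.2
  have hL0 : 0 < L := (H.pos 1 one_pos).trans_le (hKL 1 one_pos)
  obtain ⟨δ, hδ, hδg⟩ := (mem_nhdsGT_iff_exists_Ioc_subset (s := {t | t ^ σ * g t < 1})).1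
    (hg.eventually (gt_mem_nhds one_pos))
  have hgb : ∀ t ∈ Set.Ioc 0 δ, g t ≤ t ^ (-σ) := fun t ht => by
    have h1 : t ^ σ * g t < 1 := hδg ht
    rw [Real.rpow_neg ht.1.le, ← one_div, le_div_iff₀ (Real.rpow_pos_of_pos ht.1 _), mul_comm]
    exact h1.le
  have hσ' : -1 < -σ := by linarith
  have hLK : ∀ x ∈ Set.Ioc 0 δ, L - K x ≤ x ^ (1 - σ) / (1 - σ) := fun x hx => by
    refine le_of_tendsto (hL.sub_const (K x)) ?_
    filter_upwards [Ioc_mem_nhdsGT hx.1] with ε hε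
    rw [← H.integral_deriv hε.1 hε.2]
    have h1 : ∫ t in (0 : ℝ)..x, t ^ (-σ) = x ^ (1 - σ) / (1 - σ) := by
      rw [integral_rpow (Or.inl hσ'), Real.zero_rpow (by linarith)]
      rw [sub_zero, neg_add_eq_sub]
    rw [← h1]
    calc ∫ t in ε..x, g t ≤ ∫ t in ε..x, t ^ (-σ) :=
          intervalIntegral.integral_mono_on hε.2 (H.intervalIntegrable' hε.1 hε.2)
            (intervalIntegral.intervalIntegrable_rpow' hσ') fun t ht =>
            hgb t ⟨hε.1.trans_le ht.1, ht.2.trans hx.2⟩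
      _ ≤ _ := by
          refine intervalIntegral.integral_mono_interval hε.1.le hε.2 le_rfl ?_
            (intervalIntegral.intervalIntegrable_rpow' hσ')
          exact (ae_restrict_mem measurableSet_Ioc).mono fun t ht => Real.rpow_nonneg ht.1.le _
  refine ⟨c₂ / (9 * L ^ 2), (1 / (1 - σ) + 2) / c₁ ^ 2, by positivity, ?_⟩
  filter_upwards [hS, hC, Ioc_mem_nhdsGT hδ] with x hS hC hx
  have hx0 := hx.1
  have hxi := inv_pos.2 hx0
  have k1 := hS.trans (H.le_mul_im ha₁ hab₁ hxi)
  have k2 := hC.trans (H.le_sq_mul_re ha₂ hab₂ hxi)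
  have k3 := H.mul_re_le hL hxi
  have k4 := H.norm_halfTransform_le hxi
  rw [inv_inv] at k3 k4
  set Z := halfTransform K x⁻¹
  have l1 : c₁ * x ≤ Z.im := by rwa [inv_mul_eq_div, le_div_iff₀ hx0] at k1
  have l2 : c₂ * x ^ 2 ≤ Z.re := by
    rwa [inv_pow, inv_mul_eq_div, le_div_iff₀ (by positivity)] at k2
  have l3 : Z.re ≤ (1 / (1 - σ) + 2) * (x ^ 2 * x ^ (-σ)) := by
    have e1 : x ^ (1 - σ) = x * x ^ (-σ) := by
      rw [show (1 - σ) = 1 + -σ by ring, Real.rpow_add hx0, Real.rpow_one]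
    have e2 := hLK x hx
    have e3 := mul_le_mul_of_nonneg_left (hgb x hx) hx0.le
    rw [e1] at e2
    rw [inv_mul_eq_div, div_le_iff₀ hx0] at k3
    calc Z.re ≤ (L - K x + 2 * x * g x) * x := k3
      _ ≤ (x * x ^ (-σ) / (1 - σ) + 2 * (x * x ^ (-σ))) * x :=
          mul_le_mul_of_nonneg_right (by linarith) hx0.le
      _ = _ := by ring
  have l4 : ‖Z‖ ≤ 3 * (L * x) := by
    refine k4.trans (mul_le_mul_of_nonneg_left ?_ (by norm_num))
    have : ∫ _ in (0 : ℝ)..x, L = L * x := by simp [mul_comm]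
    rw [← this]
    exact intervalIntegral.integral_mono_on_of_le_Ioo hx0.le (H.intervalIntegrable _ _) (by simp)
      fun t ht => hKL t ht.1
  have l5 : c₁ * x ≤ ‖Z‖ := l1.trans (Complex.im_le_norm _)
  have l6 : 0 < ‖Z‖ := lt_of_lt_of_le (by positivity) l5
  constructor
  · rw [le_div_iff₀ (by positivity), div_mul_eq_mul_div, div_le_iff₀ (by positivity)]
    have : ‖Z‖ ^ 2 ≤ (3 * (L * x)) ^ 2 := pow_le_pow_left₀ l6.le l4 2
    nlinarith [mul_le_mul_of_nonneg_left this hc₂.le, mul_le_mul_of_nonneg_left l2 (sq_nonneg L)]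
  · have h1 : (c₁ * x) ^ 2 ≤ ‖Z‖ ^ 2 := pow_le_pow_left₀ (by positivity) l5 2
    rw [div_le_iff₀ (by positivity)]
    refine l3.trans ?_
    have h2 : 0 ≤ (1 / (1 - σ) + 2) / c₁ ^ 2 * x ^ (-σ) := by
      have : 0 < 1 - σ := by linarith
      positivity
    refine le_trans (le_of_eq ?_) (mul_le_mul_of_nonneg_left h1 h2)
    field_simp

/-- Here `K(t) ~ κ t^{σ-1}`, and `Re Z`, `Im Z` and `|Z|` are all bounded below, and `|Z|` above, by
multiples of `x^σ`. The lower bounds use windows at scale `x`; the upper bound on the quotient only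
needs `Re Z ≤ |Z|`. -/
theorem spectral_bounds_of_infinite (H : DecayingKernel K g h) {σ κ : ℝ} (hσ : 0 < σ) (hσ' : σ < 1)
    (hκ : 0 < κ) (hK : Tendsto (fun t => t ^ (1 - σ) * K t) (𝓝[>] 0) (𝓝 κ)) :
    ∃ c M : ℝ, 0 < c ∧ ∀ᶠ x in 𝓝[>] (0 : ℝ),
      c ≤ (halfTransform K x⁻¹).re / ‖halfTransform K x⁻¹‖ ^ 2 ∧
      (halfTransform K x⁻¹).re / ‖halfTransform K x⁻¹‖ ^ 2 ≤ M * x ^ (-σ) := by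
  have hscale : ∀ a : ℝ, 0 < a →
      Tendsto (fun x => x ^ (1 - σ) * K (a * x)) (𝓝[>] 0) (𝓝 (κ * a ^ (σ - 1))) := by
    intro a ha
    have h1 : Tendsto (fun x : ℝ => a * x) (𝓝[>] 0) (𝓝[>] 0) := by
      refine tendsto_nhdsWithin_iff.2 ⟨?_, ?_⟩
      · simpa using ((continuous_id.const_mul a).tendsto 0).mono_left
          (nhdsWithin_le_nhds (s := Set.Ioi 0))
      · filter_upwards [self_mem_nhdsWithin] with x hx using mul_pos ha hx
    refine ((hK.comp h1).mul_const (a ^ (σ - 1))).congr' ?_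
    filter_upwards [self_mem_nhdsWithin] with x hx
    have h2 : a ^ (1 - σ) * a ^ (σ - 1) = 1 := by
      rw [← Real.rpow_add ha]; simp
    simp only [Function.comp]
    rw [Real.mul_rpow ha.le (le_of_lt hx)]
    linear_combination (x ^ (1 - σ) * K (a * x)) * h2
  -- Re `Z` needs a lower bound for `g(dx) - g(3x)` from the asymptotics of `K` alone. The secant
  -- over `[dx, 2dx]` bounds `x g(dx)` below by about `κ d^{σ-1} x^{σ-1} (1 - 2^{σ-1})/d`, and this
  -- `d` cancels the last factor. The result exceeds `κ x^{σ-1}`, whereas `x g(3x)` is at most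
  -- `K(x)/2`.
  set d : ℝ := 1 - 2 ^ (σ - 1) with hd
  have h2σ : (2 : ℝ) ^ (σ - 1) < 1 := Real.rpow_lt_one_of_one_lt_of_neg (by norm_num) (by linarith)
  have h2σ' : 0 < (2 : ℝ) ^ (σ - 1) := by positivity
  have hd0 : 0 < d := by rw [hd]; linarith
  have hd1 : d < 1 := by rw [hd]; linarith
  have hcos : ∀ a : ℝ, 0 < a → a ≤ 1 → 0 < 1 - Real.cos a := fun a ha ha1 => by
    have := Real.cos_lt_cos_of_nonneg_of_le_pi le_rfl (by linarith [Real.pi_gt_three]) ha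
    rw [Real.cos_zero] at this
    linarith
  have hS : ∀ᶠ x in 𝓝[>] (0 : ℝ), κ * d / 2 < x ^ (1 - σ) * K (1 * x) - x ^ (1 - σ) * K (2 * x) := by
    refine ((hscale 1 one_pos).sub (hscale 2 two_pos)).eventually (lt_mem_nhds ?_)
    rw [Real.one_rpow, ← mul_sub, ← hd]
    exact half_lt_self (by positivity)
  have hC : ∀ᶠ x in 𝓝[>] (0 : ℝ), κ / 4 <
      (x ^ (1 - σ) * K (d * x) - x ^ (1 - σ) * K (2 * d * x)) / d - x ^ (1 - σ) * K (1 * x) / 2 := by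
    refine ((((hscale d hd0).sub (hscale (2 * d) (by positivity))).div_const d).sub
      ((hscale 1 one_pos).div_const 2)).eventually (lt_mem_nhds ?_)
    rw [Real.mul_rpow two_pos.le hd0.le]
    have h1 : 1 ≤ d ^ (σ - 1) :=
      Real.one_le_rpow_of_pos_of_le_one_of_nonpos hd0 hd1.le (by linarith)
    have h3 : (κ * d ^ (σ - 1) - κ * (2 ^ (σ - 1) * d ^ (σ - 1))) / d = κ * d ^ (σ - 1) := by
      rw [div_eq_iff hd0.ne', hd]; ring
    rw [h3, Real.one_rpow]
    nlinarith
  obtain ⟨δ, hδ, hδK⟩ := (mem_nhdsGT_iff_exists_Ioc_subset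
    (s := {t | t ^ (1 - σ) * K t < 2 * κ})).1 (hK.eventually (gt_mem_nhds (by linarith)))
  have hKb : ∀ t ∈ Set.Ioc 0 δ, K t ≤ 2 * κ * t ^ (σ - 1) := fun t ht => by
    have h1 : t ^ (1 - σ) * K t < 2 * κ := hδK ht
    rw [show σ - 1 = -(1 - σ) by ring, Real.rpow_neg ht.1.le, ← div_eq_mul_inv,
      le_div_iff₀ (Real.rpow_pos_of_pos ht.1 _), mul_comm]
    exact h1.le
  set c₁ := (1 - Real.cos 1) * (κ * d / 2)
  have hc₁ : 0 < c₁ := mul_pos (hcos 1 one_pos le_rfl) (by positivity)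
  set c₂ := (1 - Real.cos d) * (κ / 4)
  have hc₂ : 0 < c₂ := mul_pos (hcos d hd0 hd1.le) (by positivity)
  refine ⟨c₂ / (6 * κ / σ) ^ 2, 1 / c₁, by positivity, ?_⟩
  filter_upwards [hS, hC, Ioc_mem_nhdsGT hδ, Ioc_mem_nhdsGT one_pos] with x hS hC hx hx1
  have hx0 := hx.1
  have hxi := inv_pos.2 hx0
  have hxp : 0 < x ^ (1 - σ) := Real.rpow_pos_of_pos hx0 _
  have hxs : 0 < x ^ σ := Real.rpow_pos_of_pos hx0 _
  have hmul : x ^ (1 - σ) * x ^ σ = x := by rw [← Real.rpow_add hx0]; simp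
  have k1 := H.le_mul_im (a := 1 * x) (b := 2 * x) (by linarith) (by linarith) hxi
  have k1' := const_mul_integral_le H.continuousOn_deriv H.nonneg' (a := 1) (b := 2) one_pos
    one_le_two (by linarith [Real.pi_gt_three]) hx0
  rw [H.integral_deriv (by linarith) (by linarith)] at k1'
  have k2 := H.le_sq_mul_re (a := d * x) (b := 3 * x) (mul_pos hd0 hx0) (by nlinarith) hxi
  have k2' := const_mul_integral_le H.continuousOn H.nonneg'' (a := d) (b := 3) hd0
    (by linarith) Real.pi_gt_three.le hx0
  rw [H.integral_deriv' (mul_pos hd0 hx0) (by nlinarith)] at k2'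
  have k4 := H.norm_halfTransform_le hxi
  rw [inv_inv] at k4
  set Z := halfTransform K x⁻¹
  have l1 : c₁ * x ^ σ ≤ Z.im := by
    have e1 : (1 - Real.cos 1) * (K (1 * x) - K (2 * x)) * x ≤ Z.im := by
      have := k1'.trans k1
      rwa [inv_mul_eq_div, le_div_iff₀ hx0] at this
    refine le_trans ?_ e1
    have e2 : (κ * d / 2) * x ^ σ ≤ (K (1 * x) - K (2 * x)) * x := by
      calc (κ * d / 2) * x ^ σ ≤ (x ^ (1 - σ) * K (1 * x) - x ^ (1 - σ) * K (2 * x)) * x ^ σ :=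
            mul_le_mul_of_nonneg_right hS.le hxs.le
        _ = (K (1 * x) - K (2 * x)) * (x ^ (1 - σ) * x ^ σ) := by ring
        _ = _ := by rw [hmul]
    rw [mul_assoc, mul_assoc]
    exact mul_le_mul_of_nonneg_left e2 (hcos 1 one_pos le_rfl).le
  have l2 : c₂ * x ^ σ ≤ Z.re := by
    have e1 : (1 - Real.cos d) * (g (d * x) - g (3 * x)) * x ^ 2 ≤ Z.re := by
      have := k2'.trans k2
      rwa [inv_pow, inv_mul_eq_div, le_div_iff₀ (by positivity)] at this
    refine le_trans ?_ e1
    have e3 := H.le_mul_deriv (x := d * x) (y := 2 * d * x) (mul_pos hd0 hx0)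
      (by nlinarith [mul_pos hd0 hx0])
    have e4 := H.mul_deriv_le (x := 1 * x) (y := 3 * x) (by linarith) (by linarith)
    have e5 := H.pos (3 * x) (by linarith)
    have e6 : (K (d * x) - K (2 * d * x)) / d - K (1 * x) / 2 ≤ (g (d * x) - g (3 * x)) * x := by
      have f1 : (K (d * x) - K (2 * d * x)) / d ≤ g (d * x) * x := by
        rw [div_le_iff₀ hd0]; linarith
      linarith
    have e2 : (κ / 4) * x ^ σ ≤ (g (d * x) - g (3 * x)) * x ^ 2 := by
      calc (κ / 4) * x ^ σ ≤ ((x ^ (1 - σ) * K (d * x) - x ^ (1 - σ) * K (2 * d * x)) / d -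
            x ^ (1 - σ) * K (1 * x) / 2) * x ^ σ := mul_le_mul_of_nonneg_right hC.le hxs.le
        _ = ((K (d * x) - K (2 * d * x)) / d - K (1 * x) / 2) * (x ^ (1 - σ) * x ^ σ) := by ring
        _ = ((K (d * x) - K (2 * d * x)) / d - K (1 * x) / 2) * x := by rw [hmul]
        _ ≤ (g (d * x) - g (3 * x)) * x * x := mul_le_mul_of_nonneg_right e6 hx0.le
        _ = _ := by ring
    rw [mul_assoc, mul_assoc]
    exact mul_le_mul_of_nonneg_left e2 (hcos d hd0 hd1.le).le
  have l4 : ‖Z‖ ≤ 6 * κ / σ * x ^ σ := by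
    have e1 : ∫ t in (0 : ℝ)..x, 2 * κ * t ^ (σ - 1) = 2 * κ * (x ^ σ / σ) := by
      rw [intervalIntegral.integral_const_mul, integral_rpow (Or.inl (by linarith)),
        Real.zero_rpow (by linarith)]
      simp
    have e2 : ∫ t in (0 : ℝ)..x, K t ≤ 2 * κ * (x ^ σ / σ) := by
      rw [← e1]
      exact intervalIntegral.integral_mono_on_of_le_Ioo hx0.le (H.intervalIntegrable _ _)
        ((intervalIntegral.intervalIntegrable_rpow' (by linarith)).const_mul _)
        fun t ht => hKb t ⟨ht.1, ht.2.le.trans hx.2⟩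
    calc ‖Z‖ ≤ 3 * (2 * κ * (x ^ σ / σ)) := by linarith
      _ = _ := by ring
  have l5 : c₁ * x ^ σ ≤ ‖Z‖ := l1.trans (Complex.im_le_norm _)
  have l6 : 0 < ‖Z‖ := lt_of_lt_of_le (by positivity) l5
  -- The estimates give a quotient of order `x^{-σ}`; for `x ≤ 1` this is weakened to a constant
  -- lower bound.
  have hxs1 : x ^ σ ≤ 1 := Real.rpow_le_one hx0.le hx1.2 hσ.le
  constructor
  · rw [le_div_iff₀ (by positivity), div_mul_eq_mul_div, div_le_iff₀ (by positivity)]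
    have : ‖Z‖ ^ 2 ≤ (6 * κ / σ * x ^ σ) ^ 2 := pow_le_pow_left₀ l6.le l4 2
    calc c₂ * ‖Z‖ ^ 2 ≤ c₂ * (6 * κ / σ * x ^ σ) ^ 2 := mul_le_mul_of_nonneg_left this hc₂.le
      _ = (c₂ * x ^ σ) * x ^ σ * (6 * κ / σ) ^ 2 := by ring
      _ ≤ (c₂ * x ^ σ) * 1 * (6 * κ / σ) ^ 2 := by gcongr
      _ ≤ Z.re * (6 * κ / σ) ^ 2 := by rw [mul_one]; gcongr
  · calc Z.re / ‖Z‖ ^ 2 ≤ ‖Z‖ / ‖Z‖ ^ 2 := by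
          gcongr
          exact Complex.re_le_norm _
      _ = 1 / ‖Z‖ := by field_simp
      _ ≤ 1 / (c₁ * x ^ σ) := one_div_le_one_div_of_le (by positivity) l5
      _ = 1 / c₁ * x ^ (-σ) := by rw [Real.rpow_neg hx0.le]; field_simp

end DecayingKernel

theorem spectral_bounds {K : ℝ → ℝ} {σ : ℝ} (hK : KernelAssumption K) (hconv : ConvexKernel K)
    (hσ : FiniteAtZero K σ ∨ InfiniteAtZero K (1 - σ)) :
    ∃ A c M : ℝ, 0 < A ∧ 0 < c ∧ ∀ ω, A ≤ ω →
      c ≤ (halfTransform K ω).re / ‖halfTransform K ω‖ ^ 2 ∧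
      (halfTransform K ω).re / ‖halfTransform K ω‖ ^ 2 ≤ M * ω ^ σ := by
  have H := hK.decayingKernel hconv
  obtain ⟨c, M, hc, hev⟩ : ∃ c M : ℝ, 0 < c ∧ ∀ᶠ x in 𝓝[>] (0 : ℝ),
      c ≤ (halfTransform K x⁻¹).re / ‖halfTransform K x⁻¹‖ ^ 2 ∧
      (halfTransform K x⁻¹).re / ‖halfTransform K x⁻¹‖ ^ 2 ≤ M * x ^ (-σ) := by
    rcases hσ with h | h
    · obtain ⟨L, hL⟩ := h.finite
      exact H.spectral_bounds_of_finite h.lt_one hL (by simpa using h.deriv_lim.neg)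
    · obtain ⟨κ, hκ, hlim⟩ := h.power_lim
      exact H.spectral_bounds_of_infinite (by linarith [h.lt_one]) (by linarith [h.pos]) hκ hlim
  have hev' := tendsto_inv_atTop_nhdsGT_zero.eventually hev
  obtain ⟨A, hA⟩ := eventually_atTop.1 hev'
  refine ⟨max A 1, c, M, by positivity, hc, fun ω hω => ?_⟩
  have hω0 : 0 < ω := one_pos.trans_le ((le_max_right _ _).trans hω)
  have := hA ω ((le_max_left _ _).trans hω)
  rwa [inv_inv, Real.rpow_neg (inv_pos.2 hω0).le, Real.inv_rpow hω0.le, inv_inv] at this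

/-! ### The Fourier transform of Schwartz functions -/

theorem schwartzFourier_eq_fourier (φ : 𝓢(ℝ, ℂ)) (ω : ℝ) :
    schwartzFourier φ ω = 𝓕 (φ : ℝ → ℂ) (ω * (2 * Real.pi)⁻¹) := by
  simp [schwartzFourier, dilation, SchwartzMap.fourier_coe]

theorem schwartzFourier_schwartzFourier (φ : 𝓢(ℝ, ℂ)) (ω : ℝ) :
    schwartzFourier (schwartzFourier φ) ω = 2 * Real.pi * φ (-ω) := by
  rw [schwartzFourier_apply]
  have h1 : ∀ t : ℝ, schwartzFourier φ t * Complex.exp (-(Complex.I * t * ω)) =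
      (fun s : ℝ => Complex.exp (↑(-2 * Real.pi * s * ω) * Complex.I) • 𝓕 (φ : ℝ → ℂ) s)
        (t * (2 * Real.pi)⁻¹) := by
    intro t
    have hpi : (Real.pi : ℂ) ≠ 0 := by exact_mod_cast Real.pi_ne_zero
    simp only [schwartzFourier_eq_fourier, smul_eq_mul]
    rw [mul_comm]
    congr 2
    push_cast
    field_simp
  rw [integral_congr_ae (ae_of_all _ h1)]
  refine (Measure.integral_comp_mul_right (fun s : ℝ =>
    Complex.exp (↑(-2 * Real.pi * s * ω) * Complex.I) • 𝓕 (φ : ℝ → ℂ) s) _).trans ?_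
  rw [← Real.fourier_real_eq_integral_exp_smul, inv_inv,
    abs_of_pos Real.two_pi_pos]
  have h2 : 𝓕 (𝓕 (φ : ℝ → ℂ)) ω = φ (-ω) := by
    have h3 := congrFun (φ.continuous.fourierInv_fourier_eq φ.integrable (𝓕 φ).integrable) (-ω)
    rwa [Real.fourierInv_eq_fourier_neg, neg_neg] at h3
  rw [h2, Complex.real_smul]
  push_cast
  ring

/-- Parseval with a shift: by Fubini the shift becomes the character `e^{-iuω}`, and Fourier
inversion undoes the second transform. -/
theorem integral_schwartzFourier_mul (θ χ : 𝓢(ℝ, ℂ)) (u : ℝ) :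
    ∫ x, schwartzFourier θ (x + u) * schwartzFourier χ x =
      2 * Real.pi * ∫ ω, θ ω * χ (-ω) * Complex.exp (-(Complex.I * u * ω)) := by
  have hexp : ∀ ω y : ℝ, ‖Complex.exp (-(Complex.I * (y : ℂ) * ω))‖ = 1 := by
    intro ω y
    rw [Complex.norm_exp]
    simp
  have hint : Integrable (Function.uncurry fun (x ω : ℝ) =>
      schwartzFourier χ x * θ ω * Complex.exp (-(Complex.I * ((x + u : ℝ) : ℂ) * ω)))
      (volume.prod volume) := by
    refine ((schwartzFourier χ).integrable.mul_prod θ.integrable).mul_bdd (c := 1)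
      (Continuous.aestronglyMeasurable (by fun_prop)) (ae_of_all _ fun p => (hexp _ _).le)
  calc ∫ x, schwartzFourier θ (x + u) * schwartzFourier χ x
      = ∫ x, ∫ ω, schwartzFourier χ x * θ ω *
          Complex.exp (-(Complex.I * ((x + u : ℝ) : ℂ) * ω)) := by
        refine integral_congr_ae (ae_of_all _ fun x => ?_)
        simp only
        rw [schwartzFourier_apply, mul_comm, ← integral_const_mul]
        refine integral_congr_ae (ae_of_all _ fun ω => ?_)
        simp only
        rw [← mul_assoc, mul_right_comm Complex.I (ω : ℂ)]
    _ = ∫ ω, ∫ x, schwartzFourier χ x * θ ω *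
          Complex.exp (-(Complex.I * ((x + u : ℝ) : ℂ) * ω)) := integral_integral_swap hint
    _ = ∫ ω, 2 * Real.pi * (θ ω * χ (-ω) * Complex.exp (-(Complex.I * u * ω))) := by
        refine integral_congr_ae (ae_of_all _ fun ω => ?_)
        simp only
        have : ∀ x : ℝ, schwartzFourier χ x * θ ω *
            Complex.exp (-(Complex.I * ((x + u : ℝ) : ℂ) * ω)) =
            θ ω * Complex.exp (-(Complex.I * u * ω)) *
              (schwartzFourier χ x * Complex.exp (-(Complex.I * x * ω))) := by
          intro x
          have : -(Complex.I * ((x + u : ℝ) : ℂ) * ω) =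
            -(Complex.I * u * ω) + -(Complex.I * x * ω) := by push_cast; ring
          rw [this, Complex.exp_add]
          ring
        simp_rw [this]
        rw [integral_const_mul, ← schwartzFourier_apply, schwartzFourier_schwartzFourier]
        ring
    _ = _ := integral_const_mul _ _

theorem integral_schwartzFourier_mul_of_even (θ χ : 𝓢(ℝ, ℂ)) (hθ : ∀ ω, θ (-ω) = θ ω) (u : ℝ) :
    ∫ x, schwartzFourier θ (x + u) * schwartzFourier χ x =
      2 * Real.pi * ∫ ω, θ ω * χ ω * Complex.exp (Complex.I * u * ω) := by
  rw [integral_schwartzFourier_mul, ← integral_neg_eq_self]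
  congr 1
  refine integral_congr_ae (ae_of_all _ fun ω => ?_)
  simp [hθ]

/-! ### The half transform as a distributional limit -/

namespace DecayingKernel

variable {K g h : ℝ → ℝ}

theorem norm_truncTransform_le' (H : DecayingKernel K g h) {T ω : ℝ} (hT : 1 ≤ T) (hω : ω ≠ 0) :
    ‖truncTransform K T ω‖ ≤ (∫ t in (0 : ℝ)..1, K t) + 2 * K 1 / |ω| := by
  have h1 := H.norm_integral_le one_pos hT hω
  rw [← H.truncTransform_sub] at h1
  have h2 := norm_le_norm_sub_add (truncTransform K T ω) (truncTransform K 1 ω)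
  have h3 := H.norm_truncTransform_le one_pos ω
  linarith

theorem norm_halfTransform_le' (H : DecayingKernel K g h) {ω : ℝ} (hω : ω ≠ 0) :
    ‖halfTransform K ω‖ ≤ (∫ t in (0 : ℝ)..1, K t) + 2 * K 1 / |ω| :=
  le_of_tendsto (H.tendsto_truncTransform hω).norm
    ((eventually_ge_atTop 1).mono fun _ hT => H.norm_truncTransform_le' hT hω)

theorem continuous_truncTransform (H : DecayingKernel K g h) (T : ℝ) :
    Continuous (truncTransform K T) := by
  refine intervalIntegral.continuous_of_dominated_interval (bound := fun t => ‖K t‖)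
    (fun ω => (intervalIntegrable_iff.1 (H.intervalIntegrable_mul_cexp 0 T ω)).1)
    (fun ω => ae_of_all _ fun t _ => ?_) (H.intervalIntegrable 0 T).norm
    (ae_of_all _ fun t _ => by fun_prop)
  rw [norm_mul, Complex.norm_exp, Complex.norm_real]
  simp

theorem aestronglyMeasurable_halfTransform (H : DecayingKernel K g h) :
    AEStronglyMeasurable (halfTransform K) volume := by
  refine aestronglyMeasurable_of_tendsto_ae atTop
    (fun T => (H.continuous_truncTransform T).aestronglyMeasurable) ?_
  filter_upwards [Measure.ae_ne volume (0 : ℝ)] with ω hω using H.tendsto_truncTransform hω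

/-- Dominated convergence. The majorant of the truncated transforms is of order `1/|ω|` at the
origin, which is why `η` must vanish near `0`. -/
theorem tendsto_integral_truncTransform (H : DecayingKernel K g h) {η : ℝ → ℂ}
    (hη : Integrable η) {δ : ℝ} (hδ : 0 < δ) (h0 : ∀ ω, |ω| < δ → η ω = 0) :
    Tendsto (fun T => ∫ ω, η ω * truncTransform K T ω) atTop
      (𝓝 (∫ ω, η ω * halfTransform K ω)) := by
  refine tendsto_integral_filter_of_dominated_convergence
    (fun ω => ‖η ω‖ * ((∫ t in (0 : ℝ)..1, K t) + 2 * K 1 / δ))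
    (Eventually.of_forall fun T => hη.1.mul (H.continuous_truncTransform T).aestronglyMeasurable)
    ?_ (hη.norm.mul_const _) ?_
  · filter_upwards [eventually_ge_atTop 1] with T hT
    refine ae_of_all _ fun ω => ?_
    rw [norm_mul]
    rcases lt_or_ge |ω| δ with h1 | h1
    · simp [h0 ω h1]
    · have hω : ω ≠ 0 := abs_pos.1 (hδ.trans_le h1)
      refine mul_le_mul_of_nonneg_left ((H.norm_truncTransform_le' hT hω).trans ?_) (norm_nonneg _)
      have := H.pos 1 one_pos
      gcongr
  · filter_upwards [Measure.ae_ne volume (0 : ℝ)] with ω hω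
    exact (H.tendsto_truncTransform hω).const_mul _

theorem integral_mul_truncTransform (H : DecayingKernel K g h) {η : ℝ → ℂ}
    (hη : Integrable η) {T : ℝ} (hT : 0 ≤ T) :
    ∫ u in (0 : ℝ)..T, (K u : ℂ) * ∫ ω, η ω * Complex.exp (Complex.I * u * ω) =
      ∫ ω, η ω * truncTransform K T ω := by
  have hKi : Integrable (fun u => (K u : ℂ)) (volume.restrict (Set.Ioc 0 T)) :=
    ((intervalIntegrable_iff_integrableOn_Ioc_of_le hT).1 (H.intervalIntegrable 0 T)).ofReal
  have hint : Integrable (Function.uncurry fun (u ω : ℝ) =>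
      (K u : ℂ) * η ω * Complex.exp (Complex.I * u * ω))
      ((volume.restrict (Set.Ioc 0 T)).prod volume) := by
    refine (hKi.mul_prod hη).mul_bdd (c := 1)
      (Continuous.aestronglyMeasurable (by fun_prop)) (ae_of_all _ fun p => ?_)
    rw [Complex.norm_exp]
    simp
  rw [intervalIntegral.integral_of_le hT]
  calc ∫ u in Set.Ioc 0 T, (K u : ℂ) * ∫ ω, η ω * Complex.exp (Complex.I * u * ω)
      = ∫ u in Set.Ioc 0 T, ∫ ω, (K u : ℂ) * η ω * Complex.exp (Complex.I * u * ω) := by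
        simp_rw [mul_assoc, integral_const_mul]
    _ = ∫ ω, ∫ u in Set.Ioc 0 T, (K u : ℂ) * η ω * Complex.exp (Complex.I * u * ω) :=
        integral_integral_swap hint
    _ = _ := by
        refine integral_congr_ae (ae_of_all _ fun ω => ?_)
        simp only [truncTransform]
        rw [intervalIntegral.integral_of_le hT, ← integral_const_mul]
        refine integral_congr_ae (ae_of_all _ fun u => ?_)
        ring

/-- `K` need not be integrable at infinity, so Fubini is applied on `(0,T]` only and both sides pass
to the limit `T → ∞`. -/
theorem setIntegral_Ioi_eq (H : DecayingKernel K g h) {η : ℝ → ℂ} (hη : Integrable η)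
    {δ : ℝ} (hδ : 0 < δ) (h0 : ∀ ω, |ω| < δ → η ω = 0)
    (hi : IntegrableOn (fun u => (K u : ℂ) * ∫ ω, η ω * Complex.exp (Complex.I * u * ω))
      (Set.Ioi 0)) :
    ∫ u in Set.Ioi 0, (K u : ℂ) * ∫ ω, η ω * Complex.exp (Complex.I * u * ω) =
      ∫ ω, η ω * halfTransform K ω := by
  refine tendsto_nhds_unique (intervalIntegral_tendsto_integral_Ioi 0 hi tendsto_id)
    ((H.tendsto_integral_truncTransform hη hδ h0).congr' ?_)
  filter_upwards [eventually_ge_atTop 0] with T hT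
  exact (H.integral_mul_truncTransform hη hT).symm

/-- Near the origin `K` is integrable and `f` bounded. Beyond `1` it is `K` that is bounded, and
`f(x+u) k(x)` is integrable in both variables by a shear of the plane. -/
theorem integrable_kernel_mul (H : DecayingKernel K g h) (f k : 𝓢(ℝ, ℂ)) :
    Integrable (fun p : ℝ × ℝ => (K p.1 : ℂ) * (f (p.2 + p.1) * k p.2))
      ((volume.restrict (Set.Ioi 0)).prod volume) := by
  have hsplit : (Set.Ioi (0 : ℝ)) = Set.Ioc 0 1 ∪ Set.Ioi 1 :=
    (Set.Ioc_union_Ioi_eq_Ioi zero_le_one).symm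
  have hdisj : Disjoint (Set.Ioc (0 : ℝ) 1) (Set.Ioi 1) :=
    Set.disjoint_left.2 fun x hx hx' => not_lt.2 hx.2 hx'
  rw [hsplit, Measure.restrict_union hdisj measurableSet_Ioi, Measure.add_prod]
  refine Integrable.add_measure ?_ ?_
  · have hKi : Integrable (fun u => (K u : ℂ)) (volume.restrict (Set.Ioc 0 1)) :=
      ((intervalIntegrable_iff_integrableOn_Ioc_of_le zero_le_one).1
        (H.intervalIntegrable 0 1)).ofReal
    have := (hKi.mul_prod k.integrable (μ := volume.restrict (Set.Ioc 0 1)) (ν := volume)).mul_bdd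
      (g := fun p : ℝ × ℝ => f (p.2 + p.1)) (c := SchwartzMap.seminorm ℂ 0 0 f)
      (f.continuous.comp (by fun_prop)).aestronglyMeasurable
      (ae_of_all _ fun p => SchwartzMap.norm_le_seminorm ℂ f _)
    refine this.congr (ae_of_all _ fun p => ?_)
    ring
  · have h1 : Integrable (fun p : ℝ × ℝ => f (p.2 + p.1) * k p.2) (volume.prod volume) := by
      have h2 := (k.integrable (μ := volume)).mul_prod (f.integrable (μ := volume))
      have h3 := (measurePreserving_prod_add_swap (volume : Measure ℝ)
        (volume : Measure ℝ)).integrable_comp_of_integrable h2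
      refine h3.congr (ae_of_all _ fun p => ?_)
      simp only [Function.comp]
      ring
    have hmeas : AEStronglyMeasurable (fun p : ℝ × ℝ => (K p.1 : ℂ))
        ((volume.restrict (Set.Ioi 1)).prod volume) := by
      have : AEStronglyMeasurable (fun t => (K t : ℂ)) (volume.restrict (Set.Ioi (1 : ℝ))) := by
        refine ContinuousOn.aestronglyMeasurable (fun t ht => ?_) measurableSet_Ioi
        exact (Complex.continuous_ofReal.continuousAt.comp
          (H.hasDerivAt t (one_pos.trans ht)).continuousAt).continuousWithinAt
      exact this.comp_fst
    have h4 : Integrable (fun p : ℝ × ℝ => f (p.2 + p.1) * k p.2)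
        ((volume.restrict (Set.Ioi 1)).prod volume) := by
      refine h1.mono_measure ?_
      exact Measure.prod_mono Measure.restrict_le_self le_rfl
    refine h4.bdd_mul (c := K 1) hmeas ?_
    have h5 : ∀ᵐ t ∂(volume.restrict (Set.Ioi (1 : ℝ))), ‖(K t : ℂ)‖ ≤ K 1 := by
      refine (ae_restrict_mem measurableSet_Ioi).mono fun t ht => ?_
      have ht0 : 0 < t := one_pos.trans ht
      rw [Complex.norm_real, Real.norm_of_nonneg (H.pos t ht0).le]
      exact H.antitoneOn (Set.mem_Ioi.2 one_pos) ht0 (le_of_lt ht)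
    exact Measure.quasiMeasurePreserving_fst.ae h5

theorem setIntegral_kernel_eq (H : DecayingKernel K g h) (θ χ : 𝓢(ℝ, ℂ))
    (hθ : ∀ ω, θ (-ω) = θ ω) {δ : ℝ} (hδ : 0 < δ) (h0 : ∀ ω, |ω| < δ → θ ω = 0) :
    ∫ u in Set.Ioi 0, (K u : ℂ) * ∫ x, schwartzFourier θ (x + u) * schwartzFourier χ x =
      2 * Real.pi * ∫ ω, θ ω * χ ω * halfTransform K ω := by
  have hη : Integrable fun ω => θ ω * χ ω :=
    χ.integrable.bdd_mul θ.continuous.aestronglyMeasurable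
      (ae_of_all _ fun ω => SchwartzMap.norm_le_seminorm ℂ θ ω)
  have hpi : (2 * Real.pi : ℂ) ≠ 0 := by exact_mod_cast Real.two_pi_pos.ne'
  have e1 : ∀ u : ℝ, (K u : ℂ) * ∫ x, schwartzFourier θ (x + u) * schwartzFourier χ x =
      2 * Real.pi * ((K u : ℂ) * ∫ ω, θ ω * χ ω * Complex.exp (Complex.I * u * ω)) := fun u => by
    rw [integral_schwartzFourier_mul_of_even θ χ hθ]
    ring
  have hi : IntegrableOn (fun u => (K u : ℂ) *
      ∫ x, schwartzFourier θ (x + u) * schwartzFourier χ x) (Set.Ioi 0) := by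
    have := (H.integrable_kernel_mul (schwartzFourier θ) (schwartzFourier χ)).integral_prod_left
    simpa only [IntegrableOn, integral_const_mul] using this
  simp_rw [e1] at hi ⊢
  rw [integral_const_mul, H.setIntegral_Ioi_eq hη hδ (fun ω hω => by simp [h0 ω hω])]
  exact (integrable_const_mul_iff (isUnit_iff_ne_zero.2 hpi) _).1 hi

end DecayingKernel

/-! ### Bounded functions as tempered distributions -/

theorem isTempered_of_bounded {f : ℝ → ℂ} (hf : AEStronglyMeasurable f volume) {C : ℝ}
    (hC : ∀ x, ‖f x‖ ≤ C) : IsTempered f := by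
  have hm : MemLp f ∞ volume := memLp_top_of_bound hf C (ae_of_all _ hC)
  refine ⟨Lp.toTemperedDistribution hm.toLp, fun φ => ⟨?_, ?_⟩⟩
  · exact φ.integrable.bdd_mul hf (ae_of_all _ hC)
  · rw [Lp.toTemperedDistribution_apply]
    refine integral_congr_ae ?_
    filter_upwards [hm.coeFn_toLp] with x hx
    rw [hx, smul_eq_mul, mul_comm]

/-- An even, real-valued test function supported in a compact subset of `ℝ \ {0}`. -/
structure EvenTest (θ : 𝓢(ℝ, ℂ)) : Prop where
  even : ∀ ω, θ (-ω) = θ ω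
  real : ∀ ω, conj (θ ω) = θ ω
  zero_near : ∃ δ : ℝ, 0 < δ ∧ ∀ ω, |ω| < δ → θ ω = 0
  compact : HasCompactSupport θ

/-- The Fourier transform of an even real test function, as a real Schwartz function. -/
noncomputable def realFourier (θ : 𝓢(ℝ, ℂ)) : 𝓢(ℝ, ℝ) :=
  (schwartzFourier θ).postcompCLM Complex.reCLM

namespace EvenTest

variable {θ θ₁ θ₂ : 𝓢(ℝ, ℂ)}

theorem schwartzFourier_neg (hθ : EvenTest θ) (x : ℝ) :
    schwartzFourier θ (-x) = schwartzFourier θ x := by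
  rw [schwartzFourier_apply, schwartzFourier_apply, ← integral_neg_eq_self]
  refine integral_congr_ae (ae_of_all _ fun ω => ?_)
  simp [hθ.even]

theorem ofReal_realFourier (hθ : EvenTest θ) (x : ℝ) :
    (realFourier θ x : ℂ) = schwartzFourier θ x := by
  have h1 : conj (schwartzFourier θ x) = schwartzFourier θ x := by
    refine Eq.trans ?_ (hθ.schwartzFourier_neg x)
    rw [schwartzFourier_apply, schwartzFourier_apply, ← integral_conj]
    refine integral_congr_ae (ae_of_all _ fun ω => ?_)
    simp [hθ.real, ← Complex.exp_conj]
  rw [realFourier, SchwartzMap.postcompCLM_apply, Complex.reCLM_apply]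
  exact Complex.conj_eq_iff_re.1 h1

theorem realFourier_neg (hθ : EvenTest θ) (x : ℝ) : realFourier θ (-x) = realFourier θ x := by
  have := hθ.ofReal_realFourier (-x)
  rw [hθ.schwartzFourier_neg, ← hθ.ofReal_realFourier] at this
  exact_mod_cast this

end EvenTest

/-- The two reflections turn the causal convolution into a weighted average of future values of `φ`.
-/
theorem testFun_zero_zero (β : ℝ) (K φ : ℝ → ℝ) (x : ℝ) :
    testFun 0 0 β K φ x = β * ∫ u in Set.Ioi 0, K u * φ (x + u) := by
  have h1 : ∀ u, causal K u * refl φ (-x - u) =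
      (Set.Ici (0 : ℝ)).indicator (fun u => K u * φ (x + u)) u := by
    intro u
    by_cases hu : u ∈ Set.Ici (0 : ℝ)
    · simp only [causal, refl, Set.indicator_of_mem hu]
      congr 2
      ring
    · simp only [causal, Set.indicator_of_notMem hu, zero_mul]
  simp only [testFun, refl.eq_1 (conv (causal K) (refl φ)), conv]
  rw [integral_congr_ae (ae_of_all _ h1), integral_indicator measurableSet_Ici,
    integral_Ici_eq_integral_Ioi]
  ring

/-! ### Both sides of the weak equation on even test functions. -/

namespace DecayingKernel

variable {K g h : ℝ → ℝ} {θ θ₁ θ₂ : 𝓢(ℝ, ℂ)}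

theorem halfTransform_neg (H : DecayingKernel K g h) {ω : ℝ} (hω : ω ≠ 0) :
    halfTransform K (-ω) = conj (halfTransform K ω) := by
  refine tendsto_nhds_unique (H.tendsto_truncTransform (neg_ne_zero.2 hω))
    (((Complex.continuous_conj.tendsto _).comp (H.tendsto_truncTransform hω)).congr fun T => ?_)
  simp only [Function.comp, truncTransform, intervalIntegral, map_sub, ← integral_conj]
  simp [← Complex.exp_conj]

theorem exists_bound_mul_halfTransform (H : DecayingKernel K g h) (hθ : EvenTest θ) :
    ∃ C : ℝ, ∀ ω, ‖θ ω * halfTransform K ω‖ ≤ C := by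
  obtain ⟨δ, hδ, h0⟩ := hθ.zero_near
  have hK1 := H.pos 1 one_pos
  have hI : 0 ≤ ∫ t in (0 : ℝ)..1, K t := by
    have := H.mul_le_integral one_pos
    linarith
  refine ⟨SchwartzMap.seminorm ℂ 0 0 θ * ((∫ t in (0 : ℝ)..1, K t) + 2 * K 1 / δ), fun ω => ?_⟩
  rw [norm_mul]
  rcases lt_or_ge |ω| δ with h1 | h1
  · rw [h0 ω h1, norm_zero, zero_mul]
    exact mul_nonneg (apply_nonneg _ _) (by positivity)
  · refine mul_le_mul (SchwartzMap.norm_le_seminorm ℂ θ ω)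
      ((H.norm_halfTransform_le' (abs_pos.1 (hδ.trans_le h1))).trans ?_) (norm_nonneg _)
      (apply_nonneg _ _)
    gcongr

theorem aestronglyMeasurable_integral_kernel (H : DecayingKernel K g h) (f : 𝓢(ℝ, ℂ)) :
    AEStronglyMeasurable (fun x => ∫ u in Set.Ioi 0, (K u : ℂ) * f (x + u)) volume := by
  have hK : AEStronglyMeasurable (fun t => (K t : ℂ)) (volume.restrict (Set.Ioi (0 : ℝ))) := by
    refine ContinuousOn.aestronglyMeasurable (fun t ht => ?_) measurableSet_Ioi
    exact (Complex.continuous_ofReal.continuousAt.comp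
      (H.hasDerivAt t ht).continuousAt).continuousWithinAt
  refine AEStronglyMeasurable.integral_prod_right' (f := fun p : ℝ × ℝ => (K p.2 : ℂ) * f (p.1 + p.2))
    ?_
  exact hK.comp_snd.mul (f.continuous.comp (by fun_prop)).aestronglyMeasurable

theorem norm_integral_kernel_le (H : DecayingKernel K g h) (f : 𝓢(ℝ, ℂ)) (x : ℝ) :
    ‖∫ u in Set.Ioi 0, (K u : ℂ) * f (x + u)‖ ≤
      (∫ t in (0 : ℝ)..1, K t) * SchwartzMap.seminorm ℂ 0 0 f + K 1 * ∫ y, ‖f y‖ := by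
  have hK1 := H.pos 1 one_pos
  have hK01 : IntegrableOn K (Set.Ioc 0 1) :=
    (intervalIntegrable_iff_integrableOn_Ioc_of_le zero_le_one).1 (H.intervalIntegrable 0 1)
  have hfx : Integrable fun u => ‖f (x + u)‖ := (f.integrable.comp_add_left x).norm
  have hb1 : ∀ u ∈ Set.Ioc (0 : ℝ) 1,
      ‖(K u : ℂ) * f (x + u)‖ ≤ K u * SchwartzMap.seminorm ℂ 0 0 f := fun u hu => by
    rw [norm_mul, Complex.norm_real, Real.norm_of_nonneg (H.pos u hu.1).le]
    exact mul_le_mul_of_nonneg_left (SchwartzMap.norm_le_seminorm ℂ f _) (H.pos u hu.1).le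
  have hb2 : ∀ u ∈ Set.Ioi (1 : ℝ), ‖(K u : ℂ) * f (x + u)‖ ≤ K 1 * ‖f (x + u)‖ := fun u hu => by
    have hu0 : 0 < u := one_pos.trans hu
    rw [norm_mul, Complex.norm_real, Real.norm_of_nonneg (H.pos u hu0).le]
    exact mul_le_mul_of_nonneg_right (H.antitoneOn (Set.mem_Ioi.2 one_pos) hu0 (le_of_lt hu))
      (norm_nonneg _)
  have hm : AEStronglyMeasurable (fun u => (K u : ℂ) * f (x + u))
      (volume.restrict (Set.Ioi (0 : ℝ))) := by
    refine ContinuousOn.aestronglyMeasurable (fun t ht => ?_) measurableSet_Ioi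
    exact ((Complex.continuous_ofReal.continuousAt.comp
      (H.hasDerivAt t ht).continuousAt).mul
        (f.continuous.comp (by fun_prop)).continuousAt).continuousWithinAt
  have i1 : IntegrableOn (fun u => (K u : ℂ) * f (x + u)) (Set.Ioc 0 1) :=
    (hK01.mul_const _).mono' (hm.mono_set Set.Ioc_subset_Ioi_self)
      ((ae_restrict_mem measurableSet_Ioc).mono hb1)
  have i2 : IntegrableOn (fun u => (K u : ℂ) * f (x + u)) (Set.Ioi 1) :=
    (hfx.integrableOn.const_mul _).mono' (hm.mono_set (Set.Ioi_subset_Ioi zero_le_one))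
      ((ae_restrict_mem measurableSet_Ioi).mono hb2)
  have hdisj : Disjoint (Set.Ioc (0 : ℝ) 1) (Set.Ioi 1) :=
    Set.disjoint_left.2 fun x hx hx' => not_lt.2 hx.2 hx'
  rw [← Set.Ioc_union_Ioi_eq_Ioi (zero_le_one (α := ℝ)),
    setIntegral_union hdisj measurableSet_Ioi i1 i2]
  refine (norm_add_le _ _).trans (add_le_add ?_ ?_)
  · rw [intervalIntegral.integral_of_le zero_le_one, ← integral_mul_const]
    exact norm_integral_le_of_norm_le (hK01.mul_const _)
      ((ae_restrict_mem measurableSet_Ioc).mono hb1)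
  · rw [← integral_add_left_eq_self (fun y => ‖f y‖) x,
      ← integral_const_mul, ← integral_indicator measurableSet_Ioi]
    have h2 : ∀ u, ‖(Set.Ioi (1 : ℝ)).indicator (fun u => (K u : ℂ) * f (x + u)) u‖ ≤
        K 1 * ‖f (x + u)‖ := fun u => by
      by_cases hu : u ∈ Set.Ioi (1 : ℝ)
      · rw [Set.indicator_of_mem hu]
        exact hb2 u hu
      · rw [Set.indicator_of_notMem hu, norm_zero]
        positivity
    exact norm_integral_le_of_norm_le (hfx.const_mul _) (ae_of_all _ h2)

theorem ofReal_testFun (hθ : EvenTest θ) (β x : ℝ) :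
    (testFun 0 0 β K (realFourier θ) x : ℂ) =
      β * ∫ u in Set.Ioi 0, (K u : ℂ) * schwartzFourier θ (x + u) := by
  rw [testFun_zero_zero, Complex.ofReal_mul, ← integral_complex_ofReal]
  congr 1
  refine integral_congr_ae (ae_of_all _ fun u => ?_)
  simp only [← hθ.ofReal_realFourier]
  push_cast
  rfl

theorem isTempered_testFun (H : DecayingKernel K g h) (hθ : EvenTest θ) (β : ℝ) :
    IsTempered fun x => (testFun 0 0 β K (realFourier θ) x : ℂ) := by
  simp_rw [ofReal_testFun hθ]
  refine isTempered_of_bounded ((H.aestronglyMeasurable_integral_kernel _).const_mul _)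
    (C := |β| * ((∫ t in (0 : ℝ)..1, K t) * SchwartzMap.seminorm ℂ 0 0 (schwartzFourier θ) +
      K 1 * ∫ y, ‖schwartzFourier θ y‖)) fun x => ?_
  rw [norm_mul, Complex.norm_real, Real.norm_eq_abs]
  exact mul_le_mul_of_nonneg_left (H.norm_integral_kernel_le _ x) (abs_nonneg _)

/-- Correlating with `K⁺` multiplies the Fourier transform by `Z`, and for even `θ` transforming
`schwartzFourier θ` again returns `2πθ`. The support of `θ` keeps the product bounded. -/
theorem isFourierFunction_testFun (H : DecayingKernel K g h) (hθ : EvenTest θ) (β : ℝ) :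
    IsFourierFunction (ofFun fun x => (testFun 0 0 β K (realFourier θ) x : ℂ))
      fun ω => 2 * Real.pi * β * (θ ω * halfTransform K ω) := by
  obtain ⟨C, hC⟩ := H.exists_bound_mul_halfTransform hθ
  obtain ⟨δ, hδ, h0⟩ := hθ.zero_near
  refine ⟨?_, fun χ _ => ?_⟩
  · have hm : AEStronglyMeasurable (fun ω => 2 * Real.pi * β * (θ ω * halfTransform K ω)) volume :=
      (θ.continuous.aestronglyMeasurable.mul H.aestronglyMeasurable_halfTransform).const_mul _
    have hlp : MemLp (fun ω => 2 * Real.pi * β * (θ ω * halfTransform K ω)) ∞ volume :=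
      memLp_top_of_bound hm (‖(2 * Real.pi * β : ℂ)‖ * C) (ae_of_all _ fun ω => by
        rw [norm_mul]
        exact mul_le_mul_of_nonneg_left (hC ω) (norm_nonneg _))
    exact hlp.locallyIntegrable le_top
  · rw [ofFun_apply (H.isTempered_testFun hθ β)]
    simp_rw [ofReal_testFun hθ]
    calc ∫ x, β * (∫ u in Set.Ioi 0, (K u : ℂ) * schwartzFourier θ (x + u)) * schwartzFourier χ x
        = β * ∫ x, ∫ u in Set.Ioi 0,
            (K u : ℂ) * (schwartzFourier θ (x + u) * schwartzFourier χ x) := by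
          rw [← integral_const_mul]
          refine integral_congr_ae (ae_of_all _ fun x => ?_)
          simp only [← mul_assoc (K _ : ℂ), integral_mul_const]
          rw [mul_assoc]
      _ = β * ∫ u in Set.Ioi 0, (K u : ℂ) *
            ∫ x, schwartzFourier θ (x + u) * schwartzFourier χ x := by
          rw [← integral_integral_swap (H.integrable_kernel_mul _ _)]
          simp_rw [integral_const_mul]
      _ = _ := by
          rw [H.setIntegral_kernel_eq θ χ hθ.even hδ h0, ← integral_const_mul, ← integral_const_mul]
          refine integral_congr_ae (ae_of_all _ fun ω => ?_)
          ring

/-- `K` and the correlation of two even functions are even, so the integral is twice that over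
`(0,∞)`; this doubles the `2π` of `setIntegral_kernel_eq`. -/
theorem integral_kernel_mul_conv (H : DecayingKernel K g h) (hsymm : ∀ t, K (-t) = K t)
    (hθ₁ : EvenTest θ₁) (hθ₂ : EvenTest θ₂) :
    ((∫ t, K t * conv (realFourier θ₁) (refl (realFourier θ₂)) t : ℝ) : ℂ) =
      4 * Real.pi * ∫ ω, θ₁ ω * θ₂ ω * halfTransform K ω := by
  obtain ⟨δ, hδ, h0⟩ := hθ₁.zero_near
  set c := conv (realFourier θ₁) (refl (realFourier θ₂)) with hc
  have hc1 : ∀ t, c t = ∫ x, realFourier θ₁ (x + t) * realFourier θ₂ x := fun t => by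
    simp only [hc, conv, refl]
    rw [← integral_add_right_eq_self _ t]
    refine integral_congr_ae (ae_of_all _ fun x => ?_)
    simp only
    congr 2
    ring
  have hceven : ∀ t, c (-t) = c t := fun t => by
    rw [hc1, hc1, ← integral_neg_eq_self]
    refine integral_congr_ae (ae_of_all _ fun x => ?_)
    simp only
    rw [← neg_add, hθ₁.realFourier_neg, hθ₂.realFourier_neg]
  have habs : ∀ t, K t * c t = (fun s => K s * c s) |t| := fun t => by
    rcases abs_choice t with h | h <;> simp [h, hsymm, hceven]
  have hcC : ∀ t, (c t : ℂ) = ∫ x, schwartzFourier θ₁ (x + t) * schwartzFourier θ₂ x := fun t => by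
    rw [hc1, ← integral_complex_ofReal]
    refine integral_congr_ae (ae_of_all _ fun x => ?_)
    simp only [← hθ₁.ofReal_realFourier, ← hθ₂.ofReal_realFourier]
    push_cast
    rfl
  rw [integral_congr_ae (ae_of_all _ habs), integral_comp_abs (f := fun s => K s * c s),
    Complex.ofReal_mul, ← integral_complex_ofReal]
  have h2 := H.setIntegral_kernel_eq θ₁ θ₂ hθ₁.even hδ h0
  simp_rw [← hcC] at h2
  have h3 : ∫ t in Set.Ioi (0 : ℝ), ((K t * c t : ℝ) : ℂ) =
      ∫ t in Set.Ioi (0 : ℝ), (K t : ℂ) * (c t : ℂ) := by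
    refine integral_congr_ae (ae_of_all _ fun x => ?_)
    simp
  rw [h3, h2]
  push_cast
  ring

end DecayingKernel

/-! ### Identification of the spectral measure -/

theorem isLocallyFinite_of_tempered {ν : Measure ℝ}
    (h : ∃ k : ℕ, ∫⁻ x, ENNReal.ofReal (1 / (1 + x ^ 2) ^ k) ∂ν < ∞) (R : ℝ) :
    ν (Metric.closedBall 0 R) < ∞ := by
  obtain ⟨k, hk⟩ := h
  have hc : 0 < ENNReal.ofReal (1 / (1 + R ^ 2) ^ k) := by
    rw [ENNReal.ofReal_pos]
    positivity
  have h1 : ENNReal.ofReal (1 / (1 + R ^ 2) ^ k) * ν (Metric.closedBall 0 R) ≤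
      ∫⁻ x, ENNReal.ofReal (1 / (1 + x ^ 2) ^ k) ∂ν := by
    calc _ = ∫⁻ _ in Metric.closedBall 0 R, ENNReal.ofReal (1 / (1 + R ^ 2) ^ k) ∂ν := by
          rw [setLIntegral_const]
      _ ≤ ∫⁻ x in Metric.closedBall 0 R, ENNReal.ofReal (1 / (1 + x ^ 2) ^ k) ∂ν := by
          refine setLIntegral_mono' Metric.isClosed_closedBall.measurableSet fun x hx => ?_
          rw [mem_closedBall_zero_iff, Real.norm_eq_abs] at hx
          refine ENNReal.ofReal_le_ofReal (one_div_le_one_div_of_le (by positivity) ?_)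
          have : x ^ 2 ≤ R ^ 2 := sq_le_sq' (by linarith [neg_abs_le x]) ((le_abs_self x).trans hx)
          gcongr
      _ ≤ _ := setLIntegral_le_lintegral _ _
  by_contra hcon
  rw [not_lt, top_le_iff] at hcon
  rw [hcon, ENNReal.mul_top hc.ne'] at h1
  exact (not_lt.2 h1) hk

theorem isLocallyFiniteMeasure_of_tempered {ν : Measure ℝ}
    (h : ∃ k : ℕ, ∫⁻ x, ENNReal.ofReal (1 / (1 + x ^ 2) ^ k) ∂ν < ∞) :
    IsLocallyFiniteMeasure ν :=
  ⟨fun x => ⟨Metric.closedBall 0 (|x| + 1),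
    Metric.closedBall_mem_nhds_of_mem (by simp),
    isLocallyFinite_of_tempered h _⟩⟩

theorem RandomMeasure.inner_stochInt {Ω : Type*} [MeasurableSpace Ω] {ν : Measure ℝ}
    {P : Measure Ω} (ξ : RandomMeasure ν P) (a b : Lp ℂ 2 ν) :
    inner ℂ (ξ.stochInt a) (ξ.stochInt b) = inner ℂ a b :=
  LinearIsometry.inner_map_map
    (⟨ξ.stochInt.toLinearMap, ξ.norm_stochInt⟩ : Lp ℂ 2 ν →ₗᵢ[ℂ] Lp ℂ 2 P) a b

theorem RandomMeasure.integral_op_mul_conj {Ω : Type*} [MeasurableSpace Ω] {ν : Measure ℝ}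
    {P : Measure Ω} (ξ : RandomMeasure ν P) (hν : ν ≪ volume) {f₁ f₂ : 𝓢'(ℝ, ℂ)} {h₁ h₂ : ℝ → ℂ}
    (H₁ : IsFourierFunction f₁ h₁) (H₂ : IsFourierFunction f₂ h₂) (M₁ : MemLp h₁ 2 ν)
    (M₂ : MemLp h₂ 2 ν) :
    ∫ x, ξ.op f₁ x * conj (ξ.op f₂ x) ∂P = ∫ ω, conj (h₁ ω) * h₂ ω ∂ν := by
  have h1 : inner ℂ (ξ.op f₂) (ξ.op f₁) = ∫ x, ξ.op f₁ x * conj (ξ.op f₂ x) ∂P := by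
    rw [L2.inner_def]
    refine integral_congr_ae (ae_of_all _ fun x => ?_)
    simp [RCLike.inner_apply]
  rw [← h1, ξ.op_eq hν H₁ M₁, ξ.op_eq hν H₂ M₂, ξ.inner_stochInt, L2.inner_def]
  refine integral_congr_ae ?_
  filter_upwards [M₁.star.coeFn_toLp, M₂.star.coeFn_toLp] with x hx₁ hx₂
  rw [hx₁, hx₂]
  simp [RCLike.inner_apply]

theorem DecayingKernel.memLp_mul_halfTransform {K g h : ℝ → ℝ} (H : DecayingKernel K g h)
    {θ : 𝓢(ℝ, ℂ)} (hθ : EvenTest θ) {ν : Measure ℝ} (hν : ν ≪ volume) [IsLocallyFiniteMeasure ν] :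
    MemLp (fun ω => θ ω * halfTransform K ω) 2 ν := by
  obtain ⟨C, hC⟩ := H.exists_bound_mul_halfTransform hθ
  have hfin : ν (tsupport θ) ≠ ∞ := hθ.compact.isCompact.measure_lt_top.ne
  refine (memLp_indicator_const 2 (isClosed_tsupport θ).measurableSet C (Or.inr hfin)).mono
    ((θ.continuous.aestronglyMeasurable.mul H.aestronglyMeasurable_halfTransform).mono_ac hν)
    (ae_of_all _ fun ω => ?_)
  by_cases hω : ω ∈ tsupport θ
  · rw [Set.indicator_of_mem hω]
    exact (hC ω).trans (le_abs_self C)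
  · rw [image_eq_zero_of_notMem_tsupport hω, zero_mul, norm_zero]
    exact norm_nonneg _

/-- By the isometry the left side of the equation is `4π²β² ∫ θ₁θ₂|Z|² dν`; the covariance of `√β F`
makes the right side `4πβ ∫ θ₁θ₂Z`. Dividing by `4πβ` gives the identity. -/
theorem IsWeakSolution.integral_evenTest {Ω Ω' : Type*} [MeasurableSpace Ω] [MeasurableSpace Ω']
    {P : Measure Ω} {Q : Measure Ω'} {K g h : ℝ → ℝ} {β : ℝ} (hβ : 0 < β)
    (H : DecayingKernel K g h) (hsymm : ∀ t, K (-t) = K t) {W F : 𝓢(ℝ, ℝ) →ₗ[ℝ] Lp ℂ 2 Q}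
    (hF : HasCovariance F K) {ν : Measure ℝ} {ξ : RandomMeasure ν P}
    (hV : IsWeakSolution 0 0 β K W F ξ) {θ₁ θ₂ : 𝓢(ℝ, ℂ)} (hθ₁ : EvenTest θ₁)
    (hθ₂ : EvenTest θ₂) :
    Real.pi * β * ∫ ω, θ₁ ω * θ₂ ω * ‖halfTransform K ω‖ ^ 2 ∂ν =
      ∫ ω, θ₁ ω * θ₂ ω * halfTransform K ω := by
  have := isLocallyFiniteMeasure_of_tempered hV.tempered
  have hν := hV.absolutelyContinuous
  have heq := hV.eqn (realFourier θ₁) (realFourier θ₂)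
  rw [ξ.integral_op_mul_conj hν (H.isFourierFunction_testFun hθ₁ β)
    (H.isFourierFunction_testFun hθ₂ β) ((H.memLp_mul_halfTransform hθ₁ hν).const_mul _)
    ((H.memLp_mul_halfTransform hθ₂ hν).const_mul _)] at heq
  have hR : ∫ x, (√(2 * 0) • W (realFourier θ₁) + √β • F (realFourier θ₁) : Lp ℂ 2 Q) x *
      conj ((√(2 * 0) • W (realFourier θ₂) + √β • F (realFourier θ₂) : Lp ℂ 2 Q) x) ∂Q =
      β * (4 * Real.pi * ∫ ω, θ₁ ω * θ₂ ω * halfTransform K ω) := by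
    rw [← H.integral_kernel_mul_conv hsymm hθ₁ hθ₂, ← hF, ← integral_const_mul]
    simp only [mul_zero, Real.sqrt_zero, zero_smul, zero_add]
    refine integral_congr_ae ?_
    filter_upwards [Lp.coeFn_smul (√β) (F (realFourier θ₁)),
      Lp.coeFn_smul (√β) (F (realFourier θ₂))] with x h1 h2
    rw [h1, h2]
    have h3 : (√β : ℂ) * (√β : ℂ) = β := by exact_mod_cast Real.mul_self_sqrt hβ.le
    simp only [Pi.smul_apply, Complex.real_smul, map_mul, Complex.conj_ofReal]
    linear_combination (F (realFourier θ₁) x * conj (F (realFourier θ₂) x)) * h3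
  have hL : ∫ ω, conj (2 * Real.pi * β * (θ₁ ω * halfTransform K ω)) *
      (2 * Real.pi * β * (θ₂ ω * halfTransform K ω)) ∂ν =
      4 * Real.pi ^ 2 * β ^ 2 * ∫ ω, θ₁ ω * θ₂ ω * ‖halfTransform K ω‖ ^ 2 ∂ν := by
    rw [← integral_const_mul]
    refine integral_congr_ae (ae_of_all _ fun ω => ?_)
    simp only [map_mul, hθ₁.real, Complex.conj_ofReal, map_ofNat, ← Complex.mul_conj']
    ring
  rw [hL, hR] at heq
  have hβ' : (β : ℂ) ≠ 0 := by exact_mod_cast hβ.ne'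
  have hpi : (Real.pi : ℂ) ≠ 0 := by exact_mod_cast Real.pi_ne_zero
  refine mul_left_cancel₀ (mul_ne_zero (mul_ne_zero (by norm_num : (4 : ℂ) ≠ 0) hpi) hβ') ?_
  linear_combination heq

theorem exists_evenTest {f : ℝ → ℝ} (hf : ContDiff ℝ (⊤ : ℕ∞) f) (hc : HasCompactSupport f)
    (hs : tsupport f ⊆ Set.Ioi 0) :
    ∃ θ : 𝓢(ℝ, ℂ), EvenTest θ ∧ ∀ ω, θ ω = ((f ω + f (-ω) : ℝ) : ℂ) := by
  have hcn : HasCompactSupport fun ω => f (-ω) := hc.comp_homeomorph (Homeomorph.neg ℝ)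
  have hc' : HasCompactSupport (fun ω => ((f ω + f (-ω) : ℝ) : ℂ)) :=
    (hc.add hcn).comp_left (g := fun x : ℝ => (x : ℂ)) (by simp)
  have hf' : ContDiff ℝ (⊤ : ℕ∞) (fun ω => ((f ω + f (-ω) : ℝ) : ℂ)) :=
    Complex.ofRealCLM.contDiff.comp (hf.add (hf.comp contDiff_neg))
  refine ⟨hc'.toSchwartzMap hf', ⟨fun ω => ?_, fun ω => ?_, ?_, hc'⟩, fun ω => rfl⟩
  · simp [add_comm]
  · simp
  · have h0 : (tsupport f)ᶜ ∈ 𝓝 (0 : ℝ) :=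
      (isClosed_tsupport f).isOpen_compl.mem_nhds fun h => lt_irrefl (0 : ℝ) (hs h)
    obtain ⟨δ, hδ, hball⟩ := Metric.mem_nhds_iff.1 h0
    have hz : ∀ ω, |ω| < δ → f ω = 0 := fun ω hω =>
      image_eq_zero_of_notMem_tsupport (hball (by simpa using hω))
    refine ⟨δ, hδ, fun ω hω => ?_⟩
    simp [hz ω hω, hz (-ω) (by rwa [abs_neg])]

theorem apply_neg_eq_zero {f : ℝ → ℝ} (hs : tsupport f ⊆ Set.Ioi 0) {ω : ℝ} (hω : 0 < ω) :
    f (-ω) = 0 :=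
  image_eq_zero_of_notMem_tsupport fun h => by have := Set.mem_Ioi.1 (hs h); linarith

/-- A bump function, compactly supported in `(0,∞)`, which is `1` on a given interval. -/
theorem exists_bump {a b : ℝ} (ha : 0 < a) (hab : a ≤ b) :
    ∃ f : ℝ → ℝ, ContDiff ℝ (⊤ : ℕ∞) f ∧ HasCompactSupport f ∧ tsupport f ⊆ Set.Ioi 0 ∧
      ∀ ω ∈ Set.Icc a b, f ω = 1 := by
  let B : ContDiffBump ((a + b) / 2) :=
    ⟨(b - a) / 2 + a / 4, (b - a) / 2 + a / 2, by linarith, by linarith⟩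
  refine ⟨B, B.contDiff, B.hasCompactSupport, ?_, fun ω hω => B.one_of_mem_closedBall ?_⟩
  · rw [B.tsupport_eq]
    intro x hx
    rw [Metric.mem_closedBall, Real.dist_eq] at hx
    have := (abs_le.1 hx).1
    simp only [B] at this
    rw [Set.mem_Ioi]
    linarith
  · rw [Metric.mem_closedBall, Real.dist_eq, abs_le]
    simp only [B]
    constructor <;> linarith [hω.1, hω.2]

/-! ### The density of the spectral measure. -/

section Density

variable {Ω Ω' : Type*} [MeasurableSpace Ω] [MeasurableSpace Ω']
  {P : Measure Ω} {Q : Measure Ω'} {K g h : ℝ → ℝ} {β : ℝ}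
  {W F : 𝓢(ℝ, ℝ) →ₗ[ℝ] Lp ℂ 2 Q} {ν : Measure ℝ} {ξ : RandomMeasure ν P}

/-- The defect in the equation for the density of the spectral measure. -/
noncomputable def densityDefect (K : ℝ → ℝ) (β : ℝ) (ν : Measure ℝ) (ω : ℝ) : ℂ :=
  (ν.rnDeriv volume ω).toReal * (Real.pi * β * ‖halfTransform K ω‖ ^ 2) - halfTransform K ω

theorem DecayingKernel.integral_evenTest_mul_defect (H : DecayingKernel K g h) (hβ : 0 < β)
    (hsymm : ∀ t, K (-t) = K t) (hF : HasCovariance F K) (hV : IsWeakSolution 0 0 β K W F ξ)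
    {θ₁ θ₂ : 𝓢(ℝ, ℂ)} (hθ₁ : EvenTest θ₁) (hθ₂ : EvenTest θ₂) :
    Integrable (fun ω => θ₁ ω * θ₂ ω * densityDefect K β ν ω) ∧
      ∫ ω, θ₁ ω * θ₂ ω * densityDefect K β ν ω = 0 := by
  have hlf := isLocallyFiniteMeasure_of_tempered hV.tempered
  have hν := hV.absolutelyContinuous
  have i1 : Integrable (fun ω => Real.pi * β * (θ₁ ω * θ₂ ω * ‖halfTransform K ω‖ ^ 2)) ν := by
    have := (H.memLp_mul_halfTransform hθ₁ hν).integrable_mul (H.memLp_mul_halfTransform hθ₂ hν).star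
    refine Integrable.const_mul (this.congr (ae_of_all _ fun ω => ?_)) _
    have h1 : conj (θ₂ ω * halfTransform K ω) = θ₂ ω * conj (halfTransform K ω) := by
      rw [map_mul, hθ₂.real]
    simp only [Pi.mul_apply, Pi.star_apply, RCLike.star_def, h1, ← Complex.mul_conj']
    ring
  have i1' : Integrable fun ω => (ν.rnDeriv volume ω).toReal •
      (Real.pi * β * (θ₁ ω * θ₂ ω * ‖halfTransform K ω‖ ^ 2) : ℂ) :=
    (integrable_rnDeriv_smul_iff hν).2 i1
  have i2 : Integrable fun ω => θ₁ ω * θ₂ ω * halfTransform K ω := by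
    have := (H.memLp_mul_halfTransform hθ₁ (Measure.AbsolutelyContinuous.refl volume)).integrable_mul
      (θ₂.memLp 2)
    refine this.congr (ae_of_all _ fun ω => ?_)
    simp only [Pi.mul_apply]
    ring
  have e : ∀ ω, θ₁ ω * θ₂ ω * densityDefect K β ν ω = (ν.rnDeriv volume ω).toReal •
      (Real.pi * β * (θ₁ ω * θ₂ ω * ‖halfTransform K ω‖ ^ 2) : ℂ) -
      θ₁ ω * θ₂ ω * halfTransform K ω := fun ω => by
    rw [densityDefect, Complex.real_smul]
    ring
  refine ⟨(i1'.sub i2).congr (ae_of_all _ fun ω => (e ω).symm), ?_⟩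
  rw [integral_congr_ae (ae_of_all _ e), integral_sub i1' i2, integral_rnDeriv_smul hν,
    integral_const_mul, hV.integral_evenTest hβ H hsymm hF hθ₁ hθ₂, sub_self]

/-- A test function equal to `1` around `x` and `-x` turns integrability of the pairing into local
integrability of the defect. -/
theorem DecayingKernel.locallyIntegrableOn_defect (H : DecayingKernel K g h) (hβ : 0 < β)
    (hsymm : ∀ t, K (-t) = K t) (hF : HasCovariance F K) (hV : IsWeakSolution 0 0 β K W F ξ) :
    LocallyIntegrableOn (fun ω => densityDefect K β ν ω + densityDefect K β ν (-ω))
      (Set.Ioi 0) := by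
  intro x hx
  have hx0 : 0 < x := hx
  obtain ⟨f, hf, hc, hs, h1⟩ := exists_bump (a := x / 2) (b := 2 * x) (by linarith) (by linarith)
  obtain ⟨θ, hθ, hθf⟩ := exists_evenTest hf hc hs
  have hi := (H.integral_evenTest_mul_defect hβ hsymm hF hV hθ hθ).1
  have hθ1 : ∀ ω ∈ Set.Icc (x / 2) (2 * x), θ ω = 1 := fun ω hω => by
    rw [hθf, h1 ω hω, apply_neg_eq_zero hs (by linarith [hω.1])]
    simp
  have hG : IntegrableOn (densityDefect K β ν) (Set.Icc (x / 2) (2 * x)) := by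
    refine hi.integrableOn.congr_fun (fun ω hω => ?_) measurableSet_Icc
    simp [hθ1 ω hω]
  have hG' : IntegrableOn (fun ω => densityDefect K β ν (-ω)) (Set.Icc (x / 2) (2 * x)) := by
    refine hi.comp_neg.integrableOn.congr_fun (fun ω hω => ?_) measurableSet_Icc
    simp [hθ.even, hθ1 ω hω]
  exact ⟨Set.Icc (x / 2) (2 * x), mem_nhdsWithin_of_mem_nhds (Icc_mem_nhds (by linarith)
    (by linarith)), hG.add hG'⟩

/-- Even tests only see the symmetrised defect, so the line is folded onto `(0,∞)` and the
fundamental lemma of the calculus of variations is applied there. In the sum `Z` and its conjugate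
combine to `2 Re Z`. -/
theorem DecayingKernel.density_eq (H : DecayingKernel K g h) (hβ : 0 < β)
    (hsymm : ∀ t, K (-t) = K t) (hF : HasCovariance F K) (hV : IsWeakSolution 0 0 β K W F ξ) :
    ∀ᵐ ω, 0 < ω → ((ν.rnDeriv volume ω).toReal + (ν.rnDeriv volume (-ω)).toReal) *
      (Real.pi * β * ‖halfTransform K ω‖ ^ 2) = 2 * (halfTransform K ω).re := by
  have key := isOpen_Ioi.ae_eq_zero_of_integral_contDiff_smul_eq_zero
    (H.locallyIntegrableOn_defect hβ hsymm hF hV) fun f hf hc hs => ?_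
  · filter_upwards [key] with ω hω hω0
    have h1 := hω hω0
    rw [densityDefect, densityDefect, H.halfTransform_neg hω0.ne', RCLike.norm_conj] at h1
    have h2 := Complex.add_conj (halfTransform K ω)
    have h3 : (((ν.rnDeriv volume ω).toReal + (ν.rnDeriv volume (-ω)).toReal) *
      (Real.pi * β * ‖halfTransform K ω‖ ^ 2) : ℂ) = ((2 * (halfTransform K ω).re : ℝ) : ℂ) := by
      linear_combination h1 + h2
    exact_mod_cast h3
  · rcases (tsupport f).eq_empty_or_nonempty with he | hne
    · have : f = 0 := by rwa [tsupport_eq_empty_iff] at he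
      simp [this]
    obtain ⟨a, ha, hamin⟩ := hc.isCompact.exists_isLeast hne
    obtain ⟨b, hb, hbmax⟩ := hc.isCompact.exists_isGreatest hne
    -- The equation pairs two test functions. Taking the second equal to `1` on the support of `f`
    -- makes the product `f` on the positive axis.
    obtain ⟨f₂, hf₂, hc₂, hs₂, h₂⟩ := exists_bump (hs ha) (hamin hb)
    obtain ⟨θ₁, hθ₁, hθf₁⟩ := exists_evenTest hf hc hs
    obtain ⟨θ₂, hθ₂, hθf₂⟩ := exists_evenTest hf₂ hc₂ hs₂
    obtain ⟨hi, h0⟩ := H.integral_evenTest_mul_defect hβ hsymm hF hV hθ₁ hθ₂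
    have hprod : ∀ ω, 0 < ω → θ₁ ω * θ₂ ω = f ω := fun ω hω => by
      rw [hθf₁, hθf₂, apply_neg_eq_zero hs hω, apply_neg_eq_zero hs₂ hω, add_zero, add_zero]
      by_cases hm : ω ∈ tsupport f
      · rw [h₂ ω ⟨hamin hm, hbmax hm⟩]
        simp
      · simp [image_eq_zero_of_notMem_tsupport hm]
    have hneg : ∫ ω in Set.Iic 0, θ₁ ω * θ₂ ω * densityDefect K β ν ω =
        ∫ ω in Set.Ioi 0, θ₁ ω * θ₂ ω * densityDefect K β ν (-ω) := by
      have := integral_comp_neg_Ioi 0 fun ω => θ₁ ω * θ₂ ω * densityDefect K β ν ω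
      rw [neg_zero] at this
      rw [← this]
      simp only [hθ₁.even, hθ₂.even]
    have hi' : Integrable fun ω => θ₁ ω * θ₂ ω * densityDefect K β ν (-ω) := by
      refine hi.comp_neg.congr (ae_of_all _ fun ω => ?_)
      simp only [hθ₁.even, hθ₂.even]
    have h1 : ∫ ω in Set.Ioi 0, f ω • (densityDefect K β ν ω + densityDefect K β ν (-ω)) = 0 := by
      rw [← h0, ← intervalIntegral.integral_Iic_add_Ioi (b := 0) hi.integrableOn hi.integrableOn,
        hneg, ← integral_add hi'.integrableOn hi.integrableOn]
      refine setIntegral_congr_fun measurableSet_Ioi fun ω hω => ?_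
      simp only [hprod ω hω, Complex.real_smul]
      ring
    rw [← h1]
    refine (setIntegral_eq_integral_of_forall_compl_eq_zero fun ω hω => ?_).symm
    rw [image_eq_zero_of_notMem_tsupport fun hm => hω (hs hm), zero_smul]

theorem DecayingKernel.density_bounds (H : DecayingKernel K g h) (hβ : 0 < β)
    (hsymm : ∀ t, K (-t) = K t) (hF : HasCovariance F K) (hV : IsWeakSolution 0 0 β K W F ξ)
    {A c M σ : ℝ} (hA : 0 < A) (hc : 0 < c) (hb : ∀ ω, A ≤ ω →
      c ≤ (halfTransform K ω).re / ‖halfTransform K ω‖ ^ 2 ∧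
      (halfTransform K ω).re / ‖halfTransform K ω‖ ^ 2 ≤ M * ω ^ σ) :
    ∀ᵐ ω, A < ω →
      2 / (Real.pi * β) * c ≤ (ν.rnDeriv volume ω).toReal + (ν.rnDeriv volume (-ω)).toReal ∧
      (ν.rnDeriv volume ω).toReal + (ν.rnDeriv volume (-ω)).toReal ≤
        2 / (Real.pi * β) * M * ω ^ σ := by
  filter_upwards [H.density_eq hβ hsymm hF hV] with ω hω hAω
  obtain ⟨h1, h2⟩ := hb ω hAω.le
  have hpi := Real.pi_pos
  -- Division by zero returns `0`, so the strictly positive lower bound on the quotient already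
  -- excludes `Z(ω) = 0`.
  have hne : ‖halfTransform K ω‖ ^ 2 ≠ 0 := fun h0 => by
    rw [h0, div_zero] at h1
    linarith
  have he : (ν.rnDeriv volume ω).toReal + (ν.rnDeriv volume (-ω)).toReal =
      2 / (Real.pi * β) * ((halfTransform K ω).re / ‖halfTransform K ω‖ ^ 2) := by
    have h3 := hω (hA.trans hAω)
    rw [← mul_div_assoc, eq_div_iff hne]
    have hπβ : Real.pi * β ≠ 0 := by positivity
    rw [div_mul_eq_mul_div, eq_div_iff hπβ]
    linear_combination h3
  rw [he]
  have hp : 0 ≤ 2 / (Real.pi * β) := by positivity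
  refine ⟨mul_le_mul_of_nonneg_left h1 hp, ?_⟩
  rw [mul_assoc]
  exact mul_le_mul_of_nonneg_left h2 hp

end Density

/-! ### Consequences for the total mass and the moments of `ν`. -/

section Weight

variable {ν : Measure ℝ}

theorem integrable_rnDeriv_add_neg [IsFiniteMeasure ν] :
    Integrable fun ω => (ν.rnDeriv volume ω).toReal + (ν.rnDeriv volume (-ω)).toReal :=
  Measure.integrable_toReal_rnDeriv.add Measure.integrable_toReal_rnDeriv.comp_neg

/-- For finite `ν` the symmetrised density would be integrable, yet it dominates a positive constant
on a half-line. -/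
theorem not_isFiniteMeasure_of_density {A c : ℝ} (hc : 0 < c)
    (hb : ∀ᵐ ω, A < ω → c ≤ (ν.rnDeriv volume ω).toReal + (ν.rnDeriv volume (-ω)).toReal) :
    ¬ IsFiniteMeasure ν := by
  intro hν
  have h1 : IntegrableOn (fun _ : ℝ => c) (Set.Ioi A) := by
    refine (integrable_rnDeriv_add_neg (ν := ν)).integrableOn.mono' aestronglyMeasurable_const
      ((ae_restrict_iff' measurableSet_Ioi).2 (hb.mono fun _ hω hA => ?_))
    rw [Real.norm_of_nonneg hc.le]
    exact hω hA
  rw [integrableOn_const_iff] at h1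
  simp [hc.ne'] at h1

/-- The weight `max(1,|ω|)^{-r}`. -/
noncomputable def weight (r : ℝ) (ω : ℝ) : ℝ := (max 1 |ω|) ^ (-r)

theorem continuous_weight (r : ℝ) : Continuous (weight r) :=
  (continuous_const.max continuous_abs).rpow_const fun _ =>
    Or.inl (ne_of_gt (lt_of_lt_of_le one_pos (le_max_left _ _)))

theorem weight_nonneg (r ω : ℝ) : 0 ≤ weight r ω :=
  Real.rpow_nonneg (zero_le_one.trans (le_max_left _ _)) _

theorem weight_neg (r ω : ℝ) : weight r (-ω) = weight r ω := by
  rw [weight, weight, abs_neg]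

/-- Only `p(ω) + p(-ω)` is controlled, but nonnegativity lets it dominate each term. Far out the
product is at most `M ω^{σ-r}` with `σ - r < -1`; the negative half follows by reflection and the
middle by local finiteness. -/
theorem integrable_weight_of_density [IsLocallyFiniteMeasure ν] (hν : ν ≪ volume)
    {A M σ r : ℝ} (hA : 0 < A) (hr : σ + 1 < r)
    (hb : ∀ᵐ ω, A < ω →
      (ν.rnDeriv volume ω).toReal + (ν.rnDeriv volume (-ω)).toReal ≤ M * ω ^ σ) :
    Integrable (weight r) ν := by
  have hA1 : 0 < max A 1 := hA.trans_le (le_max_left _ _)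
  -- Beyond `1` the weight is the pure power `ω^{-r}`.
  set B := max A 1
  have hp : IntegrableOn (fun ω : ℝ => M * ω ^ (σ - r)) (Set.Ioi B) :=
    (integrableOn_Ioi_rpow_of_lt (by linarith) hA1).const_mul M
  have hmeas : ∀ s : ℝ → ℝ, Measurable s →
      AEStronglyMeasurable (fun ω => (ν.rnDeriv volume (s ω)).toReal * weight r ω) volume :=
    fun s hs => (((Measure.measurable_rnDeriv ν volume).comp hs).ennreal_toReal.mul
      (continuous_weight r).measurable).aestronglyMeasurable
  have hbound : ∀ᵐ ω ∂(volume.restrict (Set.Ioi B)),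
      (ν.rnDeriv volume ω).toReal * weight r ω + (ν.rnDeriv volume (-ω)).toReal * weight r ω ≤
        M * ω ^ (σ - r) := by
    refine (ae_restrict_iff' measurableSet_Ioi).2 (hb.mono fun ω hω hB => ?_)
    have hω0 : 0 < ω := hA1.trans hB
    have hω1 : 1 < ω := (le_max_right _ _).trans_lt hB
    have hw : weight r ω = ω ^ (-r) := by
      rw [weight, abs_of_pos hω0, max_eq_right hω1.le]
    rw [← add_mul, sub_eq_add_neg, Real.rpow_add hω0, ← mul_assoc, hw]
    exact mul_le_mul_of_nonneg_right (hω ((le_max_left _ _).trans_lt hB))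
      (Real.rpow_nonneg hω0.le _)
  have j1 : IntegrableOn (fun ω => (ν.rnDeriv volume ω).toReal * weight r ω) (Set.Ioi B) := by
    refine hp.mono' (hmeas id measurable_id).restrict (hbound.mono fun ω hω => ?_)
    have h1 : 0 ≤ (ν.rnDeriv volume ω).toReal * weight r ω :=
      mul_nonneg ENNReal.toReal_nonneg (weight_nonneg r ω)
    have h2 : 0 ≤ (ν.rnDeriv volume (-ω)).toReal * weight r ω :=
      mul_nonneg ENNReal.toReal_nonneg (weight_nonneg r ω)
    rw [Real.norm_of_nonneg h1]
    linarith
  have j2 : IntegrableOn (fun ω => (ν.rnDeriv volume (-ω)).toReal * weight r ω) (Set.Ioi B) := by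
    refine hp.mono' (hmeas _ measurable_neg).restrict (hbound.mono fun ω hω => ?_)
    have h1 : 0 ≤ (ν.rnDeriv volume ω).toReal * weight r ω :=
      mul_nonneg ENNReal.toReal_nonneg (weight_nonneg r ω)
    have h2 : 0 ≤ (ν.rnDeriv volume (-ω)).toReal * weight r ω :=
      mul_nonneg ENNReal.toReal_nonneg (weight_nonneg r ω)
    rw [Real.norm_of_nonneg h2]
    linarith
  have j3 : IntegrableOn (fun ω => (ν.rnDeriv volume ω).toReal * weight r ω) (Set.Iio (-B)) := by
    have := (integrable_indicator_iff measurableSet_Ioi).2 j2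
    refine (integrable_indicator_iff measurableSet_Iio).1 (this.comp_neg.congr
      (ae_of_all _ fun ω => ?_))
    change (Set.Ioi B).indicator _ (-ω) = _
    by_cases hω : ω < -B
    · rw [Set.indicator_of_mem (show -ω ∈ Set.Ioi B by rw [Set.mem_Ioi]; linarith),
        Set.indicator_of_mem (show ω ∈ Set.Iio (-B) from hω), neg_neg, weight_neg]
    · rw [Set.indicator_of_notMem (show -ω ∉ Set.Ioi B by rw [Set.mem_Ioi]; linarith),
        Set.indicator_of_notMem (show ω ∉ Set.Iio (-B) from hω)]
  have transfer : ∀ s : Set ℝ, MeasurableSet s →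
      IntegrableOn (fun ω => (ν.rnDeriv volume ω).toReal * weight r ω) s →
      IntegrableOn (weight r) s ν := fun s hs hi => by
    rw [← integrable_indicator_iff hs, ← integrable_rnDeriv_smul_iff hν]
    refine ((integrable_indicator_iff hs).2 hi).congr (ae_of_all _ fun ω => ?_)
    by_cases hω : ω ∈ s <;> simp [hω]
  have hmid : IntegrableOn (weight r) (Set.Icc (-B) B) ν :=
    (continuous_weight r).continuousOn.integrableOn_compact isCompact_Icc
  rw [← integrableOn_univ]
  refine ((hmid.union (transfer _ measurableSet_Ioi j1)).union
    (transfer _ measurableSet_Iio j3)).mono_set fun ω _ => ?_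
  simp only [Set.mem_union, Set.mem_Icc, Set.mem_Ioi, Set.mem_Iio]
  rcases lt_or_ge ω (-B) with h1 | h1
  · exact Or.inr h1
  · rcases lt_or_ge B ω with h2 | h2
    · exact Or.inl (Or.inr h2)
    · exact Or.inl (Or.inl ⟨h1, h2⟩)

end Weight

/-! ### The Fourier transform of indicators of intervals -/

/-- The Fourier transform of the indicator of `[s,t]`. -/
noncomputable def intervalFourier (s t ω : ℝ) : ℂ :=
  ∫ x in s..t, Complex.exp (-(Complex.I * x * ω))

theorem continuous_intervalFourier (s t : ℝ) : Continuous (intervalFourier s t) := by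
  unfold intervalFourier
  fun_prop

theorem intervalFourier_sub (s t ω : ℝ) :
    intervalFourier 0 t ω - intervalFourier 0 s ω = intervalFourier s t ω :=
  intervalIntegral.integral_interval_sub_left (Continuous.intervalIntegrable (by fun_prop) _ _)
    (Continuous.intervalIntegrable (by fun_prop) _ _)

theorem norm_intervalFourier_le (s t ω : ℝ) : ‖intervalFourier s t ω‖ ≤ |t - s| := by
  refine (intervalIntegral.norm_integral_le_of_norm_le_const (C := 1) fun x _ => ?_).trans
    (one_mul _).le
  rw [Complex.norm_exp]
  simp

theorem norm_intervalFourier_le' (s t : ℝ) {ω : ℝ} (hω : ω ≠ 0) :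
    ‖intervalFourier s t ω‖ ≤ 2 / |ω| := by
  have hc : -(Complex.I * (ω : ℂ)) ≠ 0 :=
    neg_ne_zero.2 (mul_ne_zero Complex.I_ne_zero (by exact_mod_cast hω))
  have h1 : intervalFourier s t ω = (Complex.exp (-(Complex.I * ω) * t) -
      Complex.exp (-(Complex.I * ω) * s)) / (-(Complex.I * ω)) := by
    rw [← integral_exp_mul_complex hc, intervalFourier]
    refine intervalIntegral.integral_congr fun x _ => ?_
    congr 1
    ring
  have hn : ∀ x : ℝ, ‖Complex.exp (-(Complex.I * ω) * x)‖ = 1 := fun x => by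
    rw [Complex.norm_exp]
    simp
  rw [h1, norm_div]
  have h2 : ‖-(Complex.I * (ω : ℂ))‖ = |ω| := by simp
  rw [h2]
  refine div_le_div_of_nonneg_right ((norm_sub_le _ _).trans ?_) (abs_nonneg _)
  rw [hn, hn]
  norm_num

/-- Interpolation: of the modulus squared, the power `ρ` is bounded by `|t-s|^ρ`. The power `2 - ρ`
supplies the decay `(2/|ω|)^{2-ρ}` for `|ω| ≥ 1` and is bounded by `T^{2-ρ}` below; `4` dominates
`2^{2-ρ}`. -/
theorem sq_norm_intervalFourier_le {T ρ : ℝ} (hρ : 0 ≤ ρ) (hρ2 : ρ ≤ 2) {s t : ℝ}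
    (hst : |t - s| ≤ T) (ω : ℝ) :
    ‖intervalFourier s t ω‖ ^ 2 ≤ max 4 (T ^ (2 - ρ)) * |t - s| ^ ρ * weight (2 - ρ) ω := by
  set d := |t - s|
  have hd : 0 ≤ d := abs_nonneg _
  set n := ‖intervalFourier s t ω‖
  have hn : 0 ≤ n := norm_nonneg _
  have hnd : n ≤ d := norm_intervalFourier_le s t ω
  have hsplit : n ^ 2 = n ^ ρ * n ^ (2 - ρ) := by
    rw [← Real.rpow_add_of_nonneg hn hρ (by linarith), add_sub_cancel]
    norm_num
  have h1 : n ^ ρ ≤ d ^ ρ := Real.rpow_le_rpow hn hnd hρ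
  rw [hsplit, mul_comm (max _ _), mul_assoc]
  refine mul_le_mul h1 ?_ (Real.rpow_nonneg hn _) (Real.rpow_nonneg hd _)
  rcases le_total |ω| 1 with hω | hω
  · rw [weight, max_eq_left hω, Real.one_rpow, mul_one]
    exact (Real.rpow_le_rpow hn (hnd.trans hst) (by linarith)).trans (le_max_right _ _)
  · have hω0 : 0 < |ω| := one_pos.trans_le hω
    rw [weight, max_eq_right hω, Real.rpow_neg hω0.le]
    have h2 : n ≤ 2 / |ω| := norm_intervalFourier_le' s t (abs_pos.1 hω0)
    have h3 : n ^ (2 - ρ) ≤ (2 / |ω|) ^ (2 - ρ) := Real.rpow_le_rpow hn h2 (by linarith)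
    rw [Real.div_rpow two_pos.le hω0.le, div_eq_mul_inv] at h3
    refine h3.trans (mul_le_mul_of_nonneg_right (le_trans ?_ (le_max_left _ _)) (by positivity))
    have : (2 : ℝ) ^ (2 - ρ) ≤ 2 ^ (2 : ℝ) := Real.rpow_le_rpow_of_exponent_le one_le_two
      (by linarith)
    norm_num at this
    exact this

theorem memLp_intervalFourier {ν : Measure ℝ} {ρ : ℝ} (hρ : 0 ≤ ρ) (hρ2 : ρ ≤ 2)
    (hw : Integrable (weight (2 - ρ)) ν) (s t : ℝ) : MemLp (intervalFourier s t) 2 ν := by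
  rw [memLp_two_iff_integrable_sq_norm (continuous_intervalFourier s t).aestronglyMeasurable]
  refine (hw.const_mul (max 4 (|t - s| ^ (2 - ρ)) * |t - s| ^ ρ)).mono'
    (by have := continuous_intervalFourier s t; fun_prop) (ae_of_all _ fun ω => ?_)
  rw [Real.norm_of_nonneg (sq_nonneg _)]
  exact sq_norm_intervalFourier_le hρ hρ2 le_rfl ω

theorem isTempered_indicator (t : ℝ) :
    IsTempered ((Set.Icc 0 t).indicator fun _ => (1 : ℂ)) := by
  refine isTempered_of_bounded (C := 1)
    (aestronglyMeasurable_const.indicator measurableSet_Icc) fun x => ?_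
  by_cases hx : x ∈ Set.Icc 0 t <;> simp [hx]

theorem isFourierFunction_indicator {t : ℝ} (ht : 0 ≤ t) :
    IsFourierFunction (ofFun ((Set.Icc 0 t).indicator fun _ => 1)) (intervalFourier 0 t) := by
  refine ⟨(continuous_intervalFourier 0 t).locallyIntegrable, fun χ _ => ?_⟩
  rw [ofFun_apply (isTempered_indicator t)]
  have hint : Integrable (Function.uncurry fun (x ω : ℝ) =>
      χ ω * Complex.exp (-(Complex.I * x * ω))) ((volume.restrict (Set.Ioc 0 t)).prod volume) := by
    have h1 : Integrable (fun p : ℝ × ℝ => (1 : ℂ) * χ p.2)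
        ((volume.restrict (Set.Ioc 0 t)).prod volume) :=
      Integrable.mul_prod (integrable_const 1) χ.integrable
    refine (h1.mul_bdd (c := 1) (g := fun p : ℝ × ℝ => Complex.exp (-(Complex.I * p.1 * p.2)))
      (Continuous.aestronglyMeasurable (by fun_prop)) (ae_of_all _ fun p => ?_)).congr
      (ae_of_all _ fun p => ?_)
    · rw [Complex.norm_exp]
      simp
    · simp [Function.uncurry]
  calc ∫ x, (Set.Icc 0 t).indicator (fun _ => 1) x * schwartzFourier χ x
      = ∫ x in Set.Ioc 0 t, schwartzFourier χ x := by
        rw [← integral_Icc_eq_integral_Ioc, ← integral_indicator measurableSet_Icc]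
        refine integral_congr_ae (ae_of_all _ fun x => ?_)
        by_cases hx : x ∈ Set.Icc 0 t <;> simp [hx]
    _ = ∫ x in Set.Ioc 0 t, ∫ ω, χ ω * Complex.exp (-(Complex.I * x * ω)) := by
        simp_rw [schwartzFourier_apply]
        refine integral_congr_ae (ae_of_all _ fun x => ?_)
        refine integral_congr_ae (ae_of_all _ fun ω => ?_)
        simp only
        rw [mul_right_comm Complex.I (ω : ℂ)]
    _ = ∫ ω, ∫ x in Set.Ioc 0 t, χ ω * Complex.exp (-(Complex.I * x * ω)) :=
        integral_integral_swap hint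
    _ = ∫ ω, intervalFourier 0 t ω * χ ω := by
        refine integral_congr_ae (ae_of_all _ fun ω => ?_)
        simp only [intervalFourier]
        rw [intervalIntegral.integral_of_le ht, integral_const_mul, mul_comm]

theorem isFourierFunction_delta (t : ℝ) :
    IsFourierFunction (TemperedDistribution.delta t)
      fun ω => Complex.exp (-(Complex.I * ω * t)) := by
  refine ⟨Continuous.locallyIntegrable (by fun_prop), fun χ _ => ?_⟩
  rw [TemperedDistribution.delta_apply, schwartzFourier_apply]
  refine integral_congr_ae (ae_of_all _ fun ω => ?_)
  simp [mul_comm]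

/-- The Fourier function of `δ_t` is unique up to Lebesgue null sets, hence `ν`-null sets, and has
modulus one. Its square integrability would mean that `ν` is finite. -/
theorem delta_notMem_dom {ν : Measure ℝ} (hν : ν ≪ volume) (hinf : ¬ IsFiniteMeasure ν) (t : ℝ) :
    TemperedDistribution.delta t ∉ Dom ν := by
  rintro ⟨k, hk, hkm⟩
  refine hinf ?_
  have h1 : ∀ᵐ ω ∂ν, ‖k ω‖ = 1 := by
    filter_upwards [hν.ae_le (hk.ae_eq (isFourierFunction_delta t))] with ω hω
    rw [hω, Complex.norm_exp]
    simp
  have h2 := (memLp_two_iff_integrable_sq_norm hkm.1).1 hkm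
  have h3 : Integrable (fun _ : ℝ => (1 : ℝ)) ν := h2.congr (h1.mono fun ω hω => by simp [hω])
  rw [integrable_const_iff] at h3
  simpa using h3

/-! ### Second moments of the increments of the position -/

section Position

variable {Ω : Type*} [MeasurableSpace Ω] {P : Measure Ω} {ν : Measure ℝ} (ξ : RandomMeasure ν P)

theorem RandomMeasure.position_sub (hν : ν ≪ volume)
    (hm : ∀ s t, MemLp (intervalFourier s t) 2 ν) {s t : ℝ} (hs : 0 ≤ s) (ht : 0 ≤ t) :
    ξ.position t - ξ.position s = ξ.stochInt (hm s t).star.toLp := by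
  rw [position, position, ξ.op_eq hν (isFourierFunction_indicator ht) (hm 0 t),
    ξ.op_eq hν (isFourierFunction_indicator hs) (hm 0 s), ← map_sub, ← MemLp.toLp_sub]
  congr 1
  rw [MemLp.toLp_eq_toLp_iff]
  refine ae_of_all _ fun ω => ?_
  rw [Pi.sub_apply, Pi.star_apply, Pi.star_apply, Pi.star_apply, ← star_sub, intervalFourier_sub]

theorem integral_norm_sub_sq_eq (X Y : Lp ℂ 2 P) :
    ∫ x, ‖X x - Y x‖ ^ 2 ∂P = ‖X - Y‖ ^ 2 := by
  have h1 : ((‖X - Y‖ ^ 2 : ℝ) : ℂ) = inner ℂ (X - Y) (X - Y) := by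
    rw [inner_self_eq_norm_sq_to_K]
    push_cast
    rfl
  rw [L2.inner_def] at h1
  have h2 : ∫ x, inner ℂ ((X - Y : Lp ℂ 2 P) x) ((X - Y : Lp ℂ 2 P) x) ∂P =
      ((∫ x, ‖X x - Y x‖ ^ 2 ∂P : ℝ) : ℂ) := by
    rw [← integral_complex_ofReal]
    refine integral_congr_ae ?_
    filter_upwards [Lp.coeFn_sub X Y] with x hx
    rw [hx, inner_self_eq_norm_sq_to_K, Pi.sub_apply]
    push_cast
    rfl
  rw [h2] at h1
  exact_mod_cast h1.symm

theorem sq_norm_toLp_intervalFourier_le {ρ : ℝ} (hρ : 0 ≤ ρ) (hρ2 : ρ ≤ 2)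
    (hw : Integrable (weight (2 - ρ)) ν) (hm : ∀ s t, MemLp (intervalFourier s t) 2 ν)
    {T s t : ℝ} (hst : |t - s| ≤ T) :
    ‖((hm s t).star.toLp : Lp ℂ 2 ν)‖ ^ 2 ≤
      (max 4 (T ^ (2 - ρ)) * ∫ ω, weight (2 - ρ) ω ∂ν) * |t - s| ^ ρ := by
  have h1 := integral_norm_sub_sq_eq ((hm s t).star.toLp : Lp ℂ 2 ν) 0
  rw [sub_zero] at h1
  rw [← h1]
  have h2 : ∫ ω, ‖((hm s t).star.toLp : Lp ℂ 2 ν) ω - (0 : Lp ℂ 2 ν) ω‖ ^ 2 ∂ν =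
      ∫ ω, ‖intervalFourier s t ω‖ ^ 2 ∂ν := by
    refine integral_congr_ae ?_
    filter_upwards [(hm s t).star.coeFn_toLp, Lp.coeFn_zero ℂ 2 ν] with ω h3 h4
    rw [h3, h4]
    simp
  rw [h2]
  calc ∫ ω, ‖intervalFourier s t ω‖ ^ 2 ∂ν
      ≤ ∫ ω, max 4 (T ^ (2 - ρ)) * |t - s| ^ ρ * weight (2 - ρ) ω ∂ν :=
        integral_mono ((memLp_two_iff_integrable_sq_norm (hm s t).1).1 (hm s t))
          (hw.const_mul _) fun ω => sq_norm_intervalFourier_le hρ hρ2 hst ω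
    _ = _ := by
        rw [integral_const_mul]
        ring

end Position

/-! ### Moments of Gaussian stochastic integrals -/

section Moments

variable {Ω : Type*} [MeasurableSpace Ω] {P : Measure Ω}

/-- A centred Gaussian has the law of its standard deviation times a standard normal, the degenerate
case included; norms scale accordingly. -/
theorem eLpNorm_of_hasGaussianLaw {X : Ω → ℝ} (hX : HasGaussianLaw X P) (h0 : ∫ x, X x ∂P = 0)
    (p : ℝ≥0∞) :
    eLpNorm X p P = ‖√(Var[X; P])‖ₑ * eLpNorm id p (gaussianReal 0 1) := by
  have h1 := hX.map_eq_gaussianReal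
  rw [h0] at h1
  have h2 : gaussianReal 0 (Var[X; P]).toNNReal
      = (gaussianReal 0 1).map (√(Var[X; P]) * ·) := by
    rw [gaussianReal_map_const_mul, mul_zero, mul_one]
    congr 1
    ext
    simp [Real.sq_sqrt (variance_nonneg X P)]
  have h3 : eLpNorm X p P = eLpNorm id p (P.map X) := by
    rw [eLpNorm_map_measure (by fun_prop) hX.aemeasurable]
    rfl
  rw [h3, h1, h2, eLpNorm_map_measure (by fun_prop) (by fun_prop)]
  exact eLpNorm_const_smul (√(Var[X; P])) (id : ℝ → ℝ) p (gaussianReal 0 1)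

theorem eLpNorm_id_gaussianReal_ne_zero : eLpNorm id 2 (gaussianReal 0 1) ≠ 0 := by
  intro h
  rw [eLpNorm_eq_zero_iff (by fun_prop) two_ne_zero] at h
  have h1 := variance_congr h
  rw [variance_id_gaussianReal] at h1
  simp [variance_zero] at h1

/-- Equivalence of moments for centred complex Gaussian variables. -/
theorem exists_eLpNorm_le_of_hasGaussianLaw {p : ℝ≥0∞} (hp1 : 1 ≤ p) (hp : p ≠ ∞) :
    ∃ C : ℝ≥0∞, C ≠ ∞ ∧ ∀ Y : Ω → ℂ, HasGaussianLaw Y P → ∫ x, Y x ∂P = 0 →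
      eLpNorm Y p P ≤ C * eLpNorm Y 2 P := by
  set a := eLpNorm id p (gaussianReal 0 1)
  set b := eLpNorm id 2 (gaussianReal 0 1)
  have ha : a ≠ ∞ := (memLp_id_gaussianReal' p hp).2.ne
  have hb0 : b ≠ 0 := eLpNorm_id_gaussianReal_ne_zero
  have hb : b ≠ ∞ := (memLp_id_gaussianReal' 2 (by simp)).2.ne
  have real : ∀ X : Ω → ℝ, HasGaussianLaw X P → ∫ x, X x ∂P = 0 →
      eLpNorm X p P = a / b * eLpNorm X 2 P := by
    intro X hX h0
    rw [eLpNorm_of_hasGaussianLaw hX h0 p, eLpNorm_of_hasGaussianLaw hX h0 2, mul_comm _ a,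
      mul_comm _ b, ← mul_assoc, ENNReal.div_mul_cancel hb0 hb]
  -- One `a / b` for the real part and one for the imaginary part; neither depends on `Y`.
  refine ⟨a / b + a / b, by finiteness, fun Y hY h0 => ?_⟩
  have part : ∀ L : ℂ →L[ℝ] ℝ, (∀ z, ‖L z‖ ≤ ‖z‖) →
      eLpNorm (fun x => L (Y x)) p P ≤ a / b * eLpNorm Y 2 P := by
    intro L hL
    rw [real _ (hY.map_fun L) (by rw [L.integral_comp_comm hY.integrable, h0, map_zero])]
    gcongr
    exact eLpNorm_mono fun x => hL _
  have hre := part Complex.reCLM fun z => Complex.abs_re_le_norm z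
  have him := part Complex.imCLM fun z => Complex.abs_im_le_norm z
  have hme := (hY.map_fun Complex.reCLM).aemeasurable.aestronglyMeasurable
  have hmi := (hY.map_fun Complex.imCLM).aemeasurable.aestronglyMeasurable
  calc eLpNorm Y p P
      ≤ eLpNorm ((fun x => ‖Complex.reCLM (Y x)‖) + fun x => ‖Complex.imCLM (Y x)‖) p P := by
        refine eLpNorm_mono_real fun x => ?_
        exact Complex.norm_le_abs_re_add_abs_im _
    _ ≤ eLpNorm (fun x => ‖Complex.reCLM (Y x)‖) p P
          + eLpNorm (fun x => ‖Complex.imCLM (Y x)‖) p P := eLpNorm_add_le hme.norm hmi.norm hp1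
    _ = eLpNorm (fun x => Complex.reCLM (Y x)) p P
          + eLpNorm (fun x => Complex.imCLM (Y x)) p P := by rw [eLpNorm_norm, eLpNorm_norm]
    _ ≤ _ := by
        rw [add_mul]
        exact add_le_add hre him

variable {ν : Measure ℝ} {ξ : RandomMeasure ν P}

theorem RandomMeasure.simpleInt_ae_eq (ξ : RandomMeasure ν P) (c : FiniteSet ν →₀ ℂ) :
    ξ.simpleInt c =ᵐ[P] fun x => ∑ E ∈ c.support, c E * ξ.toFun E x := by
  rw [simpleInt, Finsupp.linearCombination_apply, Finsupp.sum]
  filter_upwards [Lp.coeFn_finsetSum c.support fun E => c E • ξ.toFun E,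
    (c.support.eventually_all (p := fun E x => (c E • ξ.toFun E : Lp ℂ 2 P) x
      = c E * ξ.toFun E x)).2 fun E _ => Lp.coeFn_smul (c E) (ξ.toFun E)] with x h1 h2
  rw [h1, Finset.sum_apply]
  exact Finset.sum_congr rfl h2

/-- Finite sums are Gaussian, so the moment inequality holds for them. It passes to `L²` limits
through convergence in measure and lower semicontinuity of the `p`-norm, so the law of the limit
need not be identified. -/
theorem RandomMeasure.IsGaussian.eLpNorm_stochInt_le (hξ : ξ.IsGaussian) {p : ℝ≥0∞} {C : ℝ≥0∞}
    (hC : ∀ Y : Ω → ℂ, HasGaussianLaw Y P → ∫ x, Y x ∂P = 0 →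
      eLpNorm Y p P ≤ C * eLpNorm Y 2 P) (hC' : C ≠ ∞) (g : Lp ℂ 2 ν) :
    eLpNorm (ξ.stochInt g) p P ≤ C * ‖g‖ₑ := by
  have simple : ∀ c, eLpNorm (ξ.simpleInt c) p P ≤ C * ‖simpleFun ν c‖ₑ := by
    intro c
    have hG : HasGaussianLaw (fun x => ∑ E ∈ c.support, c E * ξ.toFun E x) P :=
      (hξ.gaussian.comp_left fun E => ContinuousLinearMap.mul ℝ ℂ (c E)).hasGaussianLaw_fun_sum
    have h0 : ∫ x, ∑ E ∈ c.support, c E * ξ.toFun E x ∂P = 0 := by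
      rw [integral_finsetSum _ fun E _ =>
        (hξ.gaussian.hasGaussianLaw_eval E).integrable.const_mul _]
      simp [integral_const_mul, hξ.mean]
    have h := hC _ hG h0
    rw [← eLpNorm_congr_ae (ξ.simpleInt_ae_eq c), ← eLpNorm_congr_ae (ξ.simpleInt_ae_eq c)] at h
    refine h.trans_eq ?_
    rw [← Lp.enorm_def, ← ofReal_norm, ← ofReal_norm, ξ.norm_simpleInt]
  obtain ⟨u, hu, hug⟩ := mem_closure_iff_seq_limit.1 (denseRange_simpleFun ν g)
  choose c hc using hu
  have hint : ∀ n, ξ.stochInt (u n) = ξ.simpleInt (c n) := by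
    intro n
    rw [← hc n]
    exact LinearMap.extendOfNorm_eq (f := ξ.simpleInt) (e := simpleFun ν)
      (denseRange_simpleFun ν) ⟨1, fun c => by rw [one_mul, ξ.norm_simpleInt]⟩ (c n)
  refine ENNReal.le_of_forall_pos_le_add fun ε hε _ => ?_
  have hlim : Tendsto (fun n => C * ‖u n‖ₑ) atTop (𝓝 (C * ‖g‖ₑ)) :=
    ENNReal.Tendsto.const_mul hug.enorm (Or.inr hC')
  have hlt : C * ‖g‖ₑ < C * ‖g‖ₑ + ε :=
    ENNReal.lt_add_right (ENNReal.mul_ne_top hC' enorm_ne_top) (by simpa using hε.ne')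
  refine eLpNorm_le_of_tendstoInMeasure (u := atTop) (f := fun n => ⇑(ξ.stochInt (u n))) ?_
    (tendstoInMeasure_of_tendsto_Lp ((ξ.stochInt.continuous.tendsto g).comp hug))
    fun n => (Lp.aestronglyMeasurable _)
  filter_upwards [hlim.eventually_lt_const hlt] with n hn
  rw [hint]
  refine (simple (c n)).trans ?_
  rw [hc]
  exact hn.le

end Moments

/-! ### Continuous modifications -/

section Continuity

/-- The approximation of `f` by its values on the dyadic grid of mesh `2⁻ⁿ`. -/
noncomputable def dyadicApprox {E : Type*} (f : ℝ → E) (n : ℕ) (t : ℝ) : E := f (⌊2 ^ n * t⌋₊ / 2 ^ n)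

/-- The increments of `f` over adjacent dyadic points decay geometrically, locally uniformly. -/
def DyadicDecay {E : Type*} [NormedAddCommGroup E] (f : ℝ → E) : Prop :=
  ∀ N : ℕ, ∃ S r : ℝ, 0 ≤ S ∧ 0 ≤ r ∧ r < 1 ∧ ∀ n k : ℕ, k < N * 2 ^ n →
    ‖f ((k + 1 : ℕ) / 2 ^ n) - f (k / 2 ^ n)‖ ≤ S * r ^ n

variable {E : Type*} [NormedAddCommGroup E] {f : ℝ → E}

theorem floor_lt_mul_two_pow {N n : ℕ} {t : ℝ} (ht : 0 ≤ t) (htN : t < N) :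
    ⌊2 ^ n * t⌋₊ < N * 2 ^ n := by
  rw [Nat.floor_lt (by positivity)]
  push_cast
  rw [mul_comm]
  gcongr

/-- When the mesh is halved, the grid point below `t` either stays or moves one step to the right:
the new index is `2k` or `2k + 1`. -/
theorem dist_dyadicApprox_succ_le {N : ℕ} {S r : ℝ} (hS : 0 ≤ S) (hr : 0 ≤ r)
    (h : ∀ n k : ℕ, k < N * 2 ^ n → ‖f ((k + 1 : ℕ) / 2 ^ n) - f (k / 2 ^ n)‖ ≤ S * r ^ n)
    {t : ℝ} (ht : 0 ≤ t) (htN : t < N) (n : ℕ) :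
    dist (dyadicApprox f n t) (dyadicApprox f (n + 1) t) ≤ S * r * r ^ n := by
  set k := ⌊2 ^ n * t⌋₊ with hk
  have h0 : 0 ≤ 2 ^ n * t := by positivity
  have h1 : (k : ℝ) ≤ 2 ^ n * t := Nat.floor_le h0
  have h2 : 2 ^ n * t < k + 1 := Nat.lt_floor_add_one _
  have h3 : 2 * k ≤ ⌊2 ^ (n + 1) * t⌋₊ := by
    refine Nat.le_floor ?_
    push_cast
    rw [pow_succ]
    linarith
  have h4 : ⌊2 ^ (n + 1) * t⌋₊ < 2 * k + 2 := by
    rw [Nat.floor_lt (by positivity)]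
    push_cast
    rw [pow_succ]
    linarith
  have h5 : ((2 * k : ℕ) : ℝ) / 2 ^ (n + 1) = k / 2 ^ n := by
    push_cast
    rw [pow_succ]
    field_simp
  rw [dyadicApprox, dyadicApprox, ← hk, ← h5]
  rcases Nat.lt_or_ge (2 * k) ⌊2 ^ (n + 1) * t⌋₊ with h6 | h6
  · have h7 : ⌊2 ^ (n + 1) * t⌋₊ = 2 * k + 1 := by omega
    rw [h7, dist_comm, dist_eq_norm]
    refine (h (n + 1) (2 * k) ?_).trans_eq (by ring)
    have h8 := floor_lt_mul_two_pow (n := n) ht htN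
    rw [← hk] at h8
    rw [pow_succ]
    linarith
  · have h7 : ⌊2 ^ (n + 1) * t⌋₊ = 2 * k := by omega
    rw [h7, dist_self]
    positivity

/-- Points closer than the mesh lie in the same cell or in adjacent cells. -/
theorem dist_dyadicApprox_le {N : ℕ} {S r : ℝ} (hS : 0 ≤ S) (hr : 0 ≤ r)
    (h : ∀ n k : ℕ, k < N * 2 ^ n → ‖f ((k + 1 : ℕ) / 2 ^ n) - f (k / 2 ^ n)‖ ≤ S * r ^ n)
    {s t : ℝ} (hs : 0 ≤ s) (hst : s ≤ t) (htN : t < N) {n : ℕ} (hd : 2 ^ n * (t - s) < 1) :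
    dist (dyadicApprox f n t) (dyadicApprox f n s) ≤ S * r ^ n := by
  set k := ⌊2 ^ n * s⌋₊ with hk
  have h2 : 2 ^ n * s < k + 1 := Nat.lt_floor_add_one _
  have h3 : k ≤ ⌊2 ^ n * t⌋₊ := by
    rw [hk]
    gcongr
  have h4 : ⌊2 ^ n * t⌋₊ < k + 2 := by
    have ht : 0 ≤ t := hs.trans hst
    rw [Nat.floor_lt (by positivity)]
    push_cast
    linarith
  rw [dyadicApprox, dyadicApprox, ← hk]
  rcases Nat.lt_or_ge k ⌊2 ^ n * t⌋₊ with h6 | h6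
  · have h7 : ⌊2 ^ n * t⌋₊ = k + 1 := by omega
    rw [h7, dist_eq_norm]
    exact h n k (floor_lt_mul_two_pow hs (hst.trans_lt htN))
  · have h7 : ⌊2 ^ n * t⌋₊ = k := by omega
    rw [h7, dist_self]
    positivity

theorem DyadicDecay.exists_tendsto [CompleteSpace E] (hf : DyadicDecay f) {t : ℝ} (ht : 0 ≤ t) :
    ∃ l, Tendsto (fun n => dyadicApprox f n t) atTop (𝓝 l) := by
  obtain ⟨N, hN⟩ := exists_nat_gt t
  obtain ⟨S, r, hS, hr, hr1, h⟩ := hf N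
  exact cauchySeq_tendsto_of_complete
    (cauchySeq_of_le_geometric r (S * r) hr1 (dist_dyadicApprox_succ_le hS hr h ht hN))

/-- The approximations converge geometrically and uniformly on `[0,N)`, so comparing `g` with level
`n` at two points within `2⁻ⁿ` bounds its oscillation by a multiple of `rⁿ`. -/
theorem DyadicDecay.continuousOn (hf : DyadicDecay f) {g : ℝ → E}
    (hg : ∀ t, 0 ≤ t → Tendsto (fun n => dyadicApprox f n t) atTop (𝓝 (g t))) :
    ContinuousOn g (Set.Ici 0) := by
  intro t₀ ht₀
  -- The extra `1` keeps all points within `2⁻ⁿ ≤ 1` of `t₀` below `N`.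
  obtain ⟨N, hN⟩ := exists_nat_gt (t₀ + 1)
  obtain ⟨S, r, hS, hr, hr1, h⟩ := hf N
  have approx : ∀ t : ℝ, 0 ≤ t → t < N → ∀ n,
      dist (dyadicApprox f n t) (g t) ≤ S * r * r ^ n / (1 - r) := fun t ht htN =>
    dist_le_of_le_geometric_of_tendsto r (S * r) hr1 (dist_dyadicApprox_succ_le hS hr h ht htN)
      (hg t ht)
  have key : ∀ (n : ℕ) (s t : ℝ), 0 ≤ s → s ≤ t → t < N → 2 ^ n * (t - s) < 1 →
      dist (g t) (g s) ≤ (2 * (S * r / (1 - r)) + S) * r ^ n := by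
    intro n s t hs hst htN hd
    have h1 := approx t (hs.trans hst) htN n
    have h2 := approx s hs (hst.trans_lt htN) n
    have h3 := dist_dyadicApprox_le hS hr h hs hst htN hd
    have h4 := dist_triangle4 (g t) (dyadicApprox f n t) (dyadicApprox f n s) (g s)
    rw [dist_comm (g t) (dyadicApprox f n t)] at h4
    have h5 : (2 * (S * r / (1 - r)) + S) * r ^ n
        = S * r * r ^ n / (1 - r) + S * r ^ n + S * r * r ^ n / (1 - r) := by ring
    linarith
  rw [ContinuousWithinAt, Metric.tendsto_nhds]
  intro ε hε
  have hlim : Tendsto (fun n : ℕ => (2 * (S * r / (1 - r)) + S) * r ^ n) atTop (𝓝 0) := by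
    simpa using (tendsto_pow_atTop_nhds_zero_of_lt_one hr hr1).const_mul
      (2 * (S * r / (1 - r)) + S)
  obtain ⟨n, hn⟩ := (hlim.eventually_lt_const hε).exists
  have hball : ∀ᶠ t in 𝓝[Set.Ici 0] t₀, dist t t₀ < (2 ^ n)⁻¹ :=
    mem_nhdsWithin_of_mem_nhds (Metric.ball_mem_nhds _ (by positivity))
  filter_upwards [hball, self_mem_nhdsWithin] with t ht ht0
  have hn1 : ((2 : ℝ) ^ n)⁻¹ ≤ 1 := inv_le_one_of_one_le₀ (one_le_pow₀ one_le_two)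
  have hpos : (0 : ℝ) < 2 ^ n := by positivity
  have hone : (2 : ℝ) ^ n * (2 ^ n)⁻¹ = 1 := mul_inv_cancel₀ hpos.ne'
  rw [Real.dist_eq, abs_lt] at ht
  refine lt_of_le_of_lt ?_ hn
  rcases le_total t t₀ with hle | hle
  · rw [dist_comm]
    exact key n t t₀ ht0 hle (by linarith) (by nlinarith)
  · exact key n t₀ t ht₀ hle (by linarith) (by nlinarith)

end Continuity

/-! ### Kolmogorov's continuity criterion. -/

section Modification

variable {Ω : Type*} [MeasurableSpace Ω] {P : Measure Ω} {E : Type*} [NormedAddCommGroup E]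

theorem tendsto_floor_two_pow_div {t : ℝ} (ht : 0 ≤ t) :
    Tendsto (fun n : ℕ => (⌊2 ^ n * t⌋₊ / 2 ^ n : ℝ)) atTop (𝓝 t) := by
  have h := (tendsto_nat_floor_mul_div_atTop ht).comp
    (tendsto_pow_atTop_atTop_of_one_lt (one_lt_two : (1 : ℝ) < 2))
  refine h.congr fun n => ?_
  simp only [Function.comp_apply, mul_comm]

theorem floor_two_pow_div_le {t : ℝ} (ht : 0 ≤ t) (n : ℕ) :
    (⌊2 ^ n * t⌋₊ / 2 ^ n : ℝ) ≤ t := by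
  rw [div_le_iff₀ (by positivity), mul_comm t]
  exact Nat.floor_le (by positivity)

/-- The moment bound in the Kolmogorov continuity criterion. -/
def KolmogorovBound (X : ℝ → Ω → E) (p : ℝ) (P : Measure Ω) : Prop :=
  ∀ N : ℕ, ∃ C : ℝ≥0∞, C ≠ ∞ ∧ ∀ s ∈ Set.Icc (0 : ℝ) N, ∀ t ∈ Set.Icc (0 : ℝ) N,
    ∫⁻ x, ‖X t x - X s x‖ₑ ^ p ∂P ≤ C * ENNReal.ofReal ((t - s) ^ 2)

/-- Level `n` has `N 2ⁿ` increments, each with `p`-th moment at most `C 4⁻ⁿ`. Their sum has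
expectation of order `2⁻ⁿ`, which leaves room for the weight `(3/2)ⁿ`: the total is a geometric
series of ratio `3/4`. -/
theorem ae_tsum_increments_ne_top {X : ℝ → Ω → E} {p : ℝ}
    (hX : ∀ t, AEStronglyMeasurable (X t) P) (hb : KolmogorovBound X p P) (N : ℕ) :
    ∀ᵐ x ∂P, ∑' n : ℕ, ∑ k ∈ Finset.range (N * 2 ^ n), (3 / 2 : ℝ≥0∞) ^ n *
      ‖X ((k + 1 : ℕ) / 2 ^ n) x - X (k / 2 ^ n) x‖ₑ ^ p ≠ ∞ := by
  obtain ⟨C, hC, h⟩ := hb N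
  have hm : ∀ n k : ℕ, AEMeasurable (fun x => (3 / 2 : ℝ≥0∞) ^ n *
      ‖X ((k + 1 : ℕ) / 2 ^ n) x - X (k / 2 ^ n) x‖ₑ ^ p) P := fun n k =>
    (((hX _).sub (hX _)).enorm.pow_const p).const_mul _
  have hfin : ∫⁻ x, ∑' n : ℕ, ∑ k ∈ Finset.range (N * 2 ^ n), (3 / 2 : ℝ≥0∞) ^ n *
      ‖X ((k + 1 : ℕ) / 2 ^ n) x - X (k / 2 ^ n) x‖ₑ ^ p ∂P ≠ ∞ := by
    rw [lintegral_tsum fun n => Finset.aemeasurable_fun_sum _ fun k _ => hm n k]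
    have hle : ∀ n : ℕ, ∫⁻ x, ∑ k ∈ Finset.range (N * 2 ^ n), (3 / 2 : ℝ≥0∞) ^ n *
        ‖X ((k + 1 : ℕ) / 2 ^ n) x - X (k / 2 ^ n) x‖ₑ ^ p ∂P ≤
        N * C * ENNReal.ofReal ((3 / 4) ^ n) := by
      intro n
      rw [lintegral_finsetSum' _ fun k _ => hm n k]
      have hk : ∀ k ∈ Finset.range (N * 2 ^ n), ∫⁻ x, (3 / 2 : ℝ≥0∞) ^ n *
          ‖X ((k + 1 : ℕ) / 2 ^ n) x - X (k / 2 ^ n) x‖ₑ ^ p ∂P ≤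
          (3 / 2 : ℝ≥0∞) ^ n * (C * ENNReal.ofReal ((1 / 4) ^ n)) := by
        intro k hk
        have hk' : k + 1 ≤ N * 2 ^ n := Finset.mem_range.1 hk
        have hk2 : ((k + 1 : ℕ) : ℝ) ≤ N * 2 ^ n := by exact_mod_cast hk'
        have hk1 : (k : ℝ) ≤ N * 2 ^ n := by
          push_cast at hk2
          linarith
        have hmk : AEMeasurable (fun x =>
            ‖X ((k + 1 : ℕ) / 2 ^ n) x - X (k / 2 ^ n) x‖ₑ ^ p) P :=
          ((hX _).sub (hX _)).enorm.pow_const p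
        rw [lintegral_const_mul'' _ hmk]
        gcongr
        refine (h _ ⟨by positivity, ?_⟩ _ ⟨by positivity, ?_⟩).trans_eq ?_
        · rwa [div_le_iff₀ (by positivity)]
        · rwa [div_le_iff₀ (by positivity)]
        · congr 2
          have h4 : (4 : ℝ) = 2 ^ 2 := by norm_num
          push_cast
          rw [← sub_div, add_sub_cancel_left, div_pow, div_pow, one_pow, one_pow, h4, ← pow_mul,
            ← pow_mul, mul_comm]
      refine (Finset.sum_le_sum hk).trans_eq ?_
      have h32 : (3 / 2 : ℝ≥0∞) = ENNReal.ofReal (3 / 2) := by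
        rw [ENNReal.ofReal_div_of_pos two_pos]
        simp
      have h2 : ((2 : ℕ) : ℝ≥0∞) = ENNReal.ofReal 2 := by simp
      rw [Finset.sum_const, Finset.card_range, nsmul_eq_mul, Nat.cast_mul, Nat.cast_pow, h32, h2,
        ← ENNReal.ofReal_pow (by norm_num), ← ENNReal.ofReal_pow (by norm_num)]
      have h34 : ((3 : ℝ) / 4) ^ n = 2 ^ n * ((3 / 2) ^ n * (1 / 4) ^ n) := by
        rw [← mul_pow, ← mul_pow]
        norm_num
      rw [h34, ENNReal.ofReal_mul (by positivity), ENNReal.ofReal_mul (by positivity)]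
      ring
    refine ((ENNReal.tsum_le_tsum hle).trans_lt ?_).ne
    rw [ENNReal.tsum_mul_left]
    refine ENNReal.mul_lt_top (ENNReal.mul_lt_top (by simp) hC.lt_top) ?_
    rw [← ENNReal.ofReal_tsum_of_nonneg (fun n => by positivity)
      (summable_geometric_of_lt_one (by norm_num) (by norm_num))]
    exact ENNReal.ofReal_lt_top
  filter_upwards [ae_lt_top' (AEMeasurable.tsum fun n =>
    Finset.aemeasurable_fun_sum _ fun k _ => hm n k) hfin] with x hx using hx.ne

/-- A single term is at most the finite sum `S`, so an increment to the power `p` is at most `S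
(2/3)ⁿ`; the `p`-th root gives the geometric rate. -/
theorem KolmogorovBound.ae_dyadicDecay {X : ℝ → Ω → E} {p : ℝ} (hp : 0 < p)
    (hX : ∀ t, AEStronglyMeasurable (X t) P) (hb : KolmogorovBound X p P) :
    ∀ᵐ x ∂P, DyadicDecay fun t => X t x := by
  filter_upwards [ae_all_iff.2 (ae_tsum_increments_ne_top hX hb)] with x hx N
  set S := ∑' n : ℕ, ∑ k ∈ Finset.range (N * 2 ^ n), (3 / 2 : ℝ≥0∞) ^ n *
      ‖X ((k + 1 : ℕ) / 2 ^ n) x - X (k / 2 ^ n) x‖ₑ ^ p with hS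
  have hSx : S ≠ ∞ := hx N
  refine ⟨S.toReal ^ (1 / p), (2 / 3 : ℝ) ^ (1 / p), by positivity, by positivity,
    Real.rpow_lt_one (by norm_num) (by norm_num) (by positivity), fun n k hk => ?_⟩
  have h1 : (3 / 2 : ℝ≥0∞) ^ n * ‖X ((k + 1 : ℕ) / 2 ^ n) x - X (k / 2 ^ n) x‖ₑ ^ p ≤ S :=
    (Finset.single_le_sum (f := fun k : ℕ => (3 / 2 : ℝ≥0∞) ^ n *
      ‖X ((k + 1 : ℕ) / 2 ^ n) x - X (k / 2 ^ n) x‖ₑ ^ p) (fun _ _ => zero_le)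
      (Finset.mem_range.2 hk)).trans (ENNReal.le_tsum n)
  have h2 := ENNReal.toReal_mono hSx h1
  rw [ENNReal.toReal_mul, ENNReal.toReal_pow, ← ENNReal.toReal_rpow, toReal_enorm,
    ENNReal.toReal_div] at h2
  norm_num at h2
  set a := ‖X ((k + 1 : ℝ) / 2 ^ n) x - X (k / 2 ^ n) x‖ with ha
  have h3 : a ^ p ≤ S.toReal * (2 / 3) ^ n := by
    have h4 : ((2 : ℝ) / 3) ^ n * (3 / 2) ^ n = 1 := by
      rw [← mul_pow]
      norm_num
    calc a ^ p = (2 / 3) ^ n * ((3 / 2) ^ n * a ^ p) := by rw [← mul_assoc, h4, one_mul]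
      _ ≤ (2 / 3) ^ n * S.toReal := by gcongr
      _ = _ := mul_comm _ _
  have h5 := Real.rpow_le_rpow (by positivity) h3 (by positivity : 0 ≤ 1 / p)
  rw [← Real.rpow_mul (norm_nonneg _), mul_one_div_cancel hp.ne', Real.rpow_one,
    Real.mul_rpow (by positivity) (by positivity), ← Real.rpow_pow_comm (by norm_num)] at h5
  push_cast
  exact h5

/-- The moment bound gives convergence of the approximations in `p`-th mean. This identifies the
pathwise limit with the original variable. -/
theorem KolmogorovBound.tendstoInMeasure {X : ℝ → Ω → E} {p : ℝ} (hp : 0 < p)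
    (hX : ∀ t, AEStronglyMeasurable (X t) P) (hb : KolmogorovBound X p P) {t : ℝ} (ht : 0 ≤ t) :
    TendstoInMeasure P (fun n x => dyadicApprox (fun s => X s x) n t) atTop (X t) := by
  obtain ⟨N, hN⟩ := exists_nat_ge t
  obtain ⟨C, hC, h⟩ := hb N
  refine tendstoInMeasure_of_tendsto_eLpNorm (p := ENNReal.ofReal p) (by simpa using hp)
    (fun n => hX _) (hX t) ?_
  have h1 : Tendsto (fun n : ℕ => (⌊2 ^ n * t⌋₊ / 2 ^ n - t : ℝ) ^ 2) atTop (𝓝 0) := by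
    simpa using ((tendsto_floor_two_pow_div ht).sub_const t).pow 2
  have h2 : Tendsto (fun n : ℕ => C * ENNReal.ofReal ((⌊2 ^ n * t⌋₊ / 2 ^ n - t : ℝ) ^ 2)) atTop
      (𝓝 0) := by
    simpa using ENNReal.Tendsto.const_mul (ENNReal.tendsto_ofReal h1) (Or.inr hC)
  have h3 := h2.ennrpow_const (1 / p)
  rw [ENNReal.zero_rpow_of_pos (by positivity)] at h3
  refine tendsto_of_tendsto_of_tendsto_of_le_of_le tendsto_const_nhds h3 (fun _ => zero_le)
    fun n => ?_
  rw [eLpNorm_eq_lintegral_rpow_enorm_toReal (by simpa using hp) (by simp),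
    ENNReal.toReal_ofReal hp.le]
  exact ENNReal.rpow_le_rpow (h t ⟨ht, hN⟩ _ ⟨by positivity, (floor_two_pow_div_le ht n).trans hN⟩)
    (by positivity)

/-- The Kolmogorov continuity criterion: existence of a continuous modification. -/
theorem KolmogorovBound.exists_modification [CompleteSpace E] [MeasurableSpace E] [BorelSpace E]
    {X : ℝ → Ω → E} {p : ℝ} (hp : 0 < p)
    (hX : ∀ t, StronglyMeasurable (X t)) (hb : KolmogorovBound X p P) :
    ∃ Y : ℝ → Ω → E, (∀ t, 0 ≤ t → Measurable (Y t)) ∧ (∀ t, 0 ≤ t → Y t =ᵐ[P] X t) ∧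
      ∀ x, ContinuousOn (fun t => Y t x) (Set.Ici 0) := by
  obtain ⟨G, hG, hGm, hGd⟩ :=
    (hb.ae_dyadicDecay hp fun t => (hX t).aestronglyMeasurable).exists_measurable_mem
  -- Off the good event `G` the path is set to zero, so every path is continuous and not merely
  -- almost every one.
  set Y : ℝ → Ω → E := fun t => G.indicator fun x =>
    limUnder atTop fun n => dyadicApprox (fun s => X s x) n t with hY
  have hlim : ∀ t, 0 ≤ t → ∀ x ∈ G,
      Tendsto (fun n => dyadicApprox (fun s => X s x) n t) atTop (𝓝 (Y t x)) := by
    intro t ht x hx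
    rw [hY]
    simp only [Set.indicator_of_mem hx]
    exact tendsto_nhds_limUnder ((hGd x hx).exists_tendsto ht)
  refine ⟨Y, fun t ht => ?_, fun t ht => ?_, fun x => ?_⟩
  · refine measurable_of_tendsto_metrizable
      (f := fun n => G.indicator fun x => dyadicApprox (fun s => X s x) n t)
      (fun n => (hX _).measurable.indicator hGm) (tendsto_pi_nhds.2 fun x => ?_)
    by_cases hx : x ∈ G
    · simpa only [Set.indicator_of_mem hx] using hlim t ht x hx
    · simp only [hY, Set.indicator_of_notMem hx]
      exact tendsto_const_nhds
  -- A subsequence converges almost surely to `X t`, while on `G` the whole sequence converges to `Y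
  -- t`.
  · obtain ⟨ns, hns, hae⟩ := (hb.tendstoInMeasure hp
      (fun t => (hX t).aestronglyMeasurable) ht).exists_seq_tendsto_ae
    filter_upwards [hae, hG] with x h1 hx
    exact tendsto_nhds_unique ((hlim t ht x hx).comp hns.tendsto_atTop) h1
  · by_cases hx : x ∈ G
    · exact (hGd x hx).continuousOn fun t ht => hlim t ht x hx
    · simp only [hY, Set.indicator_of_notMem hx]
      exact continuousOn_const

end Modification

/-! ### Moment bounds for the position process. -/

section Position

variable {Ω : Type*} [MeasurableSpace Ω] {P : Measure Ω} {ν : Measure ℝ} {ξ : RandomMeasure ν P}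

theorem RandomMeasure.sq_norm_position_sub_le (hν : ν ≪ volume) {ρ : ℝ} (hρ : 0 ≤ ρ)
    (hρ2 : ρ ≤ 2) (hw : Integrable (weight (2 - ρ)) ν) {T s t : ℝ} (hs : s ∈ Set.Icc 0 T)
    (ht : t ∈ Set.Icc 0 T) :
    ‖ξ.position t - ξ.position s‖ ^ 2 ≤
      (max 4 (T ^ (2 - ρ)) * ∫ ω, weight (2 - ρ) ω ∂ν) * |t - s| ^ ρ := by
  rw [ξ.position_sub hν (memLp_intervalFourier hρ hρ2 hw) hs.1 ht.1, ξ.norm_stochInt]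
  exact sq_norm_toLp_intervalFourier_le hρ hρ2 hw (memLp_intervalFourier hρ hρ2 hw)
    (abs_sub_le_iff.2 ⟨by linarith [hs.1, ht.2], by linarith [ht.1, hs.2]⟩)

/-- The `L²` size of an increment is of order `|t-s|^{ρ/2}`. The moment `4/ρ` is the one that turns
this into `|t-s|²`. -/
theorem RandomMeasure.IsGaussian.kolmogorovBound_position (hξ : ξ.IsGaussian) (hν : ν ≪ volume)
    {ρ : ℝ} (hρ : 0 < ρ) (hρ2 : ρ ≤ 2) (hw : Integrable (weight (2 - ρ)) ν) :
    KolmogorovBound (fun t => ⇑(ξ.position t)) (4 / ρ) P := by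
  intro N
  have hp0 : 0 < 4 / ρ := by positivity
  have hp1 : 1 ≤ 4 / ρ := by
    rw [le_div_iff₀ hρ]
    linarith
  obtain ⟨C, hC, hmom⟩ := exists_eLpNorm_le_of_hasGaussianLaw (P := P)
    (p := ENNReal.ofReal (4 / ρ)) (by simpa using hp1) (by simp)
  set B := max 4 ((N : ℝ) ^ (2 - ρ)) * ∫ ω, weight (2 - ρ) ω ∂ν
  refine ⟨C ^ (4 / ρ) * ENNReal.ofReal (B ^ (2 / ρ)), by finiteness, fun s hs t ht => ?_⟩
  have h1 := hξ.eLpNorm_stochInt_le hmom hC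
    ((memLp_intervalFourier hρ.le hρ2 hw s t).star.toLp)
  have hsub := ξ.position_sub hν (memLp_intervalFourier hρ.le hρ2 hw) hs.1 ht.1
  have hn := ξ.norm_stochInt ((memLp_intervalFourier hρ.le hρ2 hw s t).star.toLp)
  rw [← hsub] at h1 hn
  have h2 : ∫⁻ x, ‖ξ.position t x - ξ.position s x‖ₑ ^ (4 / ρ) ∂P
      = eLpNorm (ξ.position t - ξ.position s : Lp ℂ 2 P) (ENNReal.ofReal (4 / ρ)) P ^ (4 / ρ) := by
    rw [eLpNorm_eq_lintegral_rpow_enorm_toReal (by simpa using hp0) (by simp),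
      ENNReal.toReal_ofReal hp0.le, ← ENNReal.rpow_mul, one_div_mul_cancel hp0.ne',
      ENNReal.rpow_one]
    refine lintegral_congr_ae ?_
    filter_upwards [Lp.coeFn_sub (ξ.position t) (ξ.position s)] with x hx
    rw [hx, Pi.sub_apply]
  have h3 := RandomMeasure.sq_norm_position_sub_le (ξ := ξ) hν hρ.le hρ2 hw hs ht
  set z := ‖ξ.position t - ξ.position s‖ with hz
  have hB : 0 ≤ B := mul_nonneg (le_max_of_le_left (by norm_num))
    (integral_nonneg fun ω => weight_nonneg _ ω)
  have h4 : z ^ (4 / ρ) ≤ B ^ (2 / ρ) * (t - s) ^ 2 := by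
    have h5 := Real.rpow_le_rpow (by positivity) h3 (by positivity : 0 ≤ 2 / ρ)
    rw [Real.mul_rpow hB (by positivity), ← Real.rpow_mul (abs_nonneg _),
      mul_div_cancel₀ _ hρ.ne', ← Real.rpow_natCast, ← Real.rpow_mul (norm_nonneg _),
      Real.rpow_two, sq_abs] at h5
    have h6 : ((2 : ℕ) : ℝ) * (2 / ρ) = 4 / ρ := by
      push_cast
      ring
    rwa [h6] at h5
  rw [h2]
  calc _ ≤ (C * ‖((memLp_intervalFourier hρ.le hρ2 hw s t).star.toLp : Lp ℂ 2 ν)‖ₑ) ^ (4 / ρ) :=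
        ENNReal.rpow_le_rpow h1 hp0.le
    _ = C ^ (4 / ρ) * ENNReal.ofReal (z ^ (4 / ρ)) := by
        rw [ENNReal.mul_rpow_of_nonneg _ _ hp0.le, ← ofReal_norm, ← hn,
          ENNReal.ofReal_rpow_of_nonneg (norm_nonneg _) hp0.le]
    _ ≤ C ^ (4 / ρ) * ENNReal.ofReal (B ^ (2 / ρ) * (t - s) ^ 2) := by gcongr
    _ = _ := by rw [ENNReal.ofReal_mul (by positivity), mul_assoc]

end Position

end GLE
-- The main theorem.
theorem mainTheorem12 {Ω Ω' : Type*} [MeasurableSpace Ω] [MeasurableSpace Ω']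
    (P : Measure Ω) [IsProbabilityMeasure P] (Q : Measure Ω') [IsProbabilityMeasure Q]
    (K : ℝ → ℝ) (β σ : ℝ) (hβ : 0 < β)
    (hK : GLE.KernelAssumption K) (hconv : GLE.ConvexKernel K)
    (hσ : GLE.FiniteAtZero K σ ∨ GLE.InfiniteAtZero K (1 - σ))
    (W F : 𝓢(ℝ, ℝ) →ₗ[ℝ] Lp ℂ 2 Q) (hW : GLE.IsWhiteNoise W) (hF : GLE.HasCovariance F K)
    (ν : Measure ℝ) (ξ : GLE.RandomMeasure ν P) (hξ : ξ.IsGaussian)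
    (hV : GLE.IsWeakSolution 0 0 β K W F ξ) :
    -- the velocity is not defined pointwise in time, but the position is
    (∀ t : ℝ, TemperedDistribution.delta t ∉ GLE.Dom ν) ∧
    (∀ t : ℝ, 0 ≤ t → GLE.FunInDom ν ((Set.Icc 0 t).indicator fun _ => 1)) ∧
    -- second moments of the increments of the position
    (∀ T : ℝ, 0 < T → ∃ C : ℝ, 0 < C ∧ ∀ s ∈ Set.Icc 0 T, ∀ t ∈ Set.Icc 0 T,
      ∫ x, ‖ξ.position t x - ξ.position s x‖ ^ 2 ∂P ≤ C * |t - s| ^ ((1 - σ) / 2)) ∧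
    -- the position process has a version with continuous paths
    (∃ X : ℝ → Ω → ℂ, (∀ t, 0 ≤ t → Measurable (X t)) ∧
      (∀ t, 0 ≤ t → X t =ᵐ[P] ξ.position t) ∧
      ∀ x, ContinuousOn (fun t => X t x) (Set.Ici 0)) := by
  obtain ⟨A, c, M, hA, hc, hb⟩ := GLE.spectral_bounds hK hconv hσ
  have hσ' : 0 < σ ∧ σ < 1 := by
    rcases hσ with h | h
    · exact ⟨h.pos, h.lt_one⟩
    · exact ⟨by linarith [h.lt_one], by linarith [h.pos]⟩
  have hν := hV.absolutelyContinuous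
  have := GLE.isLocallyFiniteMeasure_of_tempered hV.tempered
  have hdens := (hK.decayingKernel hconv).density_bounds hβ hK.symm hF hV hA hc hb
  have hinf : ¬ IsFiniteMeasure ν :=
    GLE.not_isFiniteMeasure_of_density (c := 2 / (Real.pi * β) * c)
      (by have := Real.pi_pos; positivity) (hdens.mono fun _ h hω => (h hω).1)
  -- Integrability of the weight needs `2 - ρ > 1 + σ`, that is `ρ < 1 - σ`; half of that bound
  -- leaves a strict margin.
  set ρ : ℝ := (1 - σ) / 2 with hρdef
  have hρ : 0 < ρ := by linarith [hσ'.2]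
  have hρ2 : ρ ≤ 2 := by linarith [hσ'.1]
  have hw : Integrable (GLE.weight (2 - ρ)) ν :=
    GLE.integrable_weight_of_density hν hA (by linarith [hσ'.2])
      (hdens.mono fun _ h hω => (h hω).2)
  refine ⟨GLE.delta_notMem_dom hν hinf, fun t ht => ⟨GLE.isTempered_indicator t,
    GLE.intervalFourier 0 t, GLE.isFourierFunction_indicator ht,
    GLE.memLp_intervalFourier hρ.le hρ2 hw 0 t⟩, fun T _ => ?_, ?_⟩
  · have hI : 0 ≤ ∫ ω, GLE.weight (2 - ρ) ω ∂ν := integral_nonneg fun ω => GLE.weight_nonneg _ ω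
    -- The integral of the weight is only known here to be nonnegative; adding `1` makes the
    -- constant strictly positive.
    refine ⟨max 4 (T ^ (2 - ρ)) * (∫ ω, GLE.weight (2 - ρ) ω ∂ν) + 1, by positivity,
      fun s hs t ht => ?_⟩
    rw [GLE.integral_norm_sub_sq_eq]
    refine (GLE.RandomMeasure.sq_norm_position_sub_le hν hρ.le hρ2 hw hs ht).trans ?_
    gcongr
    exact le_add_of_nonneg_right zero_le_one
  · exact (hξ.kolmogorovBound_position hν hρ hρ2 hw).exists_modification (by positivity)
      fun t => Lp.stronglyMeasurable _
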